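/- For an even integer $k \ge 4$ and $z$ in the upper half-plane $\mathbb{H}$, let $E_k(z) = \frac12 \sum_{\gcd(c,d)=1} (cz+d)^{-k}$ be the normalized Eisenstein series of weight $k$ for $\mathrm{SL}_2(\mathbb{Z})$, and let $$E_{k,5}^{*}(z) := \frac{1}{5^{k/2}+1}\left(5^{k/2} E_k(5z) + E_k(z)\right)$$ be the Eisenstein series associated with the Fricke group $\Gamma_0^{*}(5)$. Let $$\mathbb{F}^{*}(5) := \left\{z \in \mathbb{H} : |z| \ge \tfrac{1}{\sqrt5},\ |z+\tfrac12| \ge \tfrac{1}{2\sqrt5},\ -\tfrac12 \le \mathrm{Re}(z) \le 0\right\} \cup \left\{z \in \mathbb{H} : |z| > \tfrac{1}{\sqrt5},\ |z-\tfrac12| > \tfrac{1}{2\sqrt5},\ 0 \le \mathrm{Re}(z) < \tfrac12\right\},$$ a fundamental domain for $\Gamma_0^{*}(5)$, and let $A_5^{*} := \mathbb{F}^{*}(5) \cap \left\{z \in \mathbb{C} : |z| = \tfrac{1}{\sqrt5} \text{ or } |z+\tfrac12| = \tfrac{1}{2\sqrt5}\right\}$. **Proposition.** Let $k \ge 4$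 be an even integer. Then all but at most $2$ of the zeros of $E_{k,5}^{*}$ in $\mathbb{F}^{*}(5)$, counted with multiplicity, lie on the arc $A_5^{*}$; that is, $E_{k,5}^{*}$ has only finitely many zeros in $\mathbb{F}^{*}(5) \setminus A_5^{*}$, and the sum of their multiplicities is at most $2$. -/

import Mathlib

open UpperHalfPlane

noncomputable section

/-- The Eisenstein series
`E*_{k,p}(z) = (p^{k/2} E_k(pz) + E_k(z)) / (p^{k/2} + 1)` of even weight `k` associated with the
Fricke group `Γ₀*(p)`, where `E_k` is the level one Eisenstein series with constant term `1`.
It is written as a function of a complex variable; only its values for `0 < Im z`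
are meaningful, and there `ofComplex w` is just `w` seen as a point of the upper half-plane. -/
def frickeEisenstein (p : ℕ) {k : ℕ} (hk : 3 ≤ k) (z : ℂ) : ℂ :=
  1 / ((p : ℂ) ^ (k / 2) + 1) *
    ((p : ℂ) ^ (k / 2) * ModularForm.E hk (ofComplex ((p : ℂ) * z)) +
      ModularForm.E hk (ofComplex z))

/-- The fundamental domain `𝔽*(p)` (for `p = 5, 7`) of the Fricke group `Γ₀*(p)`. -/
def frickeDomain (p : ℕ) : Set ℂ :=
  {z | 0 < z.im ∧ 1 / √p ≤ ‖z‖ ∧ 1 / (2 * √p) ≤ ‖z + 1 / 2‖ ∧ -(1 / 2) ≤ z.re ∧ z.re ≤ 0} ∪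
  {z | 0 < z.im ∧ 1 / √p < ‖z‖ ∧ 1 / (2 * √p) < ‖z - 1 / 2‖ ∧ 0 ≤ z.re ∧ z.re < 1 / 2}

/-- The arc `A*_p`: the part of `𝔽*(p)` on the circles `|z| = 1/√p` and
`|z + 1/2| = 1/(2√p)`. -/
def frickeArc (p : ℕ) : Set ℂ :=
  frickeDomain p ∩ {z | ‖z‖ = 1 / √p ∨ ‖z + 1 / 2‖ = 1 / (2 * √p)}

/-- `E*_{k,p}` is analytic at every point of the upper half-plane, so that its order of vanishing
there (`analyticOrderAt`) has its usual meaning. -/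
theorem frickeEisenstein_analyticAt {p : ℕ} (hp : 0 < p) {k : ℕ} (hk : 3 ≤ k) {z : ℂ}
    (hz : 0 < z.im) : AnalyticAt ℂ (frickeEisenstein p hk) z := by
  have hE : DifferentiableOn ℂ (fun w : ℂ => ModularForm.E hk (ofComplex w)) {w | 0 < w.im} :=
    UpperHalfPlane.mdifferentiable_iff.mp (ModularForm.E hk).holo'
  have hopen : IsOpen {w : ℂ | 0 < w.im} := isOpen_upperHalfPlaneSet
  have hpim : ∀ w : ℂ, 0 < w.im → 0 < ((p : ℂ) * w).im := by
    intro w hw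
    have : (0 : ℝ) < p := by exact_mod_cast hp
    simpa using mul_pos this hw
  have hEp : DifferentiableOn ℂ (fun w : ℂ => ModularForm.E hk (ofComplex ((p : ℂ) * w)))
      {w | 0 < w.im} :=
    hE.comp (f := fun w : ℂ => (p : ℂ) * w) (by fun_prop) (fun w hw => hpim w hw)
  have hall : DifferentiableOn ℂ (frickeEisenstein p hk) {w | 0 < w.im} :=
    ((hEp.const_mul _).add hE).const_mul _
  exact hall.analyticAt (hopen.mem_nhds hz)

end

/-! Two counts are compared: an upper bound for the total order of vanishing at non-elliptic points,
and a lower bound for the number of zeros on the arcs.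

Upper bound. Let J be `hauptmodul`, that is `E*_{4,5} / (η(z)η(5z))^4`. It is invariant, has a
simple pole at the cusp, and is real on the mirrors bounding `leftHalf`. The minimum principle gives
`Im J > 0` on `leftHalf`. Moving up from a mirror therefore cannot decrease `Im J`, so `Re J' ≥ 0`
on the boundary, and the minimum principle applied to `J'` gives `Re J' > 0` inside. Hence the level
curves of `Im J` are graphs over `Re z` along which `Re J` increases, and J is injective on
`leftHalf`. By reflection and monotonicity along the boundary it is injective with nonzero
derivative on `regularSet`, which omits the three elliptic points (`hauptmodul_injOn_regularSet`,
`deriv_hauptmodul_ne_zero`). This takes the place of a contour-integral valence formula. The square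
of `E*_{k,5}` divided by `(η(z)η(5z))^(2k)` is a polynomial in J of degree at most `k/2`, so twice
the orders of vanishing over `regularSet` sum to at most `k/2`
(`exists_polynomial_rootMultiplicity`).

Lower bound. With `k = 2j`, on either arc `E*_{k,5}(z)` is a nonvanishing factor times the real
number `Re(e^{ijθ} E_k(5z))`, where θ is the angle on the circle. At `θ = πm/j` the exponential is
`(-1)^m`, so `|E_k(5z) - 1| < 1` fixes the sign there and forces a zero between consecutive samples.
The estimate holds for `k ≥ 12` at angular distance at least `π/(2k)` from the corner where the arcs
meet (`EstimateRegion.norm_sub_one_lt`). Counting samples gives a set Z of zeros on the open arcs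
with `k/2 ≤ 2|Z| + 5` (`exists_zeros_arcs`).

The zeros off the arc lie in `regularSet` and are disjoint from Z, so twice their total order is at
most 5, and the total order is at most 2. -/

noncomputable section

open Complex Filter Topology Set
open scoped ComplexConjugate

/-! ### Complex-analytic tools and the half fundamental domain -/

/-- An analytic function with nonnegative imaginary part on a half-plane near a boundary point, at
which it is real, has nonzero derivative there unless it is locally constant. -/
theorem deriv_ne_zero_of_im_nonneg_on_halfPlane {f : ℂ → ℂ} {z₀ w : ℂ} (hf : AnalyticAt ℂ f z₀)
    (h0 : (f z₀).im = 0) (hw : w ≠ 0)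
    (hnn : ∀ᶠ z in 𝓝 z₀, 0 < ((z - z₀) * conj w).re → 0 ≤ (f z).im)
    (hnc : ¬ ∀ᶠ z in 𝓝 z₀, f z = f z₀) : deriv f z₀ ≠ 0 := by
  intro hd
  have hg : AnalyticAt ℂ (fun z => f z - f z₀) z₀ := hf.sub analyticAt_const
  obtain ⟨n, g, hga, hg0, hev⟩ := hg.exists_eventuallyEq_pow_smul_nonzero_iff.mpr (by
    intro h; exact hnc (h.mono fun z hz => sub_eq_zero.mp hz))
  have hn0 : n ≠ 0 := by
    rintro rfl
    have := hev.self_of_nhds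
    simp only [sub_self, pow_zero, smul_eq_mul, one_mul] at this
    exact hg0 this.symm
  have hn1 : n ≠ 1 := by
    rintro rfl
    have h1 : HasDerivAt (fun z => (z - z₀) ^ 1 • g z) (g z₀) z₀ := by
      have := ((hasDerivAt_id z₀).sub_const z₀).mul hga.differentiableAt.hasDerivAt
      simpa [smul_eq_mul] using! this
    have h2 : HasDerivAt (fun z => f z - f z₀) (g z₀) z₀ := h1.congr_of_eventuallyEq hev
    have h3 : HasDerivAt (fun z => f z - f z₀) 0 z₀ := by
      have := hf.differentiableAt.hasDerivAt.sub_const (f z₀)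
      rwa [hd] at this
    exact hg0 (h2.unique h3)
  -- Shrinking towards `z₀` in the direction `u` leaves only the leading term.
  have key : ∀ u : ℂ, 0 < (u * conj w).re → 0 ≤ (u ^ n * g z₀).im := by
    intro u hu
    have hlim : Tendsto (fun r : ℝ => z₀ + r * u) (𝓝[>] 0) (𝓝 z₀) := by
      have : Continuous fun r : ℝ => z₀ + r * u := by fun_prop
      have h := this.tendsto 0
      simp only [ofReal_zero, zero_mul, add_zero] at h
      exact h.mono_left nhdsWithin_le_nhds
    have hlim2 : Tendsto (fun r : ℝ => (u ^ n * g (z₀ + r * u)).im) (𝓝[>] 0)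
        (𝓝 (u ^ n * g z₀).im) :=
      (Complex.continuous_im.tendsto _).comp ((hga.continuousAt.tendsto.comp hlim).const_mul _)
    refine ge_of_tendsto hlim2 ?_
    filter_upwards [hlim.eventually hnn, hlim.eventually hev, self_mem_nhdsWithin] with r h1 h2 hr
    have hr : 0 < r := hr
    have h3 : 0 ≤ (f (z₀ + r * u)).im := by
      apply h1
      have : (z₀ + r * u - z₀) * conj w = r * (u * conj w) := by ring
      rw [this, re_ofReal_mul]
      positivity
    have h4 : (f (z₀ + r * u) - f z₀).im = r ^ n * (u ^ n * g (z₀ + r * u)).im := by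
      rw [h2, add_sub_cancel_left, mul_pow, smul_eq_mul, mul_assoc, ← ofReal_pow, im_ofReal_mul]
    rw [sub_im, h0, sub_zero] at h4
    rw [h4] at h3
    exact nonneg_of_mul_nonneg_right h3 (by positivity)
  set b := w ^ n * g z₀ with hb
  have hb0 : b ≠ 0 := mul_ne_zero (pow_ne_zero _ hw) hg0
  have hn2 : (2 : ℝ) ≤ n := by
    have : 2 ≤ n := by omega
    exact_mod_cast this
  have hn' : (n : ℝ) ≠ 0 := by positivity
  -- Since `n ≥ 2`, turning `w` by `s / n` with `|s| < π` stays inside the half-plane, while the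
  -- `n`-th power turns by the full `s`.
  have key2 : ∀ s : ℝ, |s| < Real.pi → 0 ≤ (b * exp (s * Complex.I)).im := by
    intro s hs
    have h := key (w * exp ((s / n : ℝ) * Complex.I)) (by
      have : w * exp ((s / n : ℝ) * Complex.I) * conj w =
          (normSq w : ℝ) * exp ((s / n : ℝ) * Complex.I) := by
        rw [← mul_conj]; ring
      rw [this, re_ofReal_mul, exp_ofReal_mul_I_re]
      apply mul_pos (normSq_pos.mpr hw)
      apply Real.cos_pos_of_mem_Ioo
      rw [Set.mem_Ioo, ← abs_lt, abs_div, abs_of_pos (by positivity : (0:ℝ) < n),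
        div_lt_iff₀ (by positivity)]
      nlinarith [Real.pi_pos])
    have h2 : (w * exp ((s / n : ℝ) * Complex.I)) ^ n * g z₀ = b * exp (s * Complex.I) := by
      rw [mul_pow, ← exp_nat_mul, hb]
      have : (n : ℂ) * ((s / n : ℝ) * Complex.I) = s * Complex.I := by
        push_cast
        have : (n : ℂ) ≠ 0 := by exact_mod_cast hn'
        field_simp
      rw [this]; ring
    rwa [h2] at h
  have hpi := Real.pi_pos
  -- The angles `±π/2` force `Re b = 0`; the angles `0` and `3π/4` then force `Im b = 0`.
  have e1 := key2 (Real.pi / 2) (by rw [abs_of_pos (by positivity)]; linarith)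
  have e2 := key2 (-(Real.pi / 2)) (by rw [abs_neg, abs_of_pos (by positivity)]; linarith)
  have e3 := key2 0 (by simpa using hpi)
  have e4 := key2 (Real.pi - Real.pi / 4) (by rw [abs_of_pos (by linarith)]; linarith)
  rw [mul_im, exp_ofReal_mul_I_re, exp_ofReal_mul_I_im] at e1 e2 e3 e4
  simp only [Real.cos_pi_div_two, Real.sin_pi_div_two, Real.cos_neg, Real.sin_neg, Real.cos_zero,
    Real.sin_zero, Real.cos_pi_sub, Real.sin_pi_sub, Real.cos_pi_div_four,
    Real.sin_pi_div_four] at e1 e2 e3 e4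
  have hre : b.re = 0 := by linarith
  rw [hre] at e4
  have him : b.im = 0 := by
    have : 0 < √2 / 2 := by positivity
    nlinarith
  exact hb0 (Complex.ext hre him)

/-- The interior of the left half of the fundamental domain of `Γ₀*(5)`. -/
def leftHalf : Set ℂ :=
  {z | -(1 / 2) < z.re ∧ z.re < 0 ∧ 1 / 5 < z.re ^ 2 + z.im ^ 2 ∧
    1 / 20 < (z.re + 1 / 2) ^ 2 + z.im ^ 2 ∧ 0 < z.im}

/-- The left half of the fundamental domain of `Γ₀*(5)`, with its boundary. -/
def leftHalfClosed : Set ℂ :=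
  {z | -(1 / 2) ≤ z.re ∧ z.re ≤ 0 ∧ 1 / 5 ≤ z.re ^ 2 + z.im ^ 2 ∧
    1 / 20 ≤ (z.re + 1 / 2) ^ 2 + z.im ^ 2 ∧ 0 < z.im}

/-- The lines and circles that carry the boundary of `leftHalf`. -/
def mirrorSet : Set ℂ :=
  {z | z.re = 0 ∨ z.re = -(1 / 2) ∨ z.re ^ 2 + z.im ^ 2 = 1 / 5 ∨
    (z.re + 1 / 2) ^ 2 + z.im ^ 2 = 1 / 20}

theorem isOpen_leftHalf : IsOpen leftHalf := by
  unfold leftHalf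
  refine (isOpen_lt continuous_const Complex.continuous_re).inter
    ((isOpen_lt Complex.continuous_re continuous_const).inter
    ((isOpen_lt continuous_const ((Complex.continuous_re.pow 2).add (Complex.continuous_im.pow 2))).inter
    ((isOpen_lt continuous_const (((Complex.continuous_re.add continuous_const).pow 2).add (Complex.continuous_im.pow 2))).inter
    (isOpen_lt continuous_const Complex.continuous_im))))

theorem leftHalf_subset_closed : leftHalf ⊆ leftHalfClosed :=
  fun _ ⟨h1, h2, h3, h4, h5⟩ => ⟨h1.le, h2.le, h3.le, h4.le, h5⟩

/-- The lowest point of the region is the corner `-2/5 + i/5`, where the two circles meet. This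
keeps closures of subsets of `leftHalf` off the real axis. -/
theorem one_fifth_le_im {x y : ℝ} (h1 : -(1 / 2) ≤ x) (h2 : x ≤ 0) (h3 : 1 / 5 ≤ x ^ 2 + y ^ 2)
    (h4 : 1 / 20 ≤ (x + 1 / 2) ^ 2 + y ^ 2) (h5 : 0 ≤ y) : 1 / 5 ≤ y := by
  by_contra! h
  have hy : y ^ 2 < 1 / 25 := by nlinarith
  rcases le_total x (-(2 / 5)) with hx | hx <;> nlinarith

theorem add_ofReal_mul_I_mem_leftHalf {z : ℂ} (hz : z ∈ leftHalfClosed) (h1 : -(1 / 2) < z.re)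
    (h2 : z.re < 0) {s : ℝ} (hs : 0 < s) : z + s * Complex.I ∈ leftHalf := by
  obtain ⟨-, -, h3, h4, h5⟩ := hz
  refine ⟨?_, ?_, ?_, ?_, ?_⟩ <;> simp <;> nlinarith

/-- A minimum principle on `leftHalf` for the real part of a holomorphic function. -/
theorem re_nonneg_of_boundary {g : ℂ → ℂ} (hg : DifferentiableOn ℂ g {z | 0 < z.im})
    (hb : ∀ z ∈ leftHalfClosed, z ∈ mirrorSet → 0 ≤ (g z).re)
    (htop : ∀ ε > 0, ∃ Y : ℝ, ∀ z : ℂ, Y ≤ z.im → -(1 / 2) ≤ z.re → z.re ≤ 0 → -ε ≤ (g z).re)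
    {z : ℂ} (hz : z ∈ leftHalf) : 0 ≤ (g z).re := by
  refine le_of_forall_pos_le_add fun ε hε => ?_
  obtain ⟨Y, hY⟩ := htop ε hε
  set Y' := max Y (z.im + 1)
  set U : Set ℂ := leftHalf ∩ {w | w.im < Y'} with hU
  have hUo : IsOpen U := isOpen_leftHalf.inter (isOpen_lt Complex.continuous_im continuous_const)
  have hcl : closure U ⊆ leftHalfClosed ∩ {w | w.im ≤ Y'} := by
    have hc : IsClosed {w : ℂ | -(1 / 2) ≤ w.re ∧ w.re ≤ 0 ∧ 1 / 5 ≤ w.re ^ 2 + w.im ^ 2 ∧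
        1 / 20 ≤ (w.re + 1 / 2) ^ 2 + w.im ^ 2 ∧ 0 ≤ w.im ∧ w.im ≤ Y'} := by
      refine (isClosed_le continuous_const Complex.continuous_re).inter
        ((isClosed_le Complex.continuous_re continuous_const).inter
        ((isClosed_le continuous_const ((Complex.continuous_re.pow 2).add (Complex.continuous_im.pow 2))).inter
        ((isClosed_le continuous_const (((Complex.continuous_re.add continuous_const).pow 2).add (Complex.continuous_im.pow 2))).inter
        ((isClosed_le continuous_const Complex.continuous_im).inter
        (isClosed_le Complex.continuous_im continuous_const)))))
    refine (closure_minimal ?_ hc).trans ?_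
    · rintro w ⟨⟨h1, h2, h3, h4, h5⟩, h6⟩
      exact ⟨h1.le, h2.le, h3.le, h4.le, h5.le, h6.le⟩
    · rintro w ⟨h1, h2, h3, h4, h5, h6⟩
      exact ⟨⟨h1, h2, h3, h4, by linarith [one_fifth_le_im h1 h2 h3 h4 h5]⟩, h6⟩
  have hbd : Bornology.IsBounded U := by
    refine (Metric.isBounded_closedBall (x := (0 : ℂ)) (r := 1 + |Y'|)).subset ?_
    rintro w ⟨⟨h1, h2, h3, h4, h5⟩, h6⟩
    rw [mem_closedBall_zero_iff]
    refine (norm_le_abs_re_add_abs_im w).trans (add_le_add ?_ ?_)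
    · rw [abs_le]; constructor <;> linarith
    · exact abs_le_abs h6.le (by
        have : w.im < Y' := h6
        linarith)
  -- The modulus of `exp (-g)` is `exp (-Re g)`, so the maximum modulus principle on the truncated
  -- region bounds `Re g` from below.
  have hd : DiffContOnCl ℂ (fun w => exp (-g w)) U := by
    refine DifferentiableOn.diffContOnCl ?_
    exact (hg.mono fun w hw => (hcl hw).1.2.2.2.2).neg.cexp
  have hC : ∀ w ∈ frontier U, ‖exp (-g w)‖ ≤ Real.exp ε := by
    intro w hw
    rw [norm_exp, neg_re, Real.exp_le_exp]
    rw [hUo.frontier_eq] at hw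
    obtain ⟨hw1, hw2⟩ := hw
    obtain ⟨hwD, hwY⟩ := hcl hw1
    by_cases hm : w ∈ mirrorSet
    · linarith [hb w hwD hm]
    · obtain ⟨h1, h2, h3, h4, h5⟩ := hwD
      simp only [mirrorSet, mem_ofPred_eq, not_or] at hm
      obtain ⟨m1, m2, m3, m4⟩ := hm
      have hYw : Y' ≤ w.im := by
        by_contra! hlt
        exact hw2 ⟨⟨lt_of_le_of_ne h1 (Ne.symm m2), lt_of_le_of_ne h2 m1,
          lt_of_le_of_ne h3 (Ne.symm m3), lt_of_le_of_ne h4 (Ne.symm m4), h5⟩, hlt⟩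
      linarith [hY w ((le_max_left _ _).trans hYw) h1 h2]
  have hzU : z ∈ closure U := subset_closure ⟨hz, by
    have : z.im + 1 ≤ Y' := le_max_right _ _
    show z.im < Y'
    linarith⟩
  have := Complex.norm_le_of_forall_mem_frontier_norm_le hbd hd hC hzU
  rw [norm_exp, neg_re, Real.exp_le_exp] at this
  linarith

theorem convex_upperHalfPlane : Convex ℝ {z : ℂ | 0 < z.im} := convex_halfSpace_im_gt 0

theorem isOpen_upperHalf : IsOpen {z : ℂ | 0 < z.im} := isOpen_lt continuous_const Complex.continuous_im

/-- A function with positive real part of its derivative on a convex set has difference quotients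
with positive real part. -/
theorem re_slope_pos_of_convex {f : ℂ → ℂ} {s : Set ℂ} (hs : Convex ℝ s)
    (hf : ∀ z ∈ s, HasDerivAt f (deriv f z) z)
    (hp : ∀ z ∈ s, 0 < (deriv f z).re) {z w : ℂ} (hz : z ∈ s) (hw : w ∈ s)
    (hne : z ≠ w) : 0 < ((f w - f z) / (w - z)).re := by
  have hwz : w - z ≠ 0 := sub_ne_zero.mpr hne.symm
  set φ : ℝ → ℝ := fun r => (f (z + r * (w - z)) / (w - z)).re
  have hmem : ∀ r ∈ Icc (0 : ℝ) 1, z + r * (w - z) ∈ s := by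
    intro r hr
    have := hs.add_smul_sub_mem hz hw hr
    simpa using this
  have hφ : ∀ r ∈ Icc (0 : ℝ) 1, HasDerivAt φ (deriv f (z + r * (w - z))).re r := by
    intro r hr
    have h1 : HasDerivAt (fun x : ℂ => z + x * (w - z)) (w - z) (r : ℂ) := by
      simpa using ((hasDerivAt_id (r : ℂ)).mul_const (w - z)).const_add z
    have h2 := ((hf _ (hmem r hr)).comp (r : ℂ) h1).div_const (w - z)
    have h3 := h2.real_of_complex
    simpa [hwz] using! h3
  have hmono : φ 0 < φ 1 := by
    obtain ⟨c, hc, hceq⟩ := exists_deriv_eq_slope φ (zero_lt_one)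
      (fun r hr => (hφ r hr).continuousAt.continuousWithinAt)
      (fun r hr => (hφ r (Ioo_subset_Icc_self hr)).differentiableAt.differentiableWithinAt)
    rw [(hφ c (Ioo_subset_Icc_self hc)).deriv] at hceq
    have := hp _ (hmem c (Ioo_subset_Icc_self hc))
    rw [hceq] at this
    simpa using this
  have : ((f w - f z) / (w - z)).re = φ 1 - φ 0 := by
    simp [φ, sub_div]
  rw [this]; linarith

/-- A continuous function that is strictly increasing to the right of each point near that point is
strictly increasing. -/
theorem lt_of_forall_eventually_lt {U : ℝ → ℝ} {a b : ℝ} (hab : a < b) (hU : ContinuousOn U (Icc a b))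
    (hloc : ∀ x ∈ Ico a b, ∀ᶠ y in 𝓝[>] x, U x < U y) : U a < U b := by
  -- A strict gain is secured at `c`; beyond it only the closed condition `U c ≤ U x` has to be
  -- propagated.
  obtain ⟨c, hac, hc⟩ : ∃ c ∈ Ioo a b, U a < U c := by
    have h1 := hloc a ⟨le_rfl, hab⟩
    have h2 : ∀ᶠ y in 𝓝[>] a, y ∈ Ioo a b := Ioo_mem_nhdsGT hab
    obtain ⟨c, hc⟩ := (h1.and h2).exists
    exact ⟨c, hc.2, hc.1⟩
  have hsub : Icc c b ⊆ {x | U c ≤ U x} := by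
    apply IsClosed.Icc_subset_of_forall_exists_gt (s := {x | U c ≤ U x})
    · have : {x | U c ≤ U x} ∩ Icc c b = Icc c b ∩ U ⁻¹' (Ici (U c)) := by
        ext x; simp [and_comm]
      rw [this]
      exact (hU.mono (Icc_subset_Icc hac.1.le le_rfl)).preimage_isClosed_of_isClosed isClosed_Icc
        isClosed_Ici
    · exact le_refl (U c)
    · rintro x ⟨hx1, hx2⟩ y hy
      have h1 := hloc x ⟨hac.1.le.trans hx2.1, hx2.2⟩
      have h2 : ∀ᶠ u in 𝓝[>] x, u ∈ Ioc x y := Ioc_mem_nhdsGT hy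
      obtain ⟨u, hu⟩ := (h1.and h2).exists
      exact ⟨u, (le_trans hx1 hu.1.le : U c ≤ U u), hu.2⟩
  have : U c ≤ U b := hsub ⟨hac.2.le, le_rfl⟩
  linarith

/-! ### Transformation laws of the level one Eisenstein series -/

/-- The level one Eisenstein series as a function of a complex variable. -/
def eisensteinC {k : ℕ} (hk : 3 ≤ k) (z : ℂ) : ℂ := ModularForm.E hk (ofComplex z)

section EisensteinC

variable {k : ℕ} (hk : 3 ≤ k)

theorem eisensteinC_apply {z : ℂ} (hz : 0 < z.im) : eisensteinC hk z = ModularForm.E hk ⟨z, hz⟩ := by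
  rw [eisensteinC, ofComplex_apply_of_im_pos hz]

theorem differentiableOn_eisensteinC : DifferentiableOn ℂ (eisensteinC hk) {w | 0 < w.im} :=
  UpperHalfPlane.mdifferentiable_iff.mp (ModularForm.E hk).holo'

theorem neg_one_div_im_pos {z : ℂ} (hz : 0 < z.im) : 0 < (-1 / z).im := by
  have := UpperHalfPlane.im_inv_neg_coe_pos ⟨z, hz⟩
  simpa [neg_div, inv_neg, div_eq_mul_inv] using this

theorem eisensteinC_add_one {z : ℂ} : eisensteinC hk (z + 1) = eisensteinC hk z := by
  have := SlashInvariantFormClass.periodic_comp_ofComplex (ModularForm.E hk) (h := 1)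
    one_mem_strictPeriods_SL z
  simpa [eisensteinC] using this

open scoped ModularForm in
theorem eisensteinC_neg_one_div {z : ℂ} (hz : 0 < z.im) :
    eisensteinC hk (-1 / z) = z ^ k * eisensteinC hk z := by
  rw [eisensteinC_apply hk hz, eisensteinC_apply hk (neg_one_div_im_pos hz)]
  have h1 : (ModularForm.E hk : ℍ → ℂ) ∣[(k : ℤ)] ModularGroup.S = ModularForm.E hk :=
    SlashInvariantForm.slash_action_eqn (ModularForm.E hk) _ ⟨ModularGroup.S, rfl⟩
  have h2 := congrFun h1 ⟨z, hz⟩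
  rw [SlashInvariantForm.slash_S_apply] at h2
  have hz0 : z ≠ 0 := by rintro rfl; simp at hz
  have h3 : (UpperHalfPlane.mk (-1 / z) (neg_one_div_im_pos hz)) =
      UpperHalfPlane.mk (-z)⁻¹ (UpperHalfPlane.im_inv_neg_coe_pos ⟨z, hz⟩) := by
    ext; simp [neg_div, inv_neg]
  rw [h3, ← h2, zpow_neg, zpow_natCast]
  field_simp

/-- The `q`-expansion has rational coefficients, and `z ↦ -conj z` conjugates `q`. -/
theorem eisensteinC_neg_conj (hk2 : Even k) {z : ℂ} (hz : 0 < z.im) :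
    eisensteinC hk (-conj z) = conj (eisensteinC hk z) := by
  have hz' : 0 < (-conj z).im := by simpa using hz
  rw [eisensteinC_apply hk hz, eisensteinC_apply hk hz',
    EisensteinSeries.q_expansion_bernoulli hk hk2, EisensteinSeries.q_expansion_bernoulli hk hk2]
  have hexp : cexp (2 * Real.pi * Complex.I * (-conj z)) =
      conj (cexp (2 * Real.pi * Complex.I * z)) := by
    rw [← exp_conj]; congr 1; simp [map_ofNat]
  simp only [hexp, map_sub, map_mul, map_one, Complex.conj_tsum, map_div₀, map_zpow₀, map_ofNat]
  simp

theorem exists_eisensteinC_eq (hk2 : Even k) : ∃ C : ℂ → ℂ, AnalyticAt ℂ C 0 ∧ C 0 = 1 ∧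
    ∀ z : ℂ, 0 < z.im → eisensteinC hk z = C (Function.Periodic.qParam 1 z) := by
  refine ⟨cuspFunction 1 (ModularForm.E hk), ?_, ?_, ?_⟩
  · exact ModularFormClass.analyticAt_cuspFunction_zero (ModularForm.E hk) one_pos
      one_mem_strictPeriods_SL
  · have := EisensteinSeries.E_qExpansion_coeff_zero hk hk2
    rw [qExpansion_coeff] at this
    simpa using this
  · intro z hz
    rw [eisensteinC_apply hk hz]
    exact (SlashInvariantFormClass.eq_cuspFunction (ModularForm.E hk) ⟨z, hz⟩
      one_mem_strictPeriods_SL one_ne_zero).symm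

end EisensteinC

/-! ### The cusp form `(η(z)η(5z))^4` and its symmetries -/

/-- The function `η ^ 4`, as used in the construction of the cusp form `(η(z) η(5z)) ^ 4`. -/
def etaFour (z : ℂ) : ℂ := ModularForm.eta z ^ 4

theorem etaFour_ne_zero {z : ℂ} (hz : 0 < z.im) : etaFour z ≠ 0 :=
  pow_ne_zero _ (ModularForm.eta_ne_zero hz)

theorem differentiableOn_etaFour : DifferentiableOn ℂ etaFour {w | 0 < w.im} := fun _ hz =>
  ((ModularForm.differentiableAt_eta_of_mem_upperHalfPlaneSet hz).pow 4).differentiableWithinAt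

/-- The Euler product `∏ (1 - q ^ n)`. -/
def eulerProd (q : ℂ) : ℂ := ∏' n : ℕ, (1 - q ^ (n + 1))

theorem eta_eq_qParam_mul_eulerProd (z : ℂ) : ModularForm.eta z =
    Function.Periodic.qParam 24 z * eulerProd (Function.Periodic.qParam 1 z) := rfl

theorem analyticAt_eulerProd : AnalyticAt ℂ eulerProd 0 :=
  ModularForm.differentiableOn_tprod_one_sub_pow.analyticAt (Metric.ball_mem_nhds _ one_pos)

theorem eulerProd_zero : eulerProd 0 = 1 := by simp [eulerProd]

theorem eulerProd_conj {q : ℂ} (hq : ‖q‖ < 1) : eulerProd (conj q) = conj (eulerProd q) := by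
  have h := (ModularForm.multipliable_one_sub_pow hq).map_tprod (starRingEnd ℂ) continuous_conj
  rw [eulerProd, eulerProd, h]
  simp

theorem qParam_neg_conj (h : ℝ) (z : ℂ) : Function.Periodic.qParam h (-conj z) =
    conj (Function.Periodic.qParam h z) := by
  rw [Function.Periodic.qParam, Function.Periodic.qParam, ← exp_conj]; congr 1; simp [map_ofNat]

theorem etaFour_neg_conj {z : ℂ} (hz : 0 < z.im) : etaFour (-conj z) = conj (etaFour z) := by
  rw [etaFour, etaFour, eta_eq_qParam_mul_eulerProd, eta_eq_qParam_mul_eulerProd, qParam_neg_conj,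
    qParam_neg_conj, eulerProd_conj (Function.Periodic.norm_qParam_lt_one one_pos hz)]
  simp only [map_mul, map_pow]

theorem etaFour_neg_one_div {z : ℂ} (hz : 0 < z.im) :
    etaFour (-1 / z) = -z ^ 2 * etaFour z := by
  have h := ModularForm.eta_comp_eq_csqrt_I_inv hz
  simp only [Function.comp_apply, Pi.smul_apply, Pi.mul_apply, smul_eq_mul] at h
  have hs : ∀ w : ℂ, w ≠ 0 → sqrt w ^ 4 = w ^ 2 := by
    intro w hw
    rw [sqrt_eq_exp hw, ← exp_nat_mul]
    rw [show ((4 : ℕ) : ℂ) * (log w / 2) = (2 : ℕ) * log w by push_cast; ring, exp_nat_mul,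
      exp_log hw]
  have hz0 : z ≠ 0 := by rintro rfl; simp at hz
  rw [etaFour, etaFour, h, mul_pow, mul_pow, inv_pow, hs _ hz0, hs _ I_ne_zero, I_sq]
  ring

theorem etaFour_add_one (z : ℂ) :
    etaFour (z + 1) = cexp (2 * Real.pi * Complex.I / 6) * etaFour z := by
  have h1 : Function.Periodic.qParam 1 (z + 1) = Function.Periodic.qParam 1 z := by
    simp only [Function.Periodic.qParam, ofReal_one, div_one, mul_add, mul_one, exp_add,
      exp_two_pi_mul_I]
  rw [etaFour, etaFour, eta_eq_qParam_mul_eulerProd, eta_eq_qParam_mul_eulerProd, h1, mul_pow,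
    mul_pow, ← mul_assoc]
  congr 1
  simp only [Function.Periodic.qParam, ← exp_nat_mul, ← exp_add]
  congr 1
  push_cast
  ring

/-- This writes the action of `(1, 0; 2, 1)` as that of `S T⁻² S`, so the laws for `z ↦ z + 1` and
`z ↦ -1 / z` determine its effect. -/
theorem div_two_mul_add_one_eq {z : ℂ} (hz : 0 < z.im) :
    z / (2 * z + 1) = -1 / (-1 / z - 2) := by
  have hz0 : z ≠ 0 := by rintro rfl; simp at hz
  have h1 : 2 * z + 1 ≠ 0 := by
    intro h; have := congrArg Complex.im h; simp at this; linarith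
  have h2 : -1 / z - 2 ≠ 0 := by
    intro h; apply h1; field_simp at h; linear_combination -h
  rw [div_eq_div_iff h1 h2]
  field_simp
  ring

/-- The action of the matrix `(1, 0; 2, 1)` on a function that is modular of weight `k` up to
multipliers for `z ↦ z + 1` and `z ↦ -1 / z`. -/
theorem apply_div_two_mul_add_one {g : ℂ → ℂ} {k : ℕ} (hk : Even k) {a b : ℂ}
    (hb : b ^ 2 = 1) (hT : ∀ z, g (z + 1) = a * g z)
    (hS : ∀ z : ℂ, 0 < z.im → g (-1 / z) = b * z ^ k * g z) {z : ℂ} (hz : 0 < z.im) :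
    a ^ 2 * g (z / (2 * z + 1)) = (2 * z + 1) ^ k * g z := by
  have hz0 : z ≠ 0 := by rintro rfl; simp at hz
  have h1 := neg_one_div_im_pos hz
  have h2 : 0 < (-1 / z - 2).im := by simpa using h1
  have h3 : g (-1 / z) = a ^ 2 * g (-1 / z - 2) := by
    have e1 := hT (-1 / z - 2)
    have e2 := hT (-1 / z - 2 + 1)
    rw [show -1 / z - 2 + 1 + 1 = -1 / z by ring] at e2
    rw [e2, e1]; ring
  rw [div_two_mul_add_one_eq hz, hS _ h2]
  have h4 : (-1 / z - 2) ^ k * z ^ k = (2 * z + 1) ^ k := by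
    rw [← mul_pow, ← hk.neg_pow]; congr 1; field_simp; ring
  calc a ^ 2 * (b * (-1 / z - 2) ^ k * g (-1 / z - 2))
      = b * (-1 / z - 2) ^ k * (a ^ 2 * g (-1 / z - 2)) := by ring
    _ = b ^ 2 * ((-1 / z - 2) ^ k * z ^ k) * g z := by rw [← h3, hS z hz]; ring
    _ = _ := by rw [hb, h4, one_mul]

/-- The cusp form `(η(z) η(5z)) ^ 4`. -/
def etaProdFive (z : ℂ) : ℂ := etaFour z * etaFour (5 * z)

theorem five_mul_im_pos {z : ℂ} (hz : 0 < z.im) : 0 < (5 * z).im := by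
  simpa using hz

theorem etaProdFive_ne_zero {z : ℂ} (hz : 0 < z.im) : etaProdFive z ≠ 0 :=
  mul_ne_zero (etaFour_ne_zero hz) (etaFour_ne_zero (five_mul_im_pos hz))

theorem differentiableOn_etaProdFive : DifferentiableOn ℂ etaProdFive {w | 0 < w.im} :=
  differentiableOn_etaFour.mul (differentiableOn_etaFour.comp
    (f := fun w : ℂ => 5 * w) (by fun_prop) fun _ hw => five_mul_im_pos hw)

theorem etaProdFive_neg_conj {z : ℂ} (hz : 0 < z.im) :
    etaProdFive (-conj z) = conj (etaProdFive z) := by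
  rw [etaProdFive, etaProdFive, etaFour_neg_conj hz, map_mul, ← etaFour_neg_conj (five_mul_im_pos hz)]
  congr 2
  simp [map_ofNat]

theorem exp_pow_six : cexp (2 * Real.pi * Complex.I / 6) ^ 6 = 1 := by
  rw [← exp_nat_mul, ← exp_two_pi_mul_I]; congr 1; push_cast; ring

theorem etaFour_add_nat (z : ℂ) (n : ℕ) :
    etaFour (z + n) = cexp (2 * Real.pi * Complex.I / 6) ^ n * etaFour z := by
  induction n with
  | zero => simp
  | succ n ih => push_cast; rw [← add_assoc, etaFour_add_one, ih]; ring

/-- The two factors contribute a primitive sixth root of unity and its fifth power, which cancel. -/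
theorem etaProdFive_add_one (z : ℂ) : etaProdFive (z + 1) = etaProdFive z := by
  have h := etaFour_add_nat (5 * z) 5
  push_cast at h
  rw [etaProdFive, etaProdFive, etaFour_add_one, mul_add, mul_one, h]
  linear_combination (etaFour z * etaFour (5 * z)) * exp_pow_six

theorem five_mul_fricke (z : ℂ) : 5 * (-1 / (5 * z)) = -1 / z := by
  rw [mul_div_assoc', mul_div_mul_left _ _ (by norm_num)]

theorem etaProdFive_fricke {z : ℂ} (hz : 0 < z.im) :
    etaProdFive (-1 / (5 * z)) = 25 * z ^ 4 * etaProdFive z := by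
  rw [etaProdFive, etaProdFive, five_mul_fricke, etaFour_neg_one_div hz,
    etaFour_neg_one_div (five_mul_im_pos hz)]
  ring

/-- The involution of the upper half-plane that fixes `-1/2 + i/(2√5)`. -/
def frickeV (z : ℂ) : ℂ := (-5 * z - 3) / (10 * z + 5)

theorem ten_mul_add_five_ne_zero {z : ℂ} (hz : 0 < z.im) : 10 * z + 5 ≠ 0 := by
  intro h; have := congrArg Complex.im h; simp at this; linarith

/-- Up to translations, `frickeV` sends the pair `(z, 5z)` to the images of `(5z + 2, z)` under `(1,
0; 2, 1)`. The two arguments in a form of level 5 are thus exchanged, and only level one laws are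
needed. -/
theorem frickeV_eq {z : ℂ} (hz : 0 < z.im) :
    frickeV z + 1 = (5 * z + 2) / (2 * (5 * z + 2) + 1) := by
  have := ten_mul_add_five_ne_zero hz
  rw [frickeV, show 2 * (5 * z + 2) + 1 = 10 * z + 5 by ring, div_add_one this]
  congr 1
  ring

theorem five_mul_frickeV {z : ℂ} (hz : 0 < z.im) : 5 * frickeV z + 3 = z / (2 * z + 1) := by
  have := ten_mul_add_five_ne_zero hz
  have h1 : 2 * z + 1 ≠ 0 := by intro h; apply this; linear_combination 5 * h
  rw [frickeV, eq_div_iff h1, mul_div_assoc', div_add' _ _ _ this, div_mul_eq_mul_div,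
    div_eq_iff this]
  ring

theorem etaProdFive_frickeV {z : ℂ} (hz : 0 < z.im) :
    25 * etaProdFive (frickeV z) = (10 * z + 5) ^ 4 * etaProdFive z := by
  set a := cexp (2 * Real.pi * Complex.I / 6) with ha
  have ha0 : a ≠ 0 := exp_ne_zero _
  have ha6 : a ^ 6 = 1 := exp_pow_six
  have hS : ∀ z : ℂ, 0 < z.im → etaFour (-1 / z) = (-1) * z ^ 2 * etaFour z := fun z hz => by
    rw [etaFour_neg_one_div hz]; ring
  have h1 := apply_div_two_mul_add_one even_two (by norm_num) etaFour_add_one hS hz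
  have h2 := apply_div_two_mul_add_one even_two (by norm_num) etaFour_add_one hS
    (z := 5 * z + 2) (by simpa using hz)
  rw [← five_mul_frickeV hz] at h1
  rw [← frickeV_eq hz, etaFour_add_one] at h2
  have h3 := etaFour_add_nat (5 * frickeV z) 3
  have h4 := etaFour_add_nat (5 * z) 2
  push_cast at h3 h4
  rw [h3] at h1
  rw [h4] at h2
  rw [← ha] at h1 h2
  rw [etaProdFive, etaProdFive]
  have h5 := congrArg₂ (· * ·) h1 h2
  have ha2 : a ^ 2 ≠ 0 := pow_ne_zero _ ha0
  -- The translations and the two uses of `(1, 0; 2, 1)` leave `a ^ 8` on the left and `a ^ 2` on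
  -- the right, which agree as `a ^ 6 = 1`.
  have h6 : a ^ 8 * (etaFour (frickeV z) * etaFour (5 * frickeV z)) =
      a ^ 2 * ((2 * z + 1) ^ 2 * (10 * z + 5) ^ 2 * (etaFour z * etaFour (5 * z))) := by
    linear_combination h5
  rw [show a ^ 8 = a ^ 2 by linear_combination a ^ 2 * ha6] at h6
  rw [mul_left_cancel₀ ha2 h6]
  ring

/-! ### Invariant functions and their reality on the mirrors -/

/-- A holomorphic function on the upper half-plane with real Fourier coefficients that is invariant
under `Γ₀*(5)`. -/
structure IsFrickeInvariant (h : ℂ → ℂ) : Prop where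
  diff : DifferentiableOn ℂ h {z | 0 < z.im}
  neg_conj : ∀ z : ℂ, 0 < z.im → h (-conj z) = conj (h z)
  add_one : ∀ z : ℂ, 0 < z.im → h (z + 1) = h z
  fricke : ∀ z : ℂ, 0 < z.im → h (-1 / (5 * z)) = h z
  frickeV : ∀ z : ℂ, 0 < z.im → h (frickeV z) = h z

theorem neg_conj_eq_fricke {z : ℂ} (hz : z.re ^ 2 + z.im ^ 2 = 1 / 5) :
    -conj z = -1 / (5 * z) := by
  have h : z * conj z = 1 / 5 := by
    rw [mul_conj, normSq_apply, ← sq, ← sq, hz]; push_cast; rfl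
  have hz0 : z ≠ 0 := by rintro rfl; norm_num at hz
  field_simp
  linear_combination -5 * h

theorem neg_conj_sub_one_eq_frickeV {z : ℂ} (him : 0 < z.im)
    (hz : (z.re + 1 / 2) ^ 2 + z.im ^ 2 = 1 / 20) : -conj z - 1 = frickeV z := by
  have h : (z + 1 / 2) * conj (z + 1 / 2) = 1 / 20 := by
    rw [mul_conj, normSq_apply]
    have : (z + 1 / 2).re * (z + 1 / 2).re + (z + 1 / 2).im * (z + 1 / 2).im = 1 / 20 := by
      simp at hz ⊢; linarith
    rw [this]; push_cast; rfl
  have h0 := ten_mul_add_five_ne_zero him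
  rw [frickeV, eq_div_iff h0]
  simp only [map_add, map_div₀, map_one, map_ofNat] at h
  linear_combination -10 * h

namespace IsFrickeInvariant

variable {h h₁ h₂ : ℂ → ℂ}

/-- On the four mirrors `-conj z` equals `z`, `z + 1`, `-1 / (5z)` and `frickeV z + 1` respectively,
so invariance turns the conjugation symmetry into `conj (h z) = h z`. -/
theorem im_eq_zero (hh : IsFrickeInvariant h) {z : ℂ} (hz : 0 < z.im) (hm : z ∈ mirrorSet) :
    (h z).im = 0 := by
  rw [← conj_eq_iff_im]
  have hz' : 0 < (-conj z).im := by simpa using hz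
  have hz'' : 0 < (-conj z - 1).im := by simpa using hz
  rw [← hh.neg_conj z hz]
  rcases hm with hm | hm | hm | hm
  · congr 1
    apply Complex.ext <;> simp [hm]
  · rw [← hh.add_one z hz]
    congr 1
    apply Complex.ext <;> simp [hm]
    norm_num
  · rw [neg_conj_eq_fricke hm, hh.fricke z hz]
  · have := hh.add_one _ hz''
    rw [sub_add_cancel] at this
    rw [this, neg_conj_sub_one_eq_frickeV hz hm, hh.frickeV z hz]

theorem sub (hh₁ : IsFrickeInvariant h₁) (hh₂ : IsFrickeInvariant h₂) :
    IsFrickeInvariant (fun z => h₁ z - h₂ z) where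
  diff := hh₁.diff.sub hh₂.diff
  neg_conj z hz := by simp [hh₁.neg_conj z hz, hh₂.neg_conj z hz]
  add_one z hz := by simp [hh₁.add_one z hz, hh₂.add_one z hz]
  fricke z hz := by simp only [hh₁.fricke z hz, hh₂.fricke z hz]
  frickeV z hz := by simp [hh₁.frickeV z hz, hh₂.frickeV z hz]

theorem const_mul_pow (hh : IsFrickeInvariant h) (a : ℝ) (n : ℕ) :
    IsFrickeInvariant (fun z => a * h z ^ n) where
  diff := (hh.diff.pow n).const_mul _
  neg_conj z hz := by simp [hh.neg_conj z hz]
  add_one z hz := by simp [hh.add_one z hz]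
  fricke z hz := by simp only [hh.fricke z hz]
  frickeV z hz := by simp [hh.frickeV z hz]

end IsFrickeInvariant

/-! ### Transformation laws of `E*_{k,5}` -/

section FrickeEisenstein

variable {k : ℕ} (hk : 3 ≤ k)

theorem five_pow_add_one_ne_zero (n : ℕ) : (5 : ℂ) ^ n + 1 ≠ 0 := by
  have : (0 : ℝ) < 5 ^ n + 1 := by positivity
  exact_mod_cast this.ne'

theorem frickeEisenstein_five (z : ℂ) : frickeEisenstein 5 hk z =
    (5 ^ (k / 2) * eisensteinC hk (5 * z) + eisensteinC hk z) / (5 ^ (k / 2) + 1) := by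
  simp only [frickeEisenstein, eisensteinC, Nat.cast_ofNat]
  ring

theorem differentiableOn_frickeEisenstein :
    DifferentiableOn ℂ (frickeEisenstein 5 hk) {z | 0 < z.im} := fun _ hz =>
  (frickeEisenstein_analyticAt (by norm_num) hk hz).differentiableAt.differentiableWithinAt

theorem frickeEisenstein_neg_conj (hk2 : Even k) {z : ℂ} (hz : 0 < z.im) :
    frickeEisenstein 5 hk (-conj z) = conj (frickeEisenstein 5 hk z) := by
  have h : 5 * -conj z = -conj (5 * z) := by simp [map_ofNat]
  rw [frickeEisenstein_five, frickeEisenstein_five, h, eisensteinC_neg_conj hk hk2 hz,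
    eisensteinC_neg_conj hk hk2 (five_mul_im_pos hz)]
  simp [map_ofNat]

theorem eisensteinC_add_nat (z : ℂ) (n : ℕ) : eisensteinC hk (z + n) = eisensteinC hk z := by
  induction n with
  | zero => simp
  | succ n ih => push_cast; rw [← add_assoc, eisensteinC_add_one, ih]

theorem frickeEisenstein_add_one (z : ℂ) :
    frickeEisenstein 5 hk (z + 1) = frickeEisenstein 5 hk z := by
  have h := eisensteinC_add_nat hk (5 * z) 5
  push_cast at h
  rw [frickeEisenstein_five, frickeEisenstein_five, eisensteinC_add_one, mul_add, mul_one, h]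

theorem five_pow_half_mul_self (hk2 : Even k) : (5 : ℂ) ^ (k / 2) * 5 ^ (k / 2) = 5 ^ k := by
  rw [← pow_add]; congr 1; obtain ⟨m, rfl⟩ := hk2; omega

theorem frickeEisenstein_fricke (hk2 : Even k) {z : ℂ} (hz : 0 < z.im) :
    frickeEisenstein 5 hk (-1 / (5 * z)) = 5 ^ (k / 2) * z ^ k * frickeEisenstein 5 hk z := by
  rw [frickeEisenstein_five, frickeEisenstein_five, five_mul_fricke,
    eisensteinC_neg_one_div hk hz, eisensteinC_neg_one_div hk (five_mul_im_pos hz), mul_pow,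
    ← five_pow_half_mul_self hk2]
  ring

theorem eisensteinC_five_mul_frickeV (hk2 : Even k) {z : ℂ} (hz : 0 < z.im) :
    eisensteinC hk (5 * frickeV z) = (2 * z + 1) ^ k * eisensteinC hk z := by
  have h1 := apply_div_two_mul_add_one (g := eisensteinC hk) hk2 (a := 1) (b := 1) (by norm_num)
    (fun z => by rw [eisensteinC_add_one hk, one_mul])
    (fun z hz => by rw [eisensteinC_neg_one_div hk hz, one_mul]) hz
  have h3 := eisensteinC_add_nat hk (5 * frickeV z) 3
  push_cast at h3
  rw [← five_mul_frickeV hz, h3] at h1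
  simpa using h1

theorem eisensteinC_frickeV (hk2 : Even k) {z : ℂ} (hz : 0 < z.im) :
    eisensteinC hk (frickeV z) = (10 * z + 5) ^ k * eisensteinC hk (5 * z) := by
  have h1 := apply_div_two_mul_add_one (g := eisensteinC hk) hk2 (a := 1) (b := 1) (by norm_num)
    (fun z => by rw [eisensteinC_add_one hk, one_mul])
    (fun z hz => by rw [eisensteinC_neg_one_div hk hz, one_mul]) (z := 5 * z + 2) (by simpa using hz)
  have h3 := eisensteinC_add_nat hk (5 * z) 2
  push_cast at h3
  rw [← frickeV_eq hz, h3, eisensteinC_add_one] at h1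
  rw [show 10 * z + 5 = 2 * (5 * z + 2) + 1 by ring]
  simpa using h1

theorem frickeEisenstein_frickeV (hk2 : Even k) {z : ℂ} (hz : 0 < z.im) :
    5 ^ (k / 2) * frickeEisenstein 5 hk (frickeV z) =
      (10 * z + 5) ^ k * frickeEisenstein 5 hk z := by
  have h : (10 * z + 5) ^ k = 5 ^ (k / 2) * 5 ^ (k / 2) * (2 * z + 1) ^ k := by
    rw [five_pow_half_mul_self hk2, ← mul_pow]; congr 1; ring
  rw [frickeEisenstein_five, frickeEisenstein_five, eisensteinC_five_mul_frickeV hk hk2 hz,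
    eisensteinC_frickeV hk hk2 hz, h]
  ring

theorem qParam_one_five_mul (z : ℂ) :
    Function.Periodic.qParam 1 (5 * z) = Function.Periodic.qParam 1 z ^ 5 := by
  simp only [Function.Periodic.qParam, ← exp_nat_mul]; congr 1; push_cast; ring

theorem exists_frickeEisenstein_eq (hk2 : Even k) : ∃ C : ℂ → ℂ, AnalyticAt ℂ C 0 ∧ C 0 = 1 ∧
    ∀ z : ℂ, 0 < z.im → frickeEisenstein 5 hk z = C (Function.Periodic.qParam 1 z) := by
  obtain ⟨C, hC, hC0, hCz⟩ := exists_eisensteinC_eq hk hk2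
  refine ⟨fun q => (5 ^ (k / 2) * C (q ^ 5) + C q) / (5 ^ (k / 2) + 1), ?_, ?_, ?_⟩
  · have h5 : AnalyticAt ℂ (fun q : ℂ => C (q ^ 5)) 0 :=
      AnalyticAt.fun_comp (by simpa using hC) (analyticAt_id.pow 5)
    exact ((analyticAt_const.mul h5).add hC).div analyticAt_const (five_pow_add_one_ne_zero _)
  · simp [hC0, five_pow_add_one_ne_zero]
  · intro z hz
    rw [frickeEisenstein_five, hCz z hz, hCz _ (five_mul_im_pos hz), qParam_one_five_mul]

end FrickeEisenstein

theorem exists_etaProdFive_eq : ∃ C : ℂ → ℂ, AnalyticAt ℂ C 0 ∧ C 0 = 1 ∧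
    ∀ z : ℂ, etaProdFive z =
      Function.Periodic.qParam 1 z * C (Function.Periodic.qParam 1 z) := by
  refine ⟨fun q => eulerProd q ^ 4 * eulerProd (q ^ 5) ^ 4, ?_, ?_, ?_⟩
  · have h5 : AnalyticAt ℂ (fun q : ℂ => eulerProd (q ^ 5)) 0 :=
      AnalyticAt.fun_comp (by simpa using analyticAt_eulerProd) (analyticAt_id.pow 5)
    exact (analyticAt_eulerProd.pow 4).mul (h5.pow 4)
  · simp [eulerProd_zero]
  · intro z
    have h : Function.Periodic.qParam 24 z ^ 4 * Function.Periodic.qParam 24 (5 * z) ^ 4 =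
        Function.Periodic.qParam 1 z := by
      simp only [Function.Periodic.qParam, ← exp_nat_mul, ← exp_add]
      congr 1; push_cast; ring
    rw [etaProdFive, etaFour, etaFour, eta_eq_qParam_mul_eulerProd, eta_eq_qParam_mul_eulerProd,
      qParam_one_five_mul, ← h]
    ring

/-- A holomorphic form of weight `4m` divided by `(η(z) η(5z)) ^ (4m)` is invariant. -/
theorem IsFrickeInvariant.of_weight {F : ℂ → ℂ} {m : ℕ}
    (hd : DifferentiableOn ℂ F {z | 0 < z.im})
    (hc : ∀ z : ℂ, 0 < z.im → F (-conj z) = conj (F z))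
    (h1 : ∀ z : ℂ, F (z + 1) = F z)
    (hW : ∀ z : ℂ, 0 < z.im → F (-1 / (5 * z)) = (25 * z ^ 4) ^ m * F z)
    (hV : ∀ z : ℂ, 0 < z.im → 25 ^ m * F (_root_.frickeV z) = ((10 * z + 5) ^ 4) ^ m * F z) :
    IsFrickeInvariant fun z => F z / etaProdFive z ^ m where
  diff := hd.div (differentiableOn_etaProdFive.pow m) fun z hz =>
    pow_ne_zero _ (etaProdFive_ne_zero hz)
  neg_conj z hz := by simp [hc z hz, etaProdFive_neg_conj hz]
  add_one z hz := by simp [h1 z, etaProdFive_add_one]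
  fricke z hz := by
    have hz0 : z ≠ 0 := by rintro rfl; simp at hz
    have hD := etaProdFive_ne_zero hz
    simp only [hW z hz, etaProdFive_fricke hz, mul_pow (25 * z ^ 4)]
    rw [mul_div_mul_left]
    exact pow_ne_zero _ (mul_ne_zero (by norm_num) (pow_ne_zero _ hz0))
  frickeV z hz := by
    have h10 := ten_mul_add_five_ne_zero hz
    have hD := etaProdFive_ne_zero hz
    have h25 : (25 : ℂ) ^ m ≠ 0 := pow_ne_zero _ (by norm_num)
    rw [← mul_div_mul_left _ _ h25, hV z hz, ← mul_pow, etaProdFive_frickeV hz, mul_pow,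
      mul_div_mul_left]
    exact pow_ne_zero _ (pow_ne_zero _ h10)

/-! ### The Hauptmodul and expansions at the cusp -/

/-- The invariant function `E*_{4,5} / (η(z) η(5z)) ^ 4`, a generator of the function field of
`Γ₀*(5)`. -/
def hauptmodul (z : ℂ) : ℂ := frickeEisenstein 5 (k := 4) (by norm_num) z / etaProdFive z

theorem hauptmodul_invariant : IsFrickeInvariant hauptmodul := by
  have he : Even 4 := by decide
  have := IsFrickeInvariant.of_weight (m := 1)
    (differentiableOn_frickeEisenstein (k := 4) (by norm_num))
    (fun z hz => frickeEisenstein_neg_conj (k := 4) (by norm_num) he hz)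
    (fun z => frickeEisenstein_add_one (k := 4) (by norm_num) z)
    (fun z hz => by rw [frickeEisenstein_fricke (k := 4) (by norm_num) he hz]; norm_num)
    (fun z hz => by
      have := frickeEisenstein_frickeV (k := 4) (by norm_num) he hz
      norm_num at this ⊢; exact this)
  simpa only [pow_one] using! this

/-- The invariant function attached to the square of `E*_{k,5}`. -/
def eisensteinQuot {k : ℕ} (hk : 3 ≤ k) (z : ℂ) : ℂ :=
  frickeEisenstein 5 hk z ^ 2 / etaProdFive z ^ (k / 2)

theorem eisensteinQuot_invariant {k : ℕ} (hk : 3 ≤ k) (hk2 : Even k) :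
    IsFrickeInvariant (eisensteinQuot hk) := by
  have hkk : k = 2 * (k / 2) := by obtain ⟨m, rfl⟩ := hk2; omega
  have h25 : (25 : ℂ) ^ (k / 2) = (5 ^ (k / 2)) ^ 2 := by
    rw [← pow_mul, mul_comm, pow_mul]; norm_num
  have h4 : ∀ x : ℂ, (x ^ 4) ^ (k / 2) = (x ^ k) ^ 2 := by
    intro x; rw [← pow_mul, ← pow_mul]; congr 1; omega
  -- Squaring gives weight `2k = 4 (k/2)`, a multiple of the weight of the cusp form even when 4
  -- does not divide `k`.
  refine IsFrickeInvariant.of_weight (F := fun z => frickeEisenstein 5 hk z ^ 2)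
    ((differentiableOn_frickeEisenstein hk).pow 2) ?_ ?_ ?_ ?_
  · intro z hz; simp [frickeEisenstein_neg_conj hk hk2 hz]
  · intro z; simp [frickeEisenstein_add_one]
  · intro z hz
    rw [frickeEisenstein_fricke hk hk2 hz, mul_pow 25, h25, h4]; ring
  · intro z hz
    rw [h25, h4, ← mul_pow, ← mul_pow, frickeEisenstein_frickeV hk hk2 hz]

/-- `h` has at most a pole of order `n` at the cusp. -/
def HasCuspExpansion (h : ℂ → ℂ) (n : ℕ) (φ : ℂ → ℂ) : Prop :=
  AnalyticAt ℂ φ 0 ∧ ∀ z : ℂ, 0 < z.im →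
    h z * Function.Periodic.qParam 1 z ^ n = φ (Function.Periodic.qParam 1 z)

theorem exists_hauptmodul_expansion : ∃ φ, HasCuspExpansion hauptmodul 1 φ ∧ φ 0 = 1 := by
  obtain ⟨A, hA, hA0, hAz⟩ := exists_frickeEisenstein_eq (k := 4) (by norm_num) (by decide)
  obtain ⟨B, hB, hB0, hBz⟩ := exists_etaProdFive_eq
  refine ⟨fun q => A q / B q, ⟨hA.div hB (by simp [hB0]), fun z hz => ?_⟩, by simp [hA0, hB0]⟩
  have hq : Function.Periodic.qParam 1 z ≠ 0 := Function.Periodic.qParam_ne_zero z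
  have hD := etaProdFive_ne_zero hz
  rw [hBz] at hD
  rw [hauptmodul, hAz z hz, hBz z]
  have := right_ne_zero_of_mul hD
  field_simp

theorem exists_eisensteinQuot_expansion {k : ℕ} (hk : 3 ≤ k) (hk2 : Even k) :
    ∃ φ, HasCuspExpansion (eisensteinQuot hk) (k / 2) φ ∧ φ 0 = 1 := by
  obtain ⟨A, hA, hA0, hAz⟩ := exists_frickeEisenstein_eq hk hk2
  obtain ⟨B, hB, hB0, hBz⟩ := exists_etaProdFive_eq
  refine ⟨fun q => A q ^ 2 / B q ^ (k / 2), ⟨(hA.pow 2).div (hB.pow _) (by simp [hB0]),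
    fun z hz => ?_⟩, by simp [hA0, hB0]⟩
  have hq : Function.Periodic.qParam 1 z ≠ 0 := Function.Periodic.qParam_ne_zero z
  have hD := etaProdFive_ne_zero hz
  rw [hBz] at hD
  rw [eisensteinQuot, hAz z hz, hBz z]
  have := right_ne_zero_of_mul hD
  rw [mul_pow]
  field_simp

local notation "𝕢" => Function.Periodic.qParam 1

theorem exists_forall_norm_qParam_lt {r : ℝ} (hr : 0 < r) :
    ∃ Y : ℝ, 0 < Y ∧ ∀ z : ℂ, Y ≤ z.im → ‖𝕢 z‖ < r := by
  have h : Tendsto (fun y : ℝ => Real.exp (-2 * Real.pi * y / 1)) atTop (𝓝 0) := by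
    refine Real.tendsto_exp_atBot.comp ?_
    have : Tendsto (fun y : ℝ => (-2 * Real.pi) * y) atTop atBot :=
      tendsto_id.const_mul_atTop_of_neg (by linarith [Real.pi_pos])
    simpa using this
  obtain ⟨Y, hY⟩ := ((h.eventually_lt_const hr).and (eventually_gt_atTop 0)).exists_forall_of_atTop
  exact ⟨Y, (hY Y le_rfl).2, fun z hz => by
    rw [Function.Periodic.norm_qParam]; exact (hY z.im hz).1⟩

theorem exists_forall_norm_sub_le {φ : ℂ → ℂ} (hφ : ContinuousAt φ 0) {ε : ℝ} (hε : 0 < ε) :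
    ∃ Y : ℝ, 0 < Y ∧ ∀ z : ℂ, Y ≤ z.im → ‖φ (𝕢 z) - φ 0‖ < ε := by
  obtain ⟨r, hr, h⟩ := Metric.continuousAt_iff.mp hφ ε hε
  obtain ⟨Y, hY0, hY⟩ := exists_forall_norm_qParam_lt hr
  exact ⟨Y, hY0, fun z hz => by
    have := @h (𝕢 z) (by simpa using hY z hz)
    rwa [dist_eq_norm] at this⟩

theorem qParam_mul_I (y : ℝ) : 𝕢 (y * Complex.I) = (Real.exp (-2 * Real.pi * y) : ℝ) := by
  rw [Function.Periodic.qParam, ofReal_exp]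
  congr 1
  push_cast
  linear_combination (2 * Real.pi * y) * I_sq

theorem IsFrickeInvariant.im_eq_zero_mul_I {h : ℂ → ℂ} (hh : IsFrickeInvariant h) {y : ℝ}
    (hy : 0 < y) : (h (y * Complex.I)).im = 0 :=
  hh.im_eq_zero (by simpa using hy) (Or.inl (by simp))

theorem im_eq_zero_of_forall_mul_I {φ : ℂ → ℂ} (hφ : ContinuousAt φ 0)
    (h : ∀ y : ℝ, 0 < y → (φ (𝕢 (y * Complex.I))).im = 0) : (φ 0).im = 0 := by
  by_contra hne
  obtain ⟨Y, hY0, hY⟩ := exists_forall_norm_sub_le hφ (abs_pos.mpr hne)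
  have h1 := hY (Y * Complex.I) (by simp)
  have h2 := (abs_im_le_norm _).trans_lt h1
  rw [sub_im, h Y hY0, zero_sub, abs_neg] at h2
  exact lt_irrefl _ h2

/-- Both `h` and `q` are real on the imaginary axis, so the leading coefficient is a limit of real
numbers. -/
theorem HasCuspExpansion.im_eq_zero {h φ : ℂ → ℂ} {n : ℕ} (hφ : HasCuspExpansion h n φ)
    (hh : IsFrickeInvariant h) : (φ 0).im = 0 := by
  refine im_eq_zero_of_forall_mul_I hφ.1.continuousAt fun y hy => ?_
  rw [← hφ.2 _ (by simpa using hy), qParam_mul_I, ← ofReal_pow, im_mul_ofReal,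
    hh.im_eq_zero_mul_I hy, zero_mul]

/-! ### Positivity of `Im J` and `Re J'` on the half domain -/

theorem leftHalf_nonempty : (-(1 / 4) + Complex.I : ℂ) ∈ leftHalf := by
  simp only [leftHalf, mem_ofPred_eq]
  norm_num

theorem leftHalf_im_pos {z : ℂ} (hz : z ∈ leftHalf) : 0 < z.im := hz.2.2.2.2

/-- A nonconstant holomorphic function with nonnegative real part on `leftHalf` has positive real
part there. -/
theorem re_pos_of_re_nonneg {g : ℂ → ℂ} (hg : DifferentiableOn ℂ g {z | 0 < z.im})
    (hnc : ¬ ∃ c, ∀ z : ℂ, 0 < z.im → g z = c) (hnn : ∀ z ∈ leftHalf, 0 ≤ (g z).re) {z : ℂ}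
    (hz : z ∈ leftHalf) : 0 < (g z).re := by
  rcases (hg.analyticOnNhd isOpen_upperHalf).is_constant_or_isOpen
    convex_upperHalfPlane.isPreconnected with ⟨c, hc⟩ | hopen
  · exact absurd ⟨c, hc⟩ hnc
  · have h1 := hopen leftHalf (fun z hz => leftHalf_im_pos hz) isOpen_leftHalf
    have h2 : g '' leftHalf ⊆ {w | 0 ≤ w.re} := by rintro _ ⟨z, hz, rfl⟩; exact hnn z hz
    have h3 := interior_mono h2
    rw [h1.interior_eq] at h3
    have h4 := h3 (mem_image_of_mem g hz)
    have h5 : interior {w : ℂ | 0 ≤ w.re} = {w | 0 < w.re} := interior_setOfPred_le_re 0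
    rw [h5] at h4
    exact h4

theorem const_of_im_eq_zero {h : ℂ → ℂ} (hd : DifferentiableOn ℂ h {z | 0 < z.im})
    (h0 : ∀ z ∈ leftHalf, (h z).im = 0) : ∃ c, ∀ z : ℂ, 0 < z.im → h z = c := by
  by_contra hnc
  have := re_pos_of_re_nonneg (g := fun z => Complex.I * h z) (hd.const_mul _) (fun ⟨c, hc⟩ => hnc
    ⟨c / Complex.I, fun z hz => by rw [← hc z hz]; field_simp⟩)
    (fun z hz => by simp [h0 z hz]) leftHalf_nonempty
  rw [I_mul_re, h0 _ leftHalf_nonempty, neg_zero] at this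
  exact lt_irrefl _ this

/-- An invariant function without pole at the cusp is constant. -/
theorem IsFrickeInvariant.eq_const {h φ : ℂ → ℂ} (hh : IsFrickeInvariant h)
    (hφ : HasCuspExpansion h 0 φ) {z : ℂ} (hz : 0 < z.im) : h z = φ 0 := by
  have hr := hφ.im_eq_zero hh
  have hval : ∀ z : ℂ, 0 < z.im → h z = φ (𝕢 z) := fun z hz => by
    simpa using hφ.2 z hz
  -- The minimum principle applies for either sign of `s`, because `Im h` vanishes on the mirrors
  -- and tends to `0` at the cusp. Hence `Im h = 0` throughout `leftHalf`.
  have key : ∀ s : ℝ, ∀ z ∈ leftHalf, 0 ≤ s * (h z).im := by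
    intro s z hz
    have := re_nonneg_of_boundary (g := fun z => -(s * Complex.I) * h z) (hh.diff.const_mul _)
      (fun z hz hm => by simp [hh.im_eq_zero hz.2.2.2.2 hm]) (fun ε hε => by
        obtain ⟨Y, hY0, hY⟩ := exists_forall_norm_sub_le hφ.1.continuousAt
          (show 0 < ε / (|s| + 1) by positivity)
        refine ⟨Y, fun z hzY _ _ => ?_⟩
        have h1 := ((abs_im_le_norm _).trans_lt (hY z hzY)).le
        rw [← hval z (by linarith), sub_im, hr, sub_zero] at h1
        have h2 : |s * (h z).im| ≤ ε := by
          rw [abs_mul]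
          rw [le_div_iff₀ (by positivity)] at h1
          nlinarith [abs_nonneg (h z).im]
        have h3 := (abs_le.mp h2).1
        simpa using h3) hz
    simpa using this
  obtain ⟨c, hc⟩ := const_of_im_eq_zero hh.diff fun z hz => by
    linarith [key 1 z hz, key (-1) z hz]
  rw [hc z hz]
  by_contra hne
  obtain ⟨Y, hY0, hY⟩ := exists_forall_norm_sub_le hφ.1.continuousAt
    (norm_pos_iff.mpr (sub_ne_zero.mpr hne))
  have := hY (Y * Complex.I) (by simp)
  rw [← hval _ (by simpa using hY0), hc _ (by simpa using hY0)] at this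
  exact lt_irrefl _ this

/-- An analytic function with prescribed value at `0`, divided by the variable. -/
theorem exists_eq_const_add_mul {φ : ℂ → ℂ} (hφ : AnalyticAt ℂ φ 0) :
    ∃ ψ : ℂ → ℂ, AnalyticAt ℂ ψ 0 ∧ ∀ q, φ q = φ 0 + q * ψ q := by
  obtain ⟨p, hp⟩ := hφ
  refine ⟨dslope φ 0, ⟨_, hp.has_fpower_series_dslope_fslope⟩, fun q => ?_⟩
  have := sub_smul_dslope φ 0 q
  rw [sub_zero, smul_eq_mul] at this
  rw [this]; ring

/-- Because the constant term is real, `Im J` differs from `Im q⁻¹` by a quantity tending to zero at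
the cusp. -/
theorem exists_hauptmodul_eq : ∃ φ : ℂ → ℂ, AnalyticAt ℂ φ 0 ∧ (φ 0).im = 0 ∧
    ∀ z : ℂ, 0 < z.im → hauptmodul z = (𝕢 z)⁻¹ + φ (𝕢 z) := by
  obtain ⟨φ₀, hφ₀, hφ₀1⟩ := exists_hauptmodul_expansion
  obtain ⟨φ, hφ, heq⟩ := exists_eq_const_add_mul hφ₀.1
  have hz : ∀ z : ℂ, 0 < z.im → hauptmodul z = (𝕢 z)⁻¹ + φ (𝕢 z) := by
    intro z hz
    have h1 := hφ₀.2 z hz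
    have hq : 𝕢 z ≠ 0 := Function.Periodic.qParam_ne_zero z
    rw [heq, hφ₀1, pow_one] at h1
    field_simp
    linear_combination h1
  refine ⟨φ, hφ, im_eq_zero_of_forall_mul_I hφ.continuousAt fun y hy => ?_, hz⟩
  have h1 := hz (y * Complex.I) (by simpa using hy)
  have h2 := congrArg Complex.im h1
  rw [hauptmodul_invariant.im_eq_zero_mul_I hy, add_im] at h2
  rw [qParam_mul_I, ← ofReal_inv, ofReal_im] at h2
  rw [qParam_mul_I]
  linarith

theorem inv_qParam (z : ℂ) : (𝕢 z)⁻¹ =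
    Real.exp (2 * Real.pi * z.im) * exp ((-(2 * Real.pi * z.re) : ℝ) * Complex.I) := by
  rw [Function.Periodic.qParam, ← exp_neg, ofReal_exp, ← exp_add]
  congr 1
  apply Complex.ext <;> simp

/-- The imaginary part is `e^{2πy} sin(-2πx)`. Its sign is constant exactly because only half of the
period strip is used. -/
theorem inv_qParam_im_nonneg {z : ℂ} (h1 : -(1 / 2) ≤ z.re) (h2 : z.re ≤ 0) :
    0 ≤ ((𝕢 z)⁻¹).im := by
  rw [inv_qParam, im_ofReal_mul, exp_ofReal_mul_I_im]
  apply mul_nonneg (Real.exp_pos _).le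
  apply Real.sin_nonneg_of_nonneg_of_le_pi <;> nlinarith [Real.pi_pos]

theorem hauptmodul_not_const : ¬ ∃ c, ∀ z : ℂ, 0 < z.im → hauptmodul z = c := by
  rintro ⟨c, hc⟩
  obtain ⟨φ, hφ, hφ1⟩ := exists_hauptmodul_expansion
  have hcont : ContinuousAt (fun q => φ q - c * q) 0 :=
    hφ.1.continuousAt.sub (continuousAt_const.mul continuousAt_id)
  obtain ⟨Y, hY0, hY⟩ := exists_forall_norm_sub_le hcont one_pos
  have h1 := hY (Y * Complex.I) (by simp)
  have h2 := hφ.2 (Y * Complex.I) (by simpa using hY0)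
  rw [hc _ (by simpa using hY0), pow_one] at h2
  rw [← h2] at h1
  simp [hφ1] at h1

/-- `Im J` is the real part of `-iJ`; it vanishes on the mirrors, and near the cusp it is at least
`-ε` because `Im q⁻¹ ≥ 0`. -/
theorem hauptmodul_im_nonneg {z : ℂ} (hz : z ∈ leftHalf) : 0 ≤ (hauptmodul z).im := by
  have := re_nonneg_of_boundary (g := fun z => -Complex.I * hauptmodul z)
    (hauptmodul_invariant.diff.const_mul _)
    (fun z hz hm => by simp [hauptmodul_invariant.im_eq_zero hz.2.2.2.2 hm]) (fun ε hε => by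
      obtain ⟨φ, hφ, hφ0, heq⟩ := exists_hauptmodul_eq
      obtain ⟨Y, hY0, hY⟩ := exists_forall_norm_sub_le hφ.continuousAt hε
      refine ⟨Y, fun z hzY h1 h2 => ?_⟩
      have h3 := (abs_lt.mp ((abs_im_le_norm _).trans_lt (hY z hzY))).1
      rw [sub_im, hφ0, sub_zero] at h3
      have h4 := inv_qParam_im_nonneg h1 h2
      have h5 : (-Complex.I * hauptmodul z).re = (hauptmodul z).im := by simp
      rw [h5, heq z (by linarith), add_im]
      linarith) hz
  simpa using this

theorem hauptmodul_im_pos {z : ℂ} (hz : z ∈ leftHalf) : 0 < (hauptmodul z).im := by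
  have := re_pos_of_re_nonneg (g := fun z => -Complex.I * hauptmodul z)
    (hauptmodul_invariant.diff.const_mul _) (fun ⟨c, hc⟩ => hauptmodul_not_const
      ⟨-c / Complex.I, fun z hz => by rw [← hc z hz]; field_simp⟩)
    (fun z hz => by simpa using hauptmodul_im_nonneg hz) hz
  simpa using this

theorem hauptmodul_im_nonneg_of_closed {z : ℂ} (hz : z ∈ leftHalfClosed) :
    0 ≤ (hauptmodul z).im := by
  by_cases hm : z ∈ mirrorSet
  · exact (hauptmodul_invariant.im_eq_zero hz.2.2.2.2 hm).ge
  · obtain ⟨h1, h2, h3, h4, h5⟩ := hz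
    simp only [mirrorSet, mem_ofPred_eq, not_or] at hm
    obtain ⟨m1, m2, m3, m4⟩ := hm
    exact hauptmodul_im_nonneg ⟨lt_of_le_of_ne h1 (Ne.symm m2), lt_of_le_of_ne h2 m1,
      lt_of_le_of_ne h3 (Ne.symm m3), lt_of_le_of_ne h4 (Ne.symm m4), h5⟩

theorem hauptmodul_analyticAt {z : ℂ} (hz : 0 < z.im) : AnalyticAt ℂ hauptmodul z :=
  hauptmodul_invariant.diff.analyticAt (isOpen_upperHalf.mem_nhds hz)

theorem hasDerivAt_hauptmodul {z : ℂ} (hz : 0 < z.im) :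
    HasDerivAt hauptmodul (deriv hauptmodul z) z :=
  (hauptmodul_analyticAt hz).differentiableAt.hasDerivAt

theorem nonneg_of_hasDerivAt_of_nonneg {φ : ℝ → ℝ} {d x : ℝ} (hd : HasDerivAt φ d x)
    (h0 : φ x = 0) (hn : ∀ᶠ s in 𝓝[>] x, 0 ≤ φ s) : 0 ≤ d := by
  have h := (hasDerivAt_iff_tendsto_slope.mp hd).mono_left (nhdsGT_le_nhdsNE x)
  refine ge_of_tendsto h ?_
  filter_upwards [hn, self_mem_nhdsWithin] with s h1 h2
  rw [slope_def_field, h0, sub_zero]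
  exact div_nonneg h1 (sub_nonneg.mpr (le_of_lt h2))

theorem hasDerivAt_im_hauptmodul_comp {γ : ℝ → ℂ} {γ' : ℂ} {s : ℝ} (hγ : HasDerivAt γ γ' s)
    (hs : 0 < (γ s).im) :
    HasDerivAt (fun r => (hauptmodul (γ r)).im) (deriv hauptmodul (γ s) * γ').im s := by
  have h1 : HasDerivAt (fun r => hauptmodul (γ r)) (deriv hauptmodul (γ s) * γ') s :=
    (hasDerivAt_hauptmodul hs).comp s hγ
  exact (Complex.imCLM.hasFDerivAt.comp_hasDerivAt s h1)

theorem hasDerivAt_re_hauptmodul_comp {γ : ℝ → ℂ} {γ' : ℂ} {s : ℝ} (hγ : HasDerivAt γ γ' s)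
    (hs : 0 < (γ s).im) :
    HasDerivAt (fun r => (hauptmodul (γ r)).re) (deriv hauptmodul (γ s) * γ').re s := by
  have h1 : HasDerivAt (fun r => hauptmodul (γ r)) (deriv hauptmodul (γ s) * γ') s :=
    (hasDerivAt_hauptmodul hs).comp s hγ
  exact (Complex.reCLM.hasFDerivAt.comp_hasDerivAt s h1)

theorem hasDerivAt_add_ofReal_mul (z w : ℂ) (s : ℝ) :
    HasDerivAt (fun r : ℝ => z + r * w) w s := by
  have := ((hasDerivAt_id (s : ℂ)).comp_ofReal.mul_const w).const_add z
  simpa using! this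

/-- Straight up from a mirror point the region is never left, so `Im J` starts at `0` and stays
nonnegative; its vertical derivative is `Im (i J') = Re J'`. -/
theorem deriv_hauptmodul_re_nonneg_of_mirror {z : ℂ} (hz : z ∈ leftHalfClosed)
    (hm : z ∈ mirrorSet) : 0 ≤ (deriv hauptmodul z).re := by
  have h1 := hasDerivAt_im_hauptmodul_comp (hasDerivAt_add_ofReal_mul z Complex.I 0)
    (by simpa using hz.2.2.2.2)
  have h2 := nonneg_of_hasDerivAt_of_nonneg h1
    (by simpa using hauptmodul_invariant.im_eq_zero hz.2.2.2.2 hm) (by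
      filter_upwards [self_mem_nhdsWithin] with s hs
      have hs : 0 < s := hs
      apply hauptmodul_im_nonneg_of_closed
      obtain ⟨h1, h2, h3, h4, h5⟩ := hz
      refine ⟨?_, ?_, ?_, ?_, ?_⟩ <;> simp <;> nlinarith)
  simpa using h2

theorem exists_deriv_hauptmodul_eq : ∃ (ψ : ℂ → ℂ) (Y : ℝ), 0 < Y ∧ ContinuousAt ψ 0 ∧ ψ 0 = 0 ∧
    ∀ z : ℂ, Y ≤ z.im →
      deriv hauptmodul z = -(2 * Real.pi * Complex.I) * (𝕢 z)⁻¹ + ψ (𝕢 z) := by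
  obtain ⟨φ, hφ, hφ0, heq⟩ := exists_hauptmodul_eq
  obtain ⟨r, hr, hball⟩ := Metric.eventually_nhds_iff.mp hφ.eventually_analyticAt
  obtain ⟨Y, hY0, hY⟩ := exists_forall_norm_qParam_lt hr
  refine ⟨fun q => deriv φ q * (2 * Real.pi * Complex.I * q), Y, hY0, ?_, by simp, ?_⟩
  · exact hφ.deriv.continuousAt.mul (by fun_prop)
  · intro z hz
    have him : 0 < z.im := by linarith
    have hq : HasDerivAt 𝕢 (2 * Real.pi * Complex.I * 𝕢 z) z := by
      have h1 : HasDerivAt (fun z : ℂ => 2 * Real.pi * Complex.I * z / (1 : ℝ))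
          (2 * Real.pi * Complex.I) z := by
        simpa using ((hasDerivAt_id z).const_mul (2 * Real.pi * Complex.I : ℂ))
      have h2 := h1.cexp
      rw [mul_comm (cexp _)] at h2
      exact h2
    have hq0 : 𝕢 z ≠ 0 := Function.Periodic.qParam_ne_zero z
    have hφz : HasDerivAt φ (deriv φ (𝕢 z)) (𝕢 z) :=
      (hball (by simpa using hY z hz)).differentiableAt.hasDerivAt
    have h3 := (hq.inv hq0).add (hφz.comp z hq)
    have h4 : HasDerivAt hauptmodul _ z := h3.congr_of_eventuallyEq (by
      filter_upwards [isOpen_upperHalf.mem_nhds him] with w hw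
      simpa using heq w hw)
    rw [h4.deriv]
    field_simp

/-- The minimum principle is used a second time, now for `J'`: near the cusp `Re J'` is `2π Im q⁻¹`
up to a vanishing error. -/
theorem deriv_hauptmodul_re_pos {z : ℂ} (hz : z ∈ leftHalf) : 0 < (deriv hauptmodul z).re := by
  have hd : DifferentiableOn ℂ (deriv hauptmodul) {z | 0 < z.im} :=
    hauptmodul_invariant.diff.deriv isOpen_upperHalf
  obtain ⟨ψ, Y₀, hY₀, hψ, hψ0, heq⟩ := exists_deriv_hauptmodul_eq
  refine re_pos_of_re_nonneg hd ?_ (fun z hz => re_nonneg_of_boundary hd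
    (fun z hz hm => deriv_hauptmodul_re_nonneg_of_mirror hz hm) (fun ε hε => ?_) hz) hz
  -- A constant `J'` would give `q J' → 0` at the cusp, whereas the pole of J makes this limit
  -- `-2πi`.
  · rintro ⟨c, hc⟩
    have hcont : ContinuousAt (fun q => (c - ψ q) * q) 0 := by
      exact (continuousAt_const.sub hψ).mul continuousAt_id
    obtain ⟨Y, hY0, hY⟩ := exists_forall_norm_sub_le hcont (Real.pi_pos)
    have h1 := hY (max Y Y₀ * Complex.I) (by simp)
    have him : 0 < max Y Y₀ := lt_max_of_lt_left hY0
    have h2 := heq (max Y Y₀ * Complex.I) (by simp)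
    rw [hc _ (by simpa using him)] at h2
    have hq0 : 𝕢 (max Y Y₀ * Complex.I) ≠ 0 := Function.Periodic.qParam_ne_zero _
    have h3 : (c - ψ (𝕢 (max Y Y₀ * Complex.I))) * 𝕢 (max Y Y₀ * Complex.I) =
        -(2 * Real.pi * Complex.I) := by
      rw [h2, add_sub_cancel_right, inv_mul_cancel_right₀ hq0]
    rw [h3] at h1
    simp [abs_of_pos Real.pi_pos] at h1
    linarith [Real.pi_pos]
  · obtain ⟨Y, hY0, hY⟩ := exists_forall_norm_sub_le hψ hε
    refine ⟨max Y Y₀, fun z hzY h1 h2 => ?_⟩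
    rw [heq z ((le_max_right _ _).trans hzY), add_re]
    have h3 := (abs_lt.mp ((abs_re_le_norm _).trans_lt (hY z ((le_max_left _ _).trans hzY)))).1
    rw [hψ0, sub_zero] at h3
    have h4 := inv_qParam_im_nonneg h1 h2
    have h5 : (-(2 * Real.pi * Complex.I) * (𝕢 z)⁻¹).re = 2 * Real.pi * ((𝕢 z)⁻¹).im := by
      simp [mul_re]
    rw [h5]
    have := Real.pi_pos
    nlinarith [mul_nonneg this.le h4]

/-! ### Injectivity of J on the half domain -/

/-- On vertical lines in `leftHalf` the imaginary part of the Hauptmodul is increasing. -/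
theorem hauptmodul_im_lt_of_im_lt {z w : ℂ} (hz : z ∈ leftHalf) (hw : w ∈ leftHalf)
    (hre : z.re = w.re) (him : z.im < w.im) : (hauptmodul z).im < (hauptmodul w).im := by
  have hconv : Convex ℝ ({u : ℂ | u.re = z.re} ∩ {u | z.im ≤ u.im}) := by
    refine Convex.inter ?_ (convex_halfSpace_im_ge _)
    intro a ha b hb s t hs ht hst
    have ha : a.re = z.re := ha
    have hb : b.re = z.re := hb
    show (s • a + t • b).re = z.re
    simp [ha, hb, ← add_mul, hst]
  have hsub : ∀ u ∈ ({u : ℂ | u.re = z.re} ∩ {u | z.im ≤ u.im}), u ∈ leftHalf := by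
    rintro u ⟨hu1, hu2⟩
    have hu1 : u.re = z.re := hu1
    have hu2 : z.im ≤ u.im := hu2
    obtain ⟨h1, h2, h3, h4, h5⟩ := hz
    refine ⟨by rwa [hu1], by rwa [hu1], ?_, ?_, by linarith⟩ <;> rw [hu1] <;> nlinarith
  have := re_slope_pos_of_convex hconv
    (fun u hu => hasDerivAt_hauptmodul (leftHalf_im_pos (hsub u hu)))
    (fun u hu => deriv_hauptmodul_re_pos (hsub u hu)) (z := z) (w := w)
    ⟨rfl, (show z.im ≤ z.im from le_rfl)⟩
    ⟨hre.symm, him.le⟩ (by rintro rfl; exact lt_irrefl _ him)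
  have hwz : w - z = ((w.im - z.im : ℝ) : ℂ) * Complex.I := by
    apply Complex.ext <;> simp [hre]
  rw [hwz, div_mul_eq_div_div, div_I, ← neg_mul] at this
  simp only [mul_re, neg_im, Complex.I_re, mul_zero, Complex.I_im, mul_one, zero_sub, neg_neg,
    div_ofReal_im, sub_im] at this
  have h2 := (div_pos_iff_of_pos_right (sub_pos.mpr him)).mp this
  linarith

/-- Near a boundary point the lower boundary of `leftHalf` is the graph of this function. -/
def lowerBoundary (x : ℝ) : ℝ := max √(1 / 5 - x ^ 2) √(1 / 20 - (x + 1 / 2) ^ 2)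

theorem lowerBoundary_mem {x : ℝ} (h1 : -(1 / 2) < x) (h2 : x < 0) :
    (x + lowerBoundary x * Complex.I : ℂ) ∈ leftHalfClosed ∩ mirrorSet := by
  have hp : 0 < lowerBoundary x := by
    by_cases h : -(2 / 5) ≤ x
    · exact lt_max_of_lt_left (Real.sqrt_pos.mpr (by nlinarith))
    · exact lt_max_of_lt_right (Real.sqrt_pos.mpr (by nlinarith))
  have h3 : 1 / 5 - x ^ 2 ≤ lowerBoundary x ^ 2 :=
    (Real.sqrt_le_iff.mp (le_max_left _ _)).2
  have h4 : 1 / 20 - (x + 1 / 2) ^ 2 ≤ lowerBoundary x ^ 2 :=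
    (Real.sqrt_le_iff.mp (le_max_right _ _)).2
  refine ⟨⟨by simpa using h1.le, by simpa using h2.le, ?_, ?_, by simpa using hp⟩, ?_⟩
  · simp; linarith
  · simp; linarith
  · rcases max_choice √(1 / 5 - x ^ 2) √(1 / 20 - (x + 1 / 2) ^ 2) with h | h
    · right; right; left
      have : lowerBoundary x ^ 2 = 1 / 5 - x ^ 2 := by
        rw [lowerBoundary, h] at hp ⊢
        exact Real.sq_sqrt (Real.sqrt_pos.mp hp).le
      simp [this]
    · right; right; right
      have : lowerBoundary x ^ 2 = 1 / 20 - (x + 1 / 2) ^ 2 := by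
        rw [lowerBoundary, h] at hp ⊢
        exact Real.sq_sqrt (Real.sqrt_pos.mp hp).le
      simp at this ⊢
      linarith

theorem exists_hauptmodul_im_ge {x : ℝ} (h1 : -(1 / 2) < x) (h2 : x < 0) (b y₀ : ℝ) :
    ∃ y : ℝ, y₀ < y ∧ b ≤ (hauptmodul (x + y * Complex.I)).im := by
  obtain ⟨φ, hφ, hφ0, heq⟩ := exists_hauptmodul_eq
  obtain ⟨Y, hY0, hY⟩ := exists_forall_norm_sub_le hφ.continuousAt one_pos
  have hsin : 0 < Real.sin (-(2 * Real.pi * x)) := by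
    apply Real.sin_pos_of_pos_of_lt_pi <;> nlinarith [Real.pi_pos]
  have hT : Tendsto (fun y : ℝ => Real.exp (2 * Real.pi * y) * Real.sin (-(2 * Real.pi * x)))
      atTop atTop := by
    refine Tendsto.atTop_mul_const hsin (Real.tendsto_exp_atTop.comp ?_)
    exact tendsto_id.const_mul_atTop (by positivity)
  obtain ⟨y, hy1, hy2, hy3⟩ := ((hT.eventually_ge_atTop (b + 1)).and
    ((eventually_gt_atTop y₀).and (eventually_ge_atTop Y))).exists
  refine ⟨y, hy2, ?_⟩
  have h3 := (abs_lt.mp ((abs_im_le_norm _).trans_lt (hY (x + y * Complex.I) (by simpa using hy3)))).1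
  rw [sub_im, hφ0, sub_zero] at h3
  rw [heq _ (by simp; linarith), add_im, inv_qParam, im_ofReal_mul, exp_ofReal_mul_I_im]
  simp only [add_re, ofReal_re, mul_re, Complex.I_re, mul_zero, ofReal_im, Complex.I_im, mul_one, sub_self,
    add_zero, add_im, mul_im, zero_add]
  linarith

theorem mem_leftHalf_of_lowerBoundary_lt {x y : ℝ} (h1 : -(1 / 2) < x) (h2 : x < 0)
    (hy : lowerBoundary x < y) : (x + y * Complex.I : ℂ) ∈ leftHalf := by
  have := add_ofReal_mul_I_mem_leftHalf (lowerBoundary_mem h1 h2).1 (by simpa using h1)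
    (by simpa using h2) (sub_pos.mpr hy)
  convert this using 1
  push_cast; ring

/-- On a vertical line `Im J` runs continuously from `0` on the mirror to arbitrarily large values
near the cusp. -/
theorem exists_mem_leftHalf_im_eq {x : ℝ} (h1 : -(1 / 2) < x) (h2 : x < 0) {b : ℝ} (hb : 0 < b) :
    ∃ y : ℝ, (x + y * Complex.I : ℂ) ∈ leftHalf ∧ (hauptmodul (x + y * Complex.I)).im = b := by
  obtain ⟨y₁, hy₁, hy₁b⟩ := exists_hauptmodul_im_ge h1 h2 b (lowerBoundary x)
  have hmem := lowerBoundary_mem h1 h2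
  have h0 := hauptmodul_invariant.im_eq_zero hmem.1.2.2.2.2 hmem.2
  have hpos : 0 < lowerBoundary x := by simpa using hmem.1.2.2.2.2
  have hcont : ContinuousOn (fun y : ℝ => (hauptmodul (x + y * Complex.I)).im)
      (Icc (lowerBoundary x) y₁) := by
    intro y hy
    have hγ : HasDerivAt (fun r : ℝ => (x + r * Complex.I : ℂ)) Complex.I y :=
      hasDerivAt_add_ofReal_mul x Complex.I y
    exact (hasDerivAt_im_hauptmodul_comp hγ
      (by simpa using hpos.trans_le hy.1)).continuousAt.continuousWithinAt
  obtain ⟨y, hy, hyb⟩ := intermediate_value_Icc hy₁.le hcont ⟨by rw [h0]; exact hb.le, hy₁b⟩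
  refine ⟨y, mem_leftHalf_of_lowerBoundary_lt h1 h2 (lt_of_le_of_ne hy.1 ?_), hyb⟩
  rintro rfl
  simp only at hyb
  rw [h0] at hyb
  exact hb.ne hyb

theorem hauptmodul_continuousAt {z : ℂ} (hz : 0 < z.im) : ContinuousAt hauptmodul z :=
  (hauptmodul_analyticAt hz).continuousAt

/-- The level sets of the imaginary part of the Hauptmodul in `leftHalf` are continuous graphs. -/
theorem continuousAt_of_level {b : ℝ} {Y : ℝ → ℝ}
    (hY : ∀ x : ℝ, -(1 / 2) < x → x < 0 → (x + Y x * Complex.I : ℂ) ∈ leftHalf ∧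
      (hauptmodul (x + Y x * Complex.I)).im = b) {x : ℝ} (h1 : -(1 / 2) < x) (h2 : x < 0) :
    ContinuousAt Y x := by
  rw [Metric.continuousAt_iff']
  intro ε hε
  have hmem := (hY x h1 h2).1
  have hnear : ∀ᶠ s : ℝ in 𝓝[>] 0, (x + (Y x - s : ℝ) * Complex.I : ℂ) ∈ leftHalf := by
    have hc : Continuous fun s : ℝ => (x + (Y x - s : ℝ) * Complex.I : ℂ) := by fun_prop
    have := hc.continuousAt.preimage_mem_nhds (x := 0) (t := leftHalf)
      (isOpen_leftHalf.mem_nhds (by simpa using hmem))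
    exact nhdsWithin_le_nhds this
  obtain ⟨s, hs, hs0, hsε⟩ := (hnear.and (Ioo_mem_nhdsGT hε)).exists
  have hs' : (x + (Y x + s : ℝ) * Complex.I : ℂ) ∈ leftHalf := by
    have := add_ofReal_mul_I_mem_leftHalf (leftHalf_subset_closed hmem) (by simpa using h1)
      (by simpa using h2) hs0
    convert this using 1
    push_cast; ring
  have hlow : (hauptmodul (x + (Y x - s : ℝ) * Complex.I)).im < b := by
    rw [← (hY x h1 h2).2]
    exact hauptmodul_im_lt_of_im_lt hs hmem (by simp) (by simpa using hs0)
  have hhigh : b < (hauptmodul (x + (Y x + s : ℝ) * Complex.I)).im := by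
    rw [← (hY x h1 h2).2]
    exact hauptmodul_im_lt_of_im_lt hmem hs' (by simp) (by simpa using hs0)
  have ev : ∀ y : ℝ, (x + y * Complex.I : ℂ) ∈ leftHalf →
      (∀ᶠ u : ℝ in 𝓝 x, (u + y * Complex.I : ℂ) ∈ leftHalf) ∧
      ContinuousAt (fun u : ℝ => (hauptmodul (u + y * Complex.I)).im) x := by
    intro y hy
    have hc : ContinuousAt (fun u : ℝ => (u + y * Complex.I : ℂ)) x := by fun_prop
    refine ⟨hc.preimage_mem_nhds (isOpen_leftHalf.mem_nhds hy), ?_⟩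
    exact (Complex.continuous_im.continuousAt).comp
      (ContinuousAt.comp (g := hauptmodul) (hauptmodul_continuousAt (leftHalf_im_pos hy)) hc)
  -- The strict inequalities at the heights `Y x ± s` persist for nearby `u`, and monotonicity on
  -- the vertical line traps `Y u` between them.
  filter_upwards [(ev _ hs).1, (ev _ hs').1, (ev _ hs).2.eventually_lt_const hlow,
    (ev _ hs').2.eventually_const_lt hhigh, Ioo_mem_nhds h1 h2] with u a1 a2 a3 a4 a5
  obtain ⟨c1, c2⟩ := hY u a5.1 a5.2
  have b1 : Y x - s < Y u := by
    by_contra! hle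
    rcases hle.eq_or_lt with he | hl
    · rw [← he, c2] at a3; exact lt_irrefl _ a3
    · have := hauptmodul_im_lt_of_im_lt c1 a1 (by simp) (by simpa using hl)
      linarith
  have b2 : Y u < Y x + s := by
    by_contra! hle
    rcases hle.eq_or_lt with he | hl
    · rw [he, c2] at a4; exact lt_irrefl _ a4
    · have := hauptmodul_im_lt_of_im_lt a2 c1 (by simp) (by simpa using hl)
      linarith
  rw [Real.dist_eq, abs_lt]
  constructor <;> linarith

/-- Along a level curve the increments of J are real. On a small ball the difference quotient has
positive real part, so a real increment has the sign of the increment of `x`; continuity of the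
curve makes this local comparison global. -/
theorem hauptmodul_re_lt_of_level {b : ℝ} {Y : ℝ → ℝ}
    (hY : ∀ x : ℝ, -(1 / 2) < x → x < 0 → (x + Y x * Complex.I : ℂ) ∈ leftHalf ∧
      (hauptmodul (x + Y x * Complex.I)).im = b) {x₁ x₂ : ℝ} (h1 : -(1 / 2) < x₁) (h2 : x₂ < 0)
    (h12 : x₁ < x₂) :
    (hauptmodul (x₁ + Y x₁ * Complex.I)).re < (hauptmodul (x₂ + Y x₂ * Complex.I)).re := by
  have hcγ : ∀ x : ℝ, -(1 / 2) < x → x < 0 →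
      ContinuousAt (fun u : ℝ => (u + Y u * Complex.I : ℂ)) x := by
    intro x hx1 hx2
    have := continuousAt_of_level hY hx1 hx2
    fun_prop
  refine lt_of_forall_eventually_lt (U := fun x => (hauptmodul (x + Y x * Complex.I)).re) h12 ?_ ?_
  · intro x hx
    have hx1 : -(1 / 2) < x := h1.trans_le hx.1
    have hx2 : x < 0 := hx.2.trans_lt h2
    exact (Complex.continuous_re.continuousAt.comp (ContinuousAt.comp (g := hauptmodul)
      (f := fun u : ℝ => (u + Y u * Complex.I : ℂ))
      (hauptmodul_continuousAt (leftHalf_im_pos (hY x hx1 hx2).1))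
      (hcγ x hx1 hx2))).continuousWithinAt
  · intro x hx
    have hx1 : -(1 / 2) < x := h1.trans_le hx.1
    have hx2 : x < 0 := hx.2.trans h2
    obtain ⟨hm, hb⟩ := hY x hx1 hx2
    obtain ⟨r, hr, hball⟩ := Metric.isOpen_iff.mp isOpen_leftHalf _ hm
    have e1 := (hcγ x hx1 hx2).preimage_mem_nhds (Metric.ball_mem_nhds _ hr)
    filter_upwards [nhdsWithin_le_nhds e1, nhdsWithin_le_nhds (Ioo_mem_nhds hx1 hx2),
      self_mem_nhdsWithin] with y a1 a2 a3
    have a3 : x < y := a3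
    have hs := re_slope_pos_of_convex (convex_ball _ r)
      (fun u hu => hasDerivAt_hauptmodul (leftHalf_im_pos (hball hu)))
      (fun u hu => deriv_hauptmodul_re_pos (hball hu)) (Metric.mem_ball_self hr) a1
      (fun h => by have := congrArg Complex.re h; simp at this; linarith)
    have hd : hauptmodul (y + Y y * Complex.I) - hauptmodul (x + Y x * Complex.I) =
        (((hauptmodul (y + Y y * Complex.I)).re - (hauptmodul (x + Y x * Complex.I)).re : ℝ) : ℂ) := by
      apply Complex.ext
      · simp
      · simp [(hY y a2.1 a2.2).2, hb]
    rw [hd, div_eq_mul_inv, re_ofReal_mul, inv_re] at hs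
    have hpos : 0 < (y + Y y * Complex.I - (x + Y x * Complex.I) : ℂ).re := by
      simpa using a3
    have hpos2 : 0 ≤ (y + Y y * Complex.I - (x + Y x * Complex.I) : ℂ).re /
        normSq (y + Y y * Complex.I - (x + Y x * Complex.I)) :=
      div_nonneg hpos.le (normSq_nonneg _)
    have := pos_of_mul_pos_left hs hpos2
    linarith

/-- Points with equal values lie on one level curve of `Im J`, along which `Re J` separates
different abscissas. For equal abscissas the vertical monotonicity of `Im J` decides. -/
theorem hauptmodul_injOn_leftHalf : InjOn hauptmodul leftHalf := by
  have key : ∀ z ∈ leftHalf, ∀ w ∈ leftHalf, hauptmodul z = hauptmodul w → ¬ z.re < w.re := by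
    intro z hz w hw h hlt
    have hb := hauptmodul_im_pos hz
    have hex : ∀ x : ℝ, ∃ y : ℝ, -(1 / 2) < x → x < 0 → (x + y * Complex.I : ℂ) ∈ leftHalf ∧
        (hauptmodul (x + y * Complex.I)).im = (hauptmodul z).im := by
      intro x
      by_cases hx : -(1 / 2) < x ∧ x < 0
      · obtain ⟨y, hy⟩ := exists_mem_leftHalf_im_eq hx.1 hx.2 hb
        exact ⟨y, fun _ _ => hy⟩
      · exact ⟨0, fun a b => absurd ⟨a, b⟩ hx⟩
    choose Y hY using hex
    have huniq : ∀ u ∈ leftHalf, (hauptmodul u).im = (hauptmodul z).im →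
        (u.re + Y u.re * Complex.I : ℂ) = u := by
      intro u hu hub
      obtain ⟨m1, m2⟩ := hY u.re hu.1 hu.2.1
      rcases lt_trichotomy (Y u.re) u.im with hl | he | hl
      · have := hauptmodul_im_lt_of_im_lt m1 hu (by simp) (by simpa using hl)
        rw [m2, hub] at this; exact absurd this (lt_irrefl _)
      · rw [he]; exact re_add_im u
      · have := hauptmodul_im_lt_of_im_lt hu m1 (by simp) (by simpa using hl)
        rw [m2, hub] at this; exact absurd this (lt_irrefl _)
    have := hauptmodul_re_lt_of_level hY hz.1 hw.2.1 hlt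
    rw [huniq z hz rfl, huniq w hw (by rw [h]), h] at this
    exact lt_irrefl _ this
  intro z hz w hw h
  have hre : z.re = w.re := le_antisymm (not_lt.mp (key w hw z hz h.symm))
    (not_lt.mp (key z hz w hw h))
  refine Complex.ext hre ?_
  rcases lt_trichotomy z.im w.im with hl | he | hl
  · exact absurd (congrArg Complex.im h) (hauptmodul_im_lt_of_im_lt hz hw hre hl).ne
  · exact he
  · exact absurd (congrArg Complex.im h).symm (hauptmodul_im_lt_of_im_lt hw hz hre.symm hl).ne

/-! ### J on the boundary of the half domain -/

theorem hauptmodul_not_eventually_const {z : ℂ} (hz : 0 < z.im) (c : ℂ) :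
    ¬ ∀ᶠ w in 𝓝 z, hauptmodul w = c := by
  intro h
  have h1 := (hauptmodul_invariant.diff.analyticOnNhd isOpen_upperHalf).eqOn_of_preconnected_of_eventuallyEq
    (g := fun _ => c) (fun _ _ => analyticAt_const) convex_upperHalfPlane.isPreconnected hz h
  exact hauptmodul_not_const ⟨c, fun w hw => h1 hw⟩

/-- At a non-elliptic boundary point the region contains half of a small disc, which leaves no room
for a critical point: one would open the angle `π` to at least `2π`. The vector `w` is the normal
pointing into the region. -/
theorem deriv_hauptmodul_ne_zero_of_halfPlane {z₀ w : ℂ} (him : 0 < z₀.im) (hm : z₀ ∈ mirrorSet)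
    (hw : w ≠ 0) (h : ∀ᶠ z in 𝓝 z₀, 0 < ((z - z₀) * conj w).re → z ∈ leftHalfClosed) :
    deriv hauptmodul z₀ ≠ 0 :=
  deriv_ne_zero_of_im_nonneg_on_halfPlane (hauptmodul_analyticAt him)
    (hauptmodul_invariant.im_eq_zero him hm) hw
    (h.mono fun _ hz hpos => hauptmodul_im_nonneg_of_closed (hz hpos))
    (hauptmodul_not_eventually_const him _)

/-- The part of the imaginary axis on the boundary of `leftHalf`, without the elliptic point. -/
def rightLine : Set ℂ := {z | z.re = 0 ∧ 1 / 5 < z.im ^ 2 ∧ 0 < z.im}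

/-- The part of the line `Re z = -1/2` on the boundary of `leftHalf`, without the elliptic point. -/
def leftLine : Set ℂ := {z | z.re = -(1 / 2) ∧ 1 / 20 < z.im ^ 2 ∧ 0 < z.im}

/-- The open arc of `|z| = 1/√5` on the boundary of `leftHalf`. -/
def rightArc : Set ℂ :=
  {z | z.re ^ 2 + z.im ^ 2 = 1 / 5 ∧ -(2 / 5) < z.re ∧ z.re < 0 ∧ 0 < z.im}

/-- The open arc of `|z + 1/2| = 1/(2√5)` on the boundary of `leftHalf`. -/
def leftArc : Set ℂ :=
  {z | (z.re + 1 / 2) ^ 2 + z.im ^ 2 = 1 / 20 ∧ -(1 / 2) < z.re ∧ z.re < -(2 / 5) ∧ 0 < z.im}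

theorem continuous_re_sq_add_im_sq (c : ℝ) : Continuous fun z : ℂ => (z.re + c) ^ 2 + z.im ^ 2 :=
  ((Complex.continuous_re.add continuous_const).pow 2).add (Complex.continuous_im.pow 2)

theorem deriv_hauptmodul_ne_zero_of_mem_rightLine {z : ℂ} (hz : z ∈ rightLine) :
    deriv hauptmodul z ≠ 0 := by
  obtain ⟨h1, h2, h3⟩ := hz
  refine deriv_hauptmodul_ne_zero_of_halfPlane h3 (Or.inl h1) (w := -1) (by norm_num) ?_
  filter_upwards [Complex.continuous_re.continuousAt.eventually_const_lt
      (show -(1 / 4) < z.re by rw [h1]; norm_num),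
    (continuous_re_sq_add_im_sq 0).continuousAt.eventually_const_lt
      (show 1 / 5 < (z.re + 0) ^ 2 + z.im ^ 2 by rw [h1]; simpa using h2),
    isOpen_upperHalf.mem_nhds h3] with u a1 a2 a3 a4
  have a3 : 0 < u.im := a3
  have hu : u.re < 0 := by simpa [h1] using a4
  exact ⟨by linarith, hu.le, by linarith, by nlinarith, a3⟩

theorem deriv_hauptmodul_ne_zero_of_mem_leftLine {z : ℂ} (hz : z ∈ leftLine) :
    deriv hauptmodul z ≠ 0 := by
  obtain ⟨h1, h2, h3⟩ := hz
  refine deriv_hauptmodul_ne_zero_of_halfPlane h3 (Or.inr (Or.inl h1)) (w := 1) (by norm_num) ?_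
  filter_upwards [Complex.continuous_re.continuousAt.eventually_lt_const
      (show z.re < -(2 / 5) by rw [h1]; norm_num),
    (continuous_re_sq_add_im_sq (1 / 2)).continuousAt.eventually_const_lt
      (show 1 / 20 < (z.re + 1 / 2) ^ 2 + z.im ^ 2 by rw [h1]; simpa using h2),
    isOpen_upperHalf.mem_nhds h3] with u a1 a2 a3 a4
  have a3 : 0 < u.im := a3
  have hu : -(1 / 2) < u.re := by
    have : 0 < u.re - z.re := by simpa using a4
    linarith
  exact ⟨hu.le, by linarith, by nlinarith, a2.le, a3⟩

/-- The side of the tangent line away from the centre lies outside the circle, so the radius vector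
serves as normal. -/
theorem deriv_hauptmodul_ne_zero_of_mem_rightArc {z : ℂ} (hz : z ∈ rightArc) :
    deriv hauptmodul z ≠ 0 := by
  obtain ⟨h1, h2, h3, h4⟩ := hz
  refine deriv_hauptmodul_ne_zero_of_halfPlane h4 (Or.inr (Or.inr (Or.inl h1))) (w := z)
    (by rintro rfl; simp at h4) ?_
  filter_upwards [Complex.continuous_re.continuousAt.eventually_const_lt
      (show -(1 / 2) < z.re by linarith),
    Complex.continuous_re.continuousAt.eventually_lt_const h3,
    (continuous_re_sq_add_im_sq (1 / 2)).continuousAt.eventually_const_lt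
      (show 1 / 20 < (z.re + 1 / 2) ^ 2 + z.im ^ 2 by nlinarith),
    isOpen_upperHalf.mem_nhds h4] with u a1 a2 a3 a4 a5
  have a4 : 0 < u.im := a4
  simp at a5
  exact ⟨a1.le, a2.le, by nlinarith [sq_nonneg (u.re - z.re), sq_nonneg (u.im - z.im)], a3.le, a4⟩

theorem deriv_hauptmodul_ne_zero_of_mem_leftArc {z : ℂ} (hz : z ∈ leftArc) :
    deriv hauptmodul z ≠ 0 := by
  obtain ⟨h1, h2, h3, h4⟩ := hz
  refine deriv_hauptmodul_ne_zero_of_halfPlane h4 (Or.inr (Or.inr (Or.inr h1))) (w := z + 1 / 2)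
    (by intro h; have := congrArg Complex.im h; simp at this; linarith) ?_
  filter_upwards [Complex.continuous_re.continuousAt.eventually_const_lt h2,
    Complex.continuous_re.continuousAt.eventually_lt_const (show z.re < 0 by linarith),
    (continuous_re_sq_add_im_sq 0).continuousAt.eventually_const_lt
      (show 1 / 5 < (z.re + 0) ^ 2 + z.im ^ 2 by nlinarith),
    isOpen_upperHalf.mem_nhds h4] with u a1 a2 a3 a4 a5
  have a4 : 0 < u.im := a4
  simp at a5
  exact ⟨a1.le, a2.le, by linarith, by
    nlinarith [sq_nonneg (u.re - z.re), sq_nonneg (u.im - z.im)], a4⟩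

/-- The upper half of the circle with real centre `c` and squared radius `R`. -/
def circleCurve (c R x : ℝ) : ℂ := x + √(R - (x - c) ^ 2) * Complex.I

theorem circleCurve_re (c R x : ℝ) : (circleCurve c R x).re = x := by simp [circleCurve]

theorem circleCurve_im (c R x : ℝ) : (circleCurve c R x).im = √(R - (x - c) ^ 2) := by
  simp [circleCurve]

theorem circleCurve_eq {c R : ℝ} {z : ℂ} (hz : (z.re - c) ^ 2 + z.im ^ 2 = R) (him : 0 < z.im) :
    circleCurve c R z.re = z := by
  apply Complex.ext
  · simp [circleCurve_re]
  · rw [circleCurve_im, ← hz, add_sub_cancel_left, Real.sqrt_sq him.le]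

theorem circleCurve_mem {c R x : ℝ} (hx : 0 < R - (x - c) ^ 2) :
    ((circleCurve c R x).re - c) ^ 2 + (circleCurve c R x).im ^ 2 = R ∧
      0 < (circleCurve c R x).im := by
  rw [circleCurve_re, circleCurve_im, Real.sq_sqrt hx.le]
  exact ⟨by ring, Real.sqrt_pos.mpr hx⟩

/-- With tangent `1 + i y'`, reality of J on the circle makes its derivative equal to `Re J' (1 +
y'²)`. Since `Re J' ≥ 0`, and `Re J' = 0` would force `J' = 0`, this is positive. -/
theorem strictMonoOn_hauptmodul_circleCurve {c R a b : ℝ}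
    (hpos : ∀ x ∈ Icc a b, 0 < R - (x - c) ^ 2)
    (hm : ∀ z : ℂ, (z.re - c) ^ 2 + z.im ^ 2 = R → z ∈ mirrorSet)
    (hcl : ∀ x ∈ Ioo a b, circleCurve c R x ∈ leftHalfClosed)
    (hne : ∀ x ∈ Ioo a b, deriv hauptmodul (circleCurve c R x) ≠ 0) :
    StrictMonoOn (fun x => (hauptmodul (circleCurve c R x)).re) (Icc a b) := by
  have hder : ∀ x, 0 < R - (x - c) ^ 2 → ∃ y' : ℝ,
      HasDerivAt (circleCurve c R) (1 + y' * Complex.I) x := by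
    intro x hx
    have h1 : HasDerivAt (fun x : ℝ => R - (x - c) ^ 2) (-(2 * (x - c))) x := by
      simpa using! (((hasDerivAt_id x).sub_const c).pow 2).const_sub R
    have h2 := h1.sqrt hx.ne'
    refine ⟨_, (((hasDerivAt_id x).ofReal_comp).add
      (h2.ofReal_comp.mul_const Complex.I))⟩
  apply strictMonoOn_of_deriv_pos (convex_Icc a b)
  · intro x hx
    obtain ⟨y', hy'⟩ := hder x (hpos x hx)
    exact (hasDerivAt_re_hauptmodul_comp hy'
      (circleCurve_mem (hpos x hx)).2).continuousAt.continuousWithinAt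
  · intro x hx
    rw [interior_Icc] at hx
    have hxp := hpos x (Ioo_subset_Icc_self hx)
    obtain ⟨y', hy'⟩ := hder x hxp
    have him := (circleCurve_mem hxp).2
    rw [(hasDerivAt_re_hauptmodul_comp hy' him).deriv]
    have hreal : (deriv hauptmodul (circleCurve c R x) * (1 + y' * Complex.I)).im = 0 := by
      have h1 := hasDerivAt_im_hauptmodul_comp hy' him
      have h2 : ∀ᶠ u in 𝓝 x, (hauptmodul (circleCurve c R u)).im = 0 := by
        have hc : ContinuousAt (fun u : ℝ => R - (u - c) ^ 2) x := by fun_prop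
        filter_upwards [hc.eventually_const_lt hxp] with u hu
        exact hauptmodul_invariant.im_eq_zero (circleCurve_mem hu).2 (hm _ (circleCurve_mem hu).1)
      exact h1.unique ((hasDerivAt_const x (0 : ℝ)).congr_of_eventuallyEq h2)
    have hre := deriv_hauptmodul_re_nonneg_of_mirror (hcl x hx) (hm _ (circleCurve_mem hxp).1)
    have hn := hne x hx
    set D := deriv hauptmodul (circleCurve c R x)
    simp only [mul_im, mul_re, add_re, add_im, one_re, one_im, ofReal_re, ofReal_im, Complex.I_re,
      Complex.I_im, mul_zero, mul_one, sub_zero, zero_add, add_zero] at hreal ⊢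
    have hDi : D.im = -(D.re * y') := by linarith
    have hD0 : D.re ≠ 0 := fun h => hn (Complex.ext h (by rw [hDi, h]; simp))
    have hDp : 0 < D.re := lt_of_le_of_ne hre (Ne.symm hD0)
    rw [hDi]
    nlinarith [mul_nonneg hDp.le (sq_nonneg y')]

theorem strictMonoOn_hauptmodul_rightArc :
    StrictMonoOn (fun x => (hauptmodul (circleCurve 0 (1 / 5) x)).re) (Icc (-(2 / 5)) 0) := by
  have hmem : ∀ x ∈ Ioo (-(2 / 5) : ℝ) 0, circleCurve 0 (1 / 5) x ∈ rightArc := by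
    rintro x ⟨h1, h2⟩
    have h := circleCurve_mem (c := 0) (R := 1 / 5) (x := x) (by nlinarith)
    exact ⟨by simpa using h.1, by rwa [circleCurve_re], by rwa [circleCurve_re], h.2⟩
  refine strictMonoOn_hauptmodul_circleCurve ?_ ?_ ?_ ?_
  · rintro x ⟨h1, h2⟩; nlinarith
  · intro z hz; right; right; left; simpa using hz
  · intro x hx
    obtain ⟨h1, h2, h3, h4⟩ := hmem x hx
    exact ⟨by linarith, h3.le, h1.ge, by nlinarith, h4⟩
  · intro x hx; exact deriv_hauptmodul_ne_zero_of_mem_rightArc (hmem x hx)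

theorem strictMonoOn_hauptmodul_leftArc :
    StrictMonoOn (fun x => (hauptmodul (circleCurve (-(1 / 2)) (1 / 20) x)).re)
      (Icc (-(1 / 2)) (-(2 / 5))) := by
  have hmem : ∀ x ∈ Ioo (-(1 / 2) : ℝ) (-(2 / 5)), circleCurve (-(1 / 2)) (1 / 20) x ∈ leftArc := by
    rintro x ⟨h1, h2⟩
    have h := circleCurve_mem (c := -(1 / 2)) (R := 1 / 20) (x := x) (by nlinarith)
    exact ⟨by simpa using h.1, by rwa [circleCurve_re], by rwa [circleCurve_re], h.2⟩
  refine strictMonoOn_hauptmodul_circleCurve ?_ ?_ ?_ ?_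
  · rintro x ⟨h1, h2⟩; nlinarith
  · intro z hz; right; right; right; simpa using hz
  · intro x hx
    obtain ⟨h1, h2, h3, h4⟩ := hmem x hx
    exact ⟨by linarith, by linarith, by nlinarith, h1.ge, h4⟩
  · intro x hx; exact deriv_hauptmodul_ne_zero_of_mem_leftArc (hmem x hx)

theorem deriv_hauptmodul_re_eq_zero_of_line {c y : ℝ} (hy : 0 < y) (hc : c = 0 ∨ c = -(1 / 2)) :
    (deriv hauptmodul (c + y * Complex.I)).re = 0 := by
  have h1 := hasDerivAt_im_hauptmodul_comp (hasDerivAt_add_ofReal_mul c Complex.I y)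
    (by simpa using hy)
  have h2 : ∀ᶠ u : ℝ in 𝓝 y, (hauptmodul (c + u * Complex.I)).im = 0 := by
    filter_upwards [lt_mem_nhds hy] with u hu
    refine hauptmodul_invariant.im_eq_zero (by simpa using hu) ?_
    rcases hc with rfl | rfl
    · left; simp
    · right; left; simp
  have := h1.unique ((hasDerivAt_const y (0 : ℝ)).congr_of_eventuallyEq h2)
  simpa using this

/-- On the line `J'` is purely imaginary, and stepping horizontally into the region fixes its sign.
The step is to the left here and to the right on `Re z = -1/2`, whence the opposite monotonicity
there. -/
theorem strictMonoOn_hauptmodul_rightLine :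
    StrictMonoOn (fun y : ℝ => (hauptmodul ((0 : ℝ) + y * Complex.I)).re) (Ici √(1 / 5)) := by
  have h5 : (0 : ℝ) < √(1 / 5) := by positivity
  apply strictMonoOn_of_deriv_pos (convex_Ici _)
  · intro y hy
    have hy : √(1 / 5) ≤ y := hy
    exact (hasDerivAt_re_hauptmodul_comp (hasDerivAt_add_ofReal_mul (0 : ℝ) Complex.I y)
      (by simp; linarith)).continuousAt.continuousWithinAt
  · intro y hy
    rw [interior_Ici] at hy
    have hy : √(1 / 5) < y := hy
    have hy0 : 0 < y := h5.trans hy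
    have hy2 : 1 / 5 < y ^ 2 := (Real.sqrt_lt' hy0).mp hy
    have hmem : ((0 : ℝ) + y * Complex.I : ℂ) ∈ rightLine :=
      ⟨by simp, by simpa using hy2, by simpa using hy0⟩
    have hne := deriv_hauptmodul_ne_zero_of_mem_rightLine hmem
    have hre := deriv_hauptmodul_re_eq_zero_of_line hy0 (Or.inl rfl)
    rw [(hasDerivAt_re_hauptmodul_comp (hasDerivAt_add_ofReal_mul (0 : ℝ) Complex.I y)
      (by simpa using hy0)).deriv]
    have h1 := hasDerivAt_im_hauptmodul_comp
      (hasDerivAt_add_ofReal_mul ((0 : ℝ) + y * Complex.I) (-1) 0) (by simpa using hy0)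
    have h2 := nonneg_of_hasDerivAt_of_nonneg h1
      (by
        simp only [ofReal_zero, zero_mul, add_zero]
        exact hauptmodul_invariant.im_eq_zero (by simpa using hy0) (Or.inl (by simp))) (by
        filter_upwards [Ioo_mem_nhdsGT (show (0 : ℝ) < 1 / 4 by norm_num)] with s hs
        apply hauptmodul_im_nonneg_of_closed
        obtain ⟨hs1, hs2⟩ := hs
        refine ⟨?_, ?_, ?_, ?_, ?_⟩ <;> simp <;> nlinarith)
    simp only [ofReal_zero, zero_mul, add_zero] at h2 hne hre ⊢
    simp only [mul_neg, mul_one, neg_im, mul_re, Complex.I_re, Complex.I_im, mul_zero, zero_sub] at h2 ⊢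
    exact lt_of_le_of_ne h2 fun h => hne (Complex.ext hre (by simpa using h.symm))

theorem strictAntiOn_hauptmodul_leftLine :
    StrictAntiOn (fun y : ℝ => (hauptmodul ((-(1 / 2) : ℝ) + y * Complex.I)).re)
      (Ici √(1 / 20)) := by
  have h5 : (0 : ℝ) < √(1 / 20) := by positivity
  apply strictAntiOn_of_deriv_neg (convex_Ici _)
  · intro y hy
    have hy : √(1 / 20) ≤ y := hy
    exact (hasDerivAt_re_hauptmodul_comp (hasDerivAt_add_ofReal_mul (-(1 / 2) : ℝ) Complex.I y)
      (by simp; linarith)).continuousAt.continuousWithinAt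
  · intro y hy
    rw [interior_Ici] at hy
    have hy : √(1 / 20) < y := hy
    have hy0 : 0 < y := h5.trans hy
    have hy2 : 1 / 20 < y ^ 2 := (Real.sqrt_lt' hy0).mp hy
    have hmem : ((-(1 / 2) : ℝ) + y * Complex.I : ℂ) ∈ leftLine :=
      ⟨by simp, by simpa using hy2, by simpa using hy0⟩
    have hne := deriv_hauptmodul_ne_zero_of_mem_leftLine hmem
    have hre := deriv_hauptmodul_re_eq_zero_of_line hy0 (Or.inr rfl)
    rw [(hasDerivAt_re_hauptmodul_comp (hasDerivAt_add_ofReal_mul (-(1 / 2) : ℝ) Complex.I y)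
      (by simpa using hy0)).deriv]
    have h1 := hasDerivAt_im_hauptmodul_comp
      (hasDerivAt_add_ofReal_mul ((-(1 / 2) : ℝ) + y * Complex.I) 1 0) (by simpa using hy0)
    have h2 := nonneg_of_hasDerivAt_of_nonneg h1
      (by
        rw [ofReal_zero, zero_mul, add_zero]
        exact hauptmodul_invariant.im_eq_zero (by simpa using hy0) (Or.inr (Or.inl (by simp)))) (by
        -- The corner has abscissa `-1/2 + 1/10`; before it, points above height `√(1/20)` also lie
        -- outside the larger circle.
        filter_upwards [Ioo_mem_nhdsGT (show (0 : ℝ) < 1 / 10 by norm_num)] with s hs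
        apply hauptmodul_im_nonneg_of_closed
        obtain ⟨hs1, hs2⟩ := hs
        refine ⟨?_, ?_, ?_, ?_, ?_⟩ <;> simp <;> nlinarith)
    rw [ofReal_zero, zero_mul, add_zero, mul_one] at h2
    simp only [mul_re, Complex.I_re, Complex.I_im, mul_zero, mul_one, zero_sub]
    rw [neg_lt_zero]
    exact lt_of_le_of_ne h2 fun h => hne (Complex.ext hre h.symm)

/-! ### Injectivity of J on the regular set -/

/-- The mirror image of `leftHalf` in the imaginary axis. -/
def rightHalf : Set ℂ := {z | -conj z ∈ leftHalf}

/-- The boundary of `leftHalf` without the three elliptic points. -/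
def regularBoundary : Set ℂ := rightLine ∪ rightArc ∪ leftArc ∪ leftLine

/-- The inequivalent non-elliptic points on which the Hauptmodul is injective. -/
def regularSet : Set ℂ := leftHalf ∪ rightHalf ∪ regularBoundary

theorem rightHalf_im_pos {z : ℂ} (hz : z ∈ rightHalf) : 0 < z.im := by
  have := leftHalf_im_pos hz
  simpa using this

theorem regularBoundary_im_pos {z : ℂ} (hz : z ∈ regularBoundary) : 0 < z.im := by
  rcases hz with ((h | h) | h) | h
  exacts [h.2.2, h.2.2.2, h.2.2.2, h.2.2]

theorem regularSet_im_pos {z : ℂ} (hz : z ∈ regularSet) : 0 < z.im := by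
  rcases hz with (h | h) | h
  exacts [leftHalf_im_pos h, rightHalf_im_pos h, regularBoundary_im_pos h]

theorem hauptmodul_eq_conj {z : ℂ} (hz : 0 < z.im) :
    hauptmodul z = conj (hauptmodul (-conj z)) := by
  rw [hauptmodul_invariant.neg_conj z hz, conj_conj]

theorem hauptmodul_im_neg {z : ℂ} (hz : z ∈ rightHalf) : (hauptmodul z).im < 0 := by
  rw [hauptmodul_eq_conj (rightHalf_im_pos hz), conj_im]
  linarith [hauptmodul_im_pos hz]

theorem regularBoundary_subset_mirrorSet : regularBoundary ⊆ mirrorSet := by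
  rintro z (((h | h) | h) | h)
  exacts [Or.inl h.1, Or.inr (Or.inr (Or.inl h.1)), Or.inr (Or.inr (Or.inr h.1)),
    Or.inr (Or.inl h.1)]

theorem hauptmodul_im_eq_zero {z : ℂ} (hz : z ∈ regularBoundary) : (hauptmodul z).im = 0 :=
  hauptmodul_invariant.im_eq_zero (regularBoundary_im_pos hz) (regularBoundary_subset_mirrorSet hz)

theorem deriv_hauptmodul_ne_zero {z : ℂ} (hz : z ∈ regularSet) : deriv hauptmodul z ≠ 0 := by
  rcases hz with (h | h) | ((h | h) | h) | h
  · intro h0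
    have := deriv_hauptmodul_re_pos h
    rw [h0] at this
    exact lt_irrefl _ this
  · intro h0
    have hz := rightHalf_im_pos h
    have h1 : HasDerivAt hauptmodul 0 z := h0 ▸ hasDerivAt_hauptmodul hz
    have h2 : HasDerivAt (fun w => hauptmodul (-w)) 0 (-z) := by
      have := HasDerivAt.comp (h₂ := hauptmodul) (-z) (by simpa using h1) (hasDerivAt_neg (-z))
      simpa using! this
    have h3 := h2.conj_conj
    have h4 : HasDerivAt hauptmodul 0 (-conj z) := by
      rw [map_neg, map_zero] at h3
      refine h3.congr_of_eventuallyEq ?_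
      filter_upwards [isOpen_upperHalf.mem_nhds (leftHalf_im_pos h)] with w hw
      simpa using hauptmodul_eq_conj hw
    have := deriv_hauptmodul_re_pos h
    rw [h4.deriv] at this
    exact lt_irrefl _ this
  · exact deriv_hauptmodul_ne_zero_of_mem_rightLine h
  · exact deriv_hauptmodul_ne_zero_of_mem_rightArc h
  · exact deriv_hauptmodul_ne_zero_of_mem_leftArc h
  · exact deriv_hauptmodul_ne_zero_of_mem_leftLine h

section Boundary

theorem rightLine_eq {z : ℂ} (hz : z ∈ rightLine) : ((0 : ℝ) + z.im * Complex.I : ℂ) = z := by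
  apply Complex.ext <;> simp [hz.1]

theorem leftLine_eq {z : ℂ} (hz : z ∈ leftLine) :
    ((-(1 / 2) : ℝ) + z.im * Complex.I : ℂ) = z := by
  apply Complex.ext <;> simp [hz.1]

theorem rightArc_eq {z : ℂ} (hz : z ∈ rightArc) : circleCurve 0 (1 / 5) z.re = z :=
  circleCurve_eq (by simpa using hz.1) hz.2.2.2

theorem leftArc_eq {z : ℂ} (hz : z ∈ leftArc) : circleCurve (-(1 / 2)) (1 / 20) z.re = z :=
  circleCurve_eq (by simpa using hz.1) hz.2.2.2

theorem circleCurve_corner :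
    circleCurve 0 (1 / 5) (-(2 / 5)) = circleCurve (-(1 / 2)) (1 / 20) (-(2 / 5)) := by
  rw [circleCurve, circleCurve]; norm_num

theorem lt_hauptmodul_of_mem_rightLine {z : ℂ} (hz : z ∈ rightLine) :
    (hauptmodul (circleCurve 0 (1 / 5) 0)).re < (hauptmodul z).re := by
  have h1 : √(1 / 5) < z.im := (Real.sqrt_lt' hz.2.2).mpr hz.2.1
  have := strictMonoOn_hauptmodul_rightLine (mem_Ici.mpr le_rfl) (mem_Ici.mpr h1.le) h1
  simp only [rightLine_eq hz] at this
  simpa [circleCurve] using this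

theorem hauptmodul_lt_of_mem_leftLine {z : ℂ} (hz : z ∈ leftLine) :
    (hauptmodul z).re < (hauptmodul (circleCurve (-(1 / 2)) (1 / 20) (-(1 / 2)))).re := by
  have h1 : √(1 / 20) < z.im := (Real.sqrt_lt' hz.2.2).mpr hz.2.1
  have := strictAntiOn_hauptmodul_leftLine (mem_Ici.mpr le_rfl) (mem_Ici.mpr h1.le) h1
  simp only [leftLine_eq hz] at this
  simpa [circleCurve] using this

theorem hauptmodul_mem_Ioo_of_mem_rightArc {z : ℂ} (hz : z ∈ rightArc) :
    (hauptmodul z).re ∈ Ioo (hauptmodul (circleCurve 0 (1 / 5) (-(2 / 5)))).re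
      (hauptmodul (circleCurve 0 (1 / 5) 0)).re := by
  have h0 := hz.2.1
  have h1 := hz.2.2.1
  have a := strictMonoOn_hauptmodul_rightArc ⟨le_rfl, by norm_num⟩ ⟨h0.le, h1.le⟩ h0
  have b := strictMonoOn_hauptmodul_rightArc ⟨h0.le, h1.le⟩ ⟨by norm_num, le_rfl⟩ h1
  simp only [rightArc_eq hz] at a b
  exact ⟨a, b⟩

theorem hauptmodul_mem_Ioo_of_mem_leftArc {z : ℂ} (hz : z ∈ leftArc) :
    (hauptmodul z).re ∈ Ioo (hauptmodul (circleCurve (-(1 / 2)) (1 / 20) (-(1 / 2)))).re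
      (hauptmodul (circleCurve 0 (1 / 5) (-(2 / 5)))).re := by
  have h0 := hz.2.1
  have h1 := hz.2.2.1
  have a := strictMonoOn_hauptmodul_leftArc ⟨le_rfl, by norm_num⟩ ⟨h0.le, h1.le⟩ h0
  have b := strictMonoOn_hauptmodul_leftArc ⟨h0.le, h1.le⟩ ⟨by norm_num, le_rfl⟩ h1
  simp only [leftArc_eq hz] at a b
  rw [circleCurve_corner]
  exact ⟨a, b⟩

/-- Going down the left line, along the two arcs and up the right line, the real number J increases
strictly; its values at the three elliptic points separate the four pieces. -/
theorem hauptmodul_injOn_regularBoundary : InjOn hauptmodul regularBoundary := by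
  have e12 : (hauptmodul (circleCurve 0 (1 / 5) (-(2 / 5)))).re <
      (hauptmodul (circleCurve 0 (1 / 5) 0)).re :=
    strictMonoOn_hauptmodul_rightArc ⟨le_rfl, by norm_num⟩ ⟨by norm_num, le_rfl⟩ (by norm_num)
  have e23 : (hauptmodul (circleCurve (-(1 / 2)) (1 / 20) (-(1 / 2)))).re <
      (hauptmodul (circleCurve 0 (1 / 5) (-(2 / 5)))).re := by
    rw [circleCurve_corner]
    exact strictMonoOn_hauptmodul_leftArc ⟨le_rfl, by norm_num⟩ ⟨by norm_num, le_rfl⟩ (by norm_num)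
  have d1 : ∀ z ∈ rightLine, ∀ w ∈ rightLine, (hauptmodul z).re = (hauptmodul w).re → z = w := by
    intro z hz w hw h
    rw [← rightLine_eq hz, ← rightLine_eq hw] at h ⊢
    rw [strictMonoOn_hauptmodul_rightLine.injOn (mem_Ici.mpr ((Real.sqrt_lt' hz.2.2).mpr hz.2.1).le)
      (mem_Ici.mpr ((Real.sqrt_lt' hw.2.2).mpr hw.2.1).le) h]
  have d2 : ∀ z ∈ rightArc, ∀ w ∈ rightArc, (hauptmodul z).re = (hauptmodul w).re → z = w := by
    intro z hz w hw h
    rw [← rightArc_eq hz, ← rightArc_eq hw] at h ⊢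
    rw [strictMonoOn_hauptmodul_rightArc.injOn ⟨hz.2.1.le, hz.2.2.1.le⟩ ⟨hw.2.1.le, hw.2.2.1.le⟩ h]
  have d3 : ∀ z ∈ leftArc, ∀ w ∈ leftArc, (hauptmodul z).re = (hauptmodul w).re → z = w := by
    intro z hz w hw h
    rw [← leftArc_eq hz, ← leftArc_eq hw] at h ⊢
    rw [strictMonoOn_hauptmodul_leftArc.injOn ⟨hz.2.1.le, hz.2.2.1.le⟩ ⟨hw.2.1.le, hw.2.2.1.le⟩ h]
  have d4 : ∀ z ∈ leftLine, ∀ w ∈ leftLine, (hauptmodul z).re = (hauptmodul w).re → z = w := by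
    intro z hz w hw h
    rw [← leftLine_eq hz, ← leftLine_eq hw] at h ⊢
    rw [strictAntiOn_hauptmodul_leftLine.injOn (mem_Ici.mpr ((Real.sqrt_lt' hz.2.2).mpr hz.2.1).le)
      (mem_Ici.mpr ((Real.sqrt_lt' hw.2.2).mpr hw.2.1).le) h]
  have r1 := @lt_hauptmodul_of_mem_rightLine
  have r2 := @hauptmodul_mem_Ioo_of_mem_rightArc
  have r3 := @hauptmodul_mem_Ioo_of_mem_leftArc
  have r4 := @hauptmodul_lt_of_mem_leftLine
  intro z hz w hw h
  have h := congrArg Complex.re h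
  rcases hz with ((hz | hz) | hz) | hz <;> rcases hw with ((hw | hw) | hw) | hw
  · exact d1 z hz w hw h
  · linarith [r1 hz, (r2 hw).2]
  · linarith [r1 hz, (r3 hw).2]
  · linarith [r1 hz, r4 hw]
  · linarith [r1 hw, (r2 hz).2]
  · exact d2 z hz w hw h
  · linarith [(r2 hz).1, (r3 hw).2]
  · linarith [(r2 hz).1, r4 hw]
  · linarith [r1 hw, (r3 hz).2]
  · linarith [(r2 hw).1, (r3 hz).2]
  · exact d3 z hz w hw h
  · linarith [(r3 hz).1, r4 hw]
  · linarith [r1 hw, r4 hz]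
  · linarith [(r2 hw).1, r4 hz]
  · linarith [(r3 hw).1, r4 hz]
  · exact d4 z hz w hw h

end Boundary

theorem hauptmodul_injOn_rightHalf : InjOn hauptmodul rightHalf := by
  intro z hz w hw h
  rw [hauptmodul_eq_conj (rightHalf_im_pos hz), hauptmodul_eq_conj (rightHalf_im_pos hw)] at h
  have := hauptmodul_injOn_leftHalf hz hw ((starRingEnd ℂ).injective h)
  exact (starRingEnd ℂ).injective (neg_injective this)

/-- The sign of `Im J` tells the two halves and the boundary apart. -/
theorem hauptmodul_injOn_regularSet : InjOn hauptmodul regularSet := by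
  intro z hz w hw h
  have him := congrArg Complex.im h
  have r1 := @hauptmodul_im_pos
  have r2 := @hauptmodul_im_neg
  have r3 := @hauptmodul_im_eq_zero
  rcases hz with (hz | hz) | hz <;> rcases hw with (hw | hw) | hw
  · exact hauptmodul_injOn_leftHalf hz hw h
  · linarith [r1 hz, r2 hw]
  · linarith [r1 hz, r3 hw]
  · linarith [r2 hz, r1 hw]
  · exact hauptmodul_injOn_rightHalf hz hw h
  · linarith [r2 hz, r3 hw]
  · linarith [r3 hz, r1 hw]
  · linarith [r3 hz, r2 hw]
  · exact hauptmodul_injOn_regularBoundary hz hw h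

/-! ### Polynomials in J and orders of vanishing -/

/-- An invariant function with a pole of order at most `n` at the cusp is a polynomial of degree at
most `n` in the Hauptmodul. -/
theorem IsFrickeInvariant.exists_polynomial (n : ℕ) : ∀ {h φ : ℂ → ℂ}, IsFrickeInvariant h →
    HasCuspExpansion h n φ → ∃ P : Polynomial ℂ, P.natDegree ≤ n ∧
      ∀ z : ℂ, 0 < z.im → h z = P.eval (hauptmodul z) := by
  induction n with
  | zero =>
    intro h φ hh hφ
    exact ⟨Polynomial.C (φ 0), by simp, fun z hz => by simpa using hh.eq_const hφ hz⟩
  | succ n ih =>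
    intro h φ hh hφ
    obtain ⟨τ, hτ, hτ1⟩ := exists_hauptmodul_expansion
    -- The leading coefficient must be real, so that subtracting the top power of J preserves the
    -- conjugation symmetry.
    have hreal : φ 0 = ((φ 0).re : ℂ) := by
      apply Complex.ext <;> simp [hφ.im_eq_zero hh]
    set a : ℝ := (φ 0).re
    have hh' : IsFrickeInvariant fun z => h z - a * hauptmodul z ^ (n + 1) :=
      hh.sub (hauptmodul_invariant.const_mul_pow a (n + 1))
    obtain ⟨ψ, hψ, heq⟩ := exists_eq_const_add_mul (φ := fun q => φ q - a * τ q ^ (n + 1))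
      (hφ.1.sub (analyticAt_const.mul (hτ.1.pow _)))
    have hexp : HasCuspExpansion (fun z => h z - a * hauptmodul z ^ (n + 1)) n ψ := by
      refine ⟨hψ, fun z hz => ?_⟩
      have hq : 𝕢 z ≠ 0 := Function.Periodic.qParam_ne_zero z
      have h1 := heq (𝕢 z)
      simp only [hτ1, one_pow, mul_one, hreal, sub_self, zero_add] at h1
      apply mul_left_cancel₀ hq
      rw [← h1, ← hφ.2 z hz, ← hτ.2 z hz]
      ring
    obtain ⟨P, hP, hPz⟩ := ih hh' hexp
    refine ⟨P + Polynomial.C (a : ℂ) * Polynomial.X ^ (n + 1), ?_, fun z hz => ?_⟩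
    · refine (Polynomial.natDegree_add_le _ _).trans (max_le (by omega) ?_)
      exact Polynomial.natDegree_C_mul_X_pow_le _ _
    · have := hPz z hz
      simp only [Polynomial.eval_add, Polynomial.eval_mul, Polynomial.eval_C, Polynomial.eval_pow,
        Polynomial.eval_X]
      rw [← this]
      ring

/-- J minus its value at `z` has a simple zero at a regular point, so J is a local coordinate there.
-/
theorem analyticOrderAt_polynomial_comp_hauptmodul {P : Polynomial ℂ} (hP : P ≠ 0) {z : ℂ}
    (hz : z ∈ regularSet) : analyticOrderAt (fun w => P.eval (hauptmodul w)) z =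
      P.rootMultiplicity (hauptmodul z) := by
  have him := regularSet_im_pos hz
  have hJ := hauptmodul_analyticAt him
  obtain ⟨R, hR, hRne⟩ := P.exists_eq_pow_rootMultiplicity_mul_and_not_dvd hP (hauptmodul z)
  rw [Polynomial.dvd_iff_isRoot] at hRne
  set m := P.rootMultiplicity (hauptmodul z)
  have hfun : (fun w => P.eval (hauptmodul w)) =
      (fun w => hauptmodul w - hauptmodul z) ^ m * fun w => R.eval (hauptmodul w) := by
    funext w
    conv_lhs => rw [hR]
    simp
  have hR' : AnalyticAt ℂ (fun w => R.eval (hauptmodul w)) z := by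
    have := hJ.aeval_polynomial R
    simpa using! this
  have hsub : AnalyticAt ℂ (fun w => hauptmodul w - hauptmodul z) z := hJ.sub analyticAt_const
  rw [hfun, analyticOrderAt_mul (hsub.pow m) hR', analyticOrderAt_pow hsub,
    hJ.analyticOrderAt_sub_eq_one_of_deriv_ne_zero (deriv_hauptmodul_ne_zero hz),
    hR'.analyticOrderAt_eq_zero.mpr hRne]
  simp

/-- Twice the orders of the zeros of `E*_{k,5}` in `regularSet` are the root multiplicities of a
polynomial of degree at most `k / 2` at the values of the Hauptmodul. -/
theorem exists_polynomial_rootMultiplicity {k : ℕ} (hk : 3 ≤ k) (hk2 : Even k) :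
    ∃ P : Polynomial ℂ, P ≠ 0 ∧ P.natDegree ≤ k / 2 ∧ ∀ z ∈ regularSet,
      2 * analyticOrderAt (frickeEisenstein 5 hk) z = P.rootMultiplicity (hauptmodul z) := by
  obtain ⟨φ, hφ, hφ1⟩ := exists_eisensteinQuot_expansion hk hk2
  obtain ⟨P, hP, hPz⟩ := (eisensteinQuot_invariant hk hk2).exists_polynomial (k / 2) hφ
  have hP0 : P ≠ 0 := by
    rintro rfl
    obtain ⟨Y, hY0, hY⟩ := exists_forall_norm_sub_le hφ.1.continuousAt one_pos
    have h1 := hY (Y * Complex.I) (by simp)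
    rw [← hφ.2 _ (by simpa using hY0), hPz _ (by simpa using hY0)] at h1
    simp [hφ1] at h1
  refine ⟨P, hP0, hP, fun z hz => ?_⟩
  have him := regularSet_im_pos hz
  rw [← analyticOrderAt_polynomial_comp_hauptmodul hP0 hz]
  have hF := frickeEisenstein_analyticAt (p := 5) (by norm_num) hk him
  have hD : AnalyticAt ℂ (fun w => etaProdFive w ^ (k / 2)) z :=
    (differentiableOn_etaProdFive.pow _).analyticAt (isOpen_upperHalf.mem_nhds him)
  have hPa : AnalyticAt ℂ (fun w => P.eval (hauptmodul w)) z := by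
    have := (hauptmodul_analyticAt him).aeval_polynomial P
    simpa using! this
  have heq : (frickeEisenstein 5 hk ^ 2) =ᶠ[𝓝 z]
      (fun w => etaProdFive w ^ (k / 2)) * fun w => P.eval (hauptmodul w) := by
    filter_upwards [isOpen_upperHalf.mem_nhds him] with w hw
    have h1 := hPz w hw
    rw [eisensteinQuot, div_eq_iff (pow_ne_zero _ (etaProdFive_ne_zero hw))] at h1
    rw [Pi.mul_apply, Pi.pow_apply, h1, mul_comm]
  have h2 := analyticOrderAt_congr heq
  rw [analyticOrderAt_pow hF, analyticOrderAt_mul hD hPa, hD.analyticOrderAt_eq_zero.mpr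
    (pow_ne_zero _ (etaProdFive_ne_zero him)), zero_add] at h2
  rw [← h2]
  simp

/-! ### Lattice sums and the estimate `|E_k - 1| < 1` -/

/-- The Eisenstein series differs from `1` by at most half the sum of any majorant of the terms with
`c ≠ 0`. -/
theorem norm_eisenstein_sub_one_le {k : ℕ} (hk : 3 ≤ k) (hk2 : Even k) (z : ℍ)
    {M : ℤ × ℤ → ℝ} {s : ℝ}
    (hM : HasSum M s) (hM0 : ∀ p, 0 ≤ M p)
    (hle : ∀ c d : ℤ, c ≠ 0 → (‖(c * z + d : ℂ)‖ ^ k)⁻¹ ≤ M (c, d)) :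
    ‖ModularForm.E hk z - 1‖ ≤ s / 2 := by
  classical
  set S := EisensteinSeries.gammaSet 1 1 0
  set G : (Fin 2 → ℤ) → ℂ := S.indicator (fun v => EisensteinSeries.eisSummand k v z)
  have hG : Summable G := (summable_eisSummand hk z).indicator S
  have hE : ModularForm.E hk z = (1 / 2 : ℂ) * ∑' v, G v := by
    have h1 : ModularForm.E hk z =
        (1 / 2 : ℂ) • EisensteinSeries.eisensteinSeriesSIF (N := 1) 0 k z := rfl
    rw [h1, EisensteinSeries.eisensteinSeriesSIF_apply, eisensteinSeries, smul_eq_mul]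
    congr 1
    exact tsum_subtype S (fun v => EisensteinSeries.eisSummand k v z)
  -- The coprime pairs with `c = 0` are `(0, ±1)`. For even `k` they contribute `2`, which the
  -- factor `1/2` turns into the constant term.
  set H : (Fin 2 → ℤ) → ℂ := fun v => if v 0 = 0 then G v else 0
  set G' : (Fin 2 → ℤ) → ℂ := fun v => if v 0 = 0 then 0 else G v
  have hGH : G = fun v => H v + G' v := by
    funext v; simp only [H, G']; split_ifs <;> simp
  have hT : ∀ v ∉ ({![0, 1], ![0, -1]} : Finset (Fin 2 → ℤ)), H v = 0 := by
    intro v hv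
    simp only [H, G]
    split_ifs with h0
    · rw [indicator_of_notMem]
      intro hS
      rw [EisensteinSeries.gammaSet_one_mem_iff, h0] at hS
      have h1 : (v 1).natAbs = 1 := by simpa using hS
      apply hv
      rw [Finset.mem_insert, Finset.mem_singleton]
      rcases Int.natAbs_eq_iff.mp h1 with h | h
      · left; funext i; fin_cases i <;> simp [h0, h]
      · right; funext i; fin_cases i <;> simp [h0, h]
    · rfl
  have hH : HasSum H 2 := by
    have h1 : HasSum H _ := hasSum_sum_of_ne_finset_zero hT
    have hne : (![0, 1] : Fin 2 → ℤ) ≠ ![0, -1] := by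
      intro h; have := congrFun h 1; simp at this
    rw [Finset.sum_pair hne] at h1
    have e1 : H ![0, 1] = 1 := by
      simp only [H, G]
      rw [if_pos (by simp), indicator_of_mem (by
        rw [EisensteinSeries.gammaSet_one_mem_iff]; simp)]
      simp [EisensteinSeries.eisSummand]
    have e2 : H ![0, -1] = 1 := by
      simp only [H, G]
      rw [if_pos (by simp), indicator_of_mem (by
        rw [EisensteinSeries.gammaSet_one_mem_iff]; simp)]
      simp [EisensteinSeries.eisSummand, hk2.neg_one_pow]
    rw [e1, e2] at h1
    norm_num at h1
    exact h1
  have hG' : HasSum G' (∑' v, G v - 2) := by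
    have := hG.hasSum.sub hH
    refine this.congr_fun ?_ |> fun h => h
    intro v
    rw [congrFun hGH v]; ring
  have hEq : ModularForm.E hk z - 1 = (1 / 2 : ℂ) * ∑' v, G' v := by
    rw [hE, hG'.tsum_eq]; ring
  have hM' : HasSum (fun v : Fin 2 → ℤ => M (v 0, v 1)) s := by
    exact (finTwoArrowEquiv ℤ).hasSum_iff.mpr hM
  have hb : ‖∑' v, G' v‖ ≤ s := by
    refine tsum_of_norm_bounded hM' fun v => ?_
    simp only [G', G]
    split_ifs with h0
    · simpa using hM0 _
    · by_cases hS : v ∈ S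
      · rw [indicator_of_mem hS, EisensteinSeries.eisSummand, zpow_neg, norm_inv, zpow_natCast,
          norm_pow]
        exact hle _ _ h0
      · rw [indicator_of_notMem hS]
        simpa using hM0 _
  rw [hEq, norm_mul]
  norm_num
  linarith

theorem summable_one_div_one_add_sq : Summable fun n : ℕ => 1 / (1 + (n : ℝ) ^ 2) := by
  refine Summable.of_norm_bounded_eventually_nat (g := fun n : ℕ => 1 / (n : ℝ) ^ 2)
    (Real.summable_one_div_nat_pow.mpr one_lt_two) ?_
  filter_upwards [eventually_gt_atTop 0] with n hn
  have : (0 : ℝ) < n := by exact_mod_cast hn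
  rw [Real.norm_of_nonneg (by positivity)]
  exact one_div_le_one_div_of_le (by positivity) (by linarith)

theorem pi_sq_lt_ten : Real.pi ^ 2 < 10 := by
  have := Real.pi_lt_d2
  nlinarith [Real.pi_pos]

/-- The term at `0` is `1`, and the rest is at most `π²/6 < 5/3`. -/
theorem tsum_one_div_one_add_sq_le : ∑' n : ℕ, 1 / (1 + (n : ℝ) ^ 2) ≤ 8 / 3 := by
  have h1 := summable_one_div_one_add_sq
  have h2 := hasSum_zeta_two
  have h3 : ∑' n : ℕ, 1 / (1 + ((n + 1 : ℕ) : ℝ) ^ 2) ≤ ∑' n : ℕ, 1 / ((n + 1 : ℕ) : ℝ) ^ 2 := by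
    refine Summable.tsum_le_tsum (fun n => ?_) ((summable_nat_add_iff 1).mpr h1)
      ((summable_nat_add_iff 1).mpr h2.summable)
    exact one_div_le_one_div_of_le (by positivity) (by linarith)
  rw [h1.tsum_eq_zero_add]
  have h4 := h2.summable.tsum_eq_zero_add
  rw [h2.tsum_eq] at h4
  simp only [Nat.cast_zero, ne_eq, OfNat.ofNat_ne_zero, not_false_eq_true, zero_pow, div_zero,
    zero_add, add_zero, div_one] at h4 ⊢
  rw [← h4] at h3
  linarith [pi_sq_lt_ten]

/-- For `d = n` and for `d = -(n + 1)` alike, `|d + t| ≥ n`, so each half is bounded by the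
unshifted sum. -/
theorem shifted_sum_bound_of_mem_Ico {t : ℝ} (h0 : 0 ≤ t) (h1 : t < 1) :
    Summable (fun d : ℤ => 1 / (1 + ((d : ℝ) + t) ^ 2)) ∧
      ∑' d : ℤ, 1 / (1 + ((d : ℝ) + t) ^ 2) ≤ 16 / 3 := by
  have hs := summable_one_div_one_add_sq
  have b1 : ∀ n : ℕ, 1 / (1 + (((n : ℤ) : ℝ) + t) ^ 2) ≤ 1 / (1 + (n : ℝ) ^ 2) := by
    intro n
    have : (0 : ℝ) ≤ n := n.cast_nonneg
    refine one_div_le_one_div_of_le (by positivity) ?_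
    push_cast
    nlinarith
  have b2 : ∀ n : ℕ, 1 / (1 + (((-(n + 1) : ℤ) : ℝ) + t) ^ 2) ≤ 1 / (1 + (n : ℝ) ^ 2) := by
    intro n
    have : (0 : ℝ) ≤ n := n.cast_nonneg
    refine one_div_le_one_div_of_le (by positivity) ?_
    push_cast
    nlinarith
  have s1 : Summable fun n : ℕ => 1 / (1 + (((n : ℤ) : ℝ) + t) ^ 2) :=
    Summable.of_nonneg_of_le (fun n => by positivity) b1 hs
  have s2 : Summable fun n : ℕ => 1 / (1 + (((-(n + 1) : ℤ) : ℝ) + t) ^ 2) :=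
    Summable.of_nonneg_of_le (fun n => by positivity) b2 hs
  have hsum := HasSum.of_nat_of_neg_add_one (f := fun d : ℤ => 1 / (1 + ((d : ℝ) + t) ^ 2))
    s1.hasSum s2.hasSum
  refine ⟨hsum.summable, ?_⟩
  rw [hsum.tsum_eq]
  have c1 := s1.tsum_le_tsum b1 hs
  have c2 := s2.tsum_le_tsum b2 hs
  linarith [tsum_one_div_one_add_sq_le]

theorem shifted_sum_bound (t : ℝ) : Summable (fun d : ℤ => 1 / (1 + ((d : ℝ) + t) ^ 2)) ∧
    ∑' d : ℤ, 1 / (1 + ((d : ℝ) + t) ^ 2) ≤ 16 / 3 := by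
  have h := shifted_sum_bound_of_mem_Ico (Int.fract_nonneg t) (Int.fract_lt_one t)
  have heq : (fun d : ℤ => 1 / (1 + ((d : ℝ) + t) ^ 2)) =
      (fun d : ℤ => 1 / (1 + ((d : ℝ) + Int.fract t) ^ 2)) ∘ Equiv.addRight ⌊t⌋ := by
    funext d
    simp only [Function.comp_apply, Equiv.coe_addRight, Int.cast_add]
    rw [add_assoc, Int.floor_add_fract]
  rw [heq]
  refine ⟨(Equiv.summable_iff _).mpr h.1, ?_⟩
  have := (Equiv.addRight ⌊t⌋).tsum_eq (fun d : ℤ => 1 / (1 + ((d : ℝ) + Int.fract t) ^ 2))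
  exact this.trans_le h.2

/-- The sum is `2ζ(2) = π²/3`; the term `c = 0` is `1 / 0 = 0` and adds nothing. -/
theorem int_one_div_sq_bound : Summable (fun c : ℤ => 1 / (c : ℝ) ^ 2) ∧
    ∑' c : ℤ, 1 / (c : ℝ) ^ 2 ≤ 10 / 3 := by
  have h2 := hasSum_zeta_two
  have s2 : HasSum (fun n : ℕ => 1 / ((-(n + 1) : ℤ) : ℝ) ^ 2) (Real.pi ^ 2 / 6) := by
    have h4 := (hasSum_nat_add_iff' 1).mpr h2
    simp only [Finset.range_one, Finset.sum_singleton, Nat.cast_zero, ne_eq, OfNat.ofNat_ne_zero,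
      not_false_eq_true, zero_pow, div_zero, sub_zero] at h4
    refine h4.congr_fun fun n => ?_
    push_cast
    rw [neg_sq]
  have hsum := HasSum.of_nat_of_neg_add_one (f := fun d : ℤ => 1 / (d : ℝ) ^ 2)
    (by simpa using h2) s2
  refine ⟨hsum.summable, ?_⟩
  rw [hsum.tsum_eq]
  linarith [pi_sq_lt_ten]

theorem prod_sum_bound {f : ℤ × ℤ → ℝ} (hf : 0 ≤ f) {g : ℤ → ℝ} (hg : Summable g)
    (h : ∀ c, Summable (fun d => f (c, d)) ∧ ∑' d, f (c, d) ≤ g c) :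
    Summable f ∧ ∑' p, f p ≤ ∑' c, g c := by
  have hs : Summable fun c : ℤ => ∑' d : ℤ, f (c, d) :=
    Summable.of_nonneg_of_le (fun c => tsum_nonneg fun d => hf (c, d)) (fun c => (h c).2) hg
  have hsum : Summable f := (summable_prod_of_nonneg hf).mpr ⟨fun c => (h c).1, hs⟩
  refine ⟨hsum, ?_⟩
  rw [hsum.tsum_prod]
  exact hs.tsum_le_tsum (fun c => (h c).2) hg

theorem lattice_sum_bound (x : ℝ) :
    Summable (fun p : ℤ × ℤ => 1 / (p.1 : ℝ) ^ 2 * (1 / (1 + ((p.2 : ℝ) + p.1 * x) ^ 2))) ∧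
      ∑' p : ℤ × ℤ, 1 / (p.1 : ℝ) ^ 2 * (1 / (1 + ((p.2 : ℝ) + p.1 * x) ^ 2)) ≤ 160 / 9 := by
  obtain ⟨hc, hcb⟩ := int_one_div_sq_bound
  have h1 : ∀ c : ℤ, Summable (fun d : ℤ => 1 / (c : ℝ) ^ 2 * (1 / (1 + ((d : ℝ) + c * x) ^ 2))) :=
    fun c => (shifted_sum_bound (c * x)).1.mul_left (1 / (c : ℝ) ^ 2)
  have h2 : ∀ c : ℤ, ∑' d : ℤ, 1 / (c : ℝ) ^ 2 * (1 / (1 + ((d : ℝ) + c * x) ^ 2)) ≤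
      1 / (c : ℝ) ^ 2 * (16 / 3) := by
    intro c
    rw [tsum_mul_left]
    exact mul_le_mul_of_nonneg_left (shifted_sum_bound _).2 (by positivity)
  have h0 : ∀ p : ℤ × ℤ, 0 ≤ 1 / (p.1 : ℝ) ^ 2 * (1 / (1 + ((p.2 : ℝ) + p.1 * x) ^ 2)) := by
    intro p
    positivity
  have h := prod_sum_bound h0 (hc.mul_right (16 / 3)) fun c => ⟨h1 c, h2 c⟩
  refine ⟨h.1, h.2.trans ?_⟩
  rw [tsum_mul_right]
  linarith

/-- A majorant of the terms `(cw+d)^{-k}`, `12 ≤ k`, with exceptional values at `±(1, 1)`, `±(1, 2)`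
and `±(1, 3)`. -/
def latticeMajorant (x : ℝ) (p : ℤ × ℤ) : ℝ :=
  (2 / 7) ^ 4 * (1 / (p.1 : ℝ) ^ 2 * (1 / (1 + ((p.2 : ℝ) + p.1 * x) ^ 2))) +
    ((((if p = (1, 1) then 1 / 64 else 0) + if p = (-1, -1) then 1 / 64 else 0) +
      ((if p = (1, 2) then 2 / 3 else 0) + if p = (-1, -2) then 2 / 3 else 0)) +
      ((if p = (1, 3) then 64 / 729 else 0) + if p = (-1, -3) then 64 / 729 else 0))

theorem latticeMajorant_exceptional_nonneg (p : ℤ × ℤ) :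
    (0 : ℝ) ≤ ((((if p = (1, 1) then 1 / 64 else 0) + if p = (-1, -1) then 1 / 64 else 0) +
      ((if p = (1, 2) then 2 / 3 else 0) + if p = (-1, -2) then 2 / 3 else 0)) +
      ((if p = (1, 3) then 64 / 729 else 0) + if p = (-1, -3) then 64 / 729 else 0)) := by
  refine add_nonneg (add_nonneg (add_nonneg ?_ ?_) (add_nonneg ?_ ?_)) (add_nonneg ?_ ?_) <;>
    split_ifs <;> norm_num

theorem latticeMajorant_base_nonneg (x : ℝ) (p : ℤ × ℤ) :
    0 ≤ (2 / 7 : ℝ) ^ 4 * (1 / (p.1 : ℝ) ^ 2 * (1 / (1 + ((p.2 : ℝ) + p.1 * x) ^ 2))) := by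
  positivity

theorem latticeMajorant_nonneg (x : ℝ) (p : ℤ × ℤ) : 0 ≤ latticeMajorant x p :=
  add_nonneg (latticeMajorant_base_nonneg x p) (latticeMajorant_exceptional_nonneg p)

/-- Numerically `(2/7)^4 · 160/9 + 2 (1/64 + 2/3 + 64/729)` is below `1.7`. The threshold is `2`
because the Eisenstein series carries a factor `1/2`. -/
theorem hasSum_latticeMajorant (x : ℝ) : ∃ s, HasSum (latticeMajorant x) s ∧ s < 2 := by
  obtain ⟨h1, h2⟩ := lattice_sum_bound x
  refine ⟨_, (h1.hasSum.mul_left _).add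
    ((((hasSum_ite_eq (1, 1) (1 / 64)).add (hasSum_ite_eq (-1, -1) (1 / 64))).add
      ((hasSum_ite_eq (1, 2) (2 / 3)).add (hasSum_ite_eq (-1, -2) (2 / 3)))).add
      ((hasSum_ite_eq (1, 3) (64 / 729)).add (hasSum_ite_eq (-1, -3) (64 / 729)))), ?_⟩
  linarith

theorem le_latticeMajorant_of_exceptional {x : ℝ} {p : ℤ × ℤ} {a : ℝ}
    (h : a ≤ ((((if p = (1, 1) then 1 / 64 else 0) + if p = (-1, -1) then 1 / 64 else 0) +
      ((if p = (1, 2) then 2 / 3 else 0) + if p = (-1, -2) then 2 / 3 else 0)) +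
      ((if p = (1, 3) then 64 / 729 else 0) + if p = (-1, -3) then 64 / 729 else 0))) :
    a ≤ latticeMajorant x p := by
  have := latticeMajorant_base_nonneg x p
  rw [latticeMajorant]
  linarith

theorem norm_sq_int_mul_add (c d : ℤ) (w : ℂ) :
    ‖(c * w + d : ℂ)‖ ^ 2 = (d + c * w.re) ^ 2 + c ^ 2 * w.im ^ 2 := by
  rw [← Complex.normSq_eq_norm_sq, Complex.normSq_apply]
  simp
  ring

theorem inv_pow_le_of_le {N a : ℝ} {j : ℕ} (hj : 6 ≤ j) (ha : 1 ≤ a) (h : a ≤ N) :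
    (N ^ j)⁻¹ ≤ (a ^ 6)⁻¹ := by
  refine inv_anti₀ (by positivity) ?_
  calc a ^ 6 ≤ a ^ j := pow_le_pow_right₀ ha hj
    _ ≤ N ^ j := pow_le_pow_left₀ (by linarith) h _

/-- The label below applies to the sixth power of the norm squared. -/
theorem inv_pow_le_base {X Y : ℝ} {c : ℤ} (hc : c ≠ 0) (hY : 1 ≤ Y) {j : ℕ} (hj : 6 ≤ j)
    (hN : 7 / 2 ≤ X ^ 2 + c ^ 2 * Y ^ 2) :
    ((X ^ 2 + c ^ 2 * Y ^ 2) ^ j)⁻¹ ≤ (2 / 7) ^ 4 * (1 / (c : ℝ) ^ 2 * (1 / (1 + X ^ 2))) := by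
  have hc1 : (1 : ℝ) ≤ (c : ℝ) ^ 2 := by
    have : (1 : ℤ) ≤ c ^ 2 := by have := sq_pos_iff.mpr hc; linarith
    exact_mod_cast this
  have hY2 : 1 ≤ Y ^ 2 := one_le_pow₀ hY
  set N := X ^ 2 + c ^ 2 * Y ^ 2 with hNdef
  have hN1 : (c : ℝ) ^ 2 ≤ N := by nlinarith [sq_nonneg X]
  have hN2 : 1 + X ^ 2 ≤ N := by nlinarith
  have h1 : (7 / 2) ^ 4 * ((c : ℝ) ^ 2 * (1 + X ^ 2)) ≤ N ^ j := by
    calc (7 / 2) ^ 4 * ((c : ℝ) ^ 2 * (1 + X ^ 2)) ≤ N ^ 4 * (N * N) := by gcongr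
      _ = N ^ 6 := by ring
      _ ≤ N ^ j := pow_le_pow_right₀ (by linarith) hj
  calc (N ^ j)⁻¹ ≤ ((7 / 2) ^ 4 * ((c : ℝ) ^ 2 * (1 + X ^ 2)))⁻¹ := inv_anti₀ (by positivity) h1
    _ = _ := by rw [mul_inv, mul_inv]; norm_num

/-- The points `w` for which all terms of the Eisenstein series other than the constant one are
dominated by `latticeMajorant`. -/
structure EstimateRegion (k : ℕ) (w : ℂ) : Prop where
  im : 1 ≤ w.im
  re_le : w.re ≤ 0
  le_re : -(5 / 2) ≤ w.re
  zero : 5 ≤ w.re ^ 2 + w.im ^ 2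
  one : 2 ≤ (w.re + 1) ^ 2 + w.im ^ 2
  two : 1 + 1 / (k : ℝ) ≤ (w.re + 2) ^ 2 + w.im ^ 2
  three : 3 / 2 ≤ (w.re + 3) ^ 2 + w.im ^ 2
  four : 7 / 2 ≤ (w.re + 4) ^ 2 + w.im ^ 2

/-- At the corner `w = -2 + i` the terms `±(1, 2)` have modulus `1` for every `k`. By Bernoulli's
inequality the margin `1/k` in the field `two` brings them down to `2/3` uniformly in `k`. -/
theorem three_halves_le_one_add_inv_pow {j : ℕ} (hj : 1 ≤ j) :
    (3 / 2 : ℝ) ≤ (1 + 1 / ((2 * j : ℕ) : ℝ)) ^ j := by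
  have hj' : (1 : ℝ) ≤ j := by exact_mod_cast hj
  have h := one_add_mul_le_pow (a := 1 / ((2 * j : ℕ) : ℝ))
    (by have : (0 : ℝ) ≤ 1 / ((2 * j : ℕ) : ℝ) := by positivity
        linarith) j
  refine le_trans (le_of_eq ?_) h
  push_cast
  field_simp
  norm_num

/-- If `|c| ≥ 2`, then `c² (Im w)² ≥ 4`. If `c = ±1`, the term is governed by `|w + e|` with `e =
±d`, and `-5/2 ≤ Re w ≤ 0` together with the fields `zero` and `four` leaves only `e = 1, 2, 3` as
exceptions. -/
theorem EstimateRegion.term_le {j : ℕ} (hj : 6 ≤ j) {w : ℂ} (h : EstimateRegion (2 * j) w)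
    (c d : ℤ) (hc : c ≠ 0) :
    (‖(c * w + d : ℂ)‖ ^ (2 * j))⁻¹ ≤ latticeMajorant w.re (c, d) := by
  rw [pow_mul, norm_sq_int_mul_add]
  have base : 7 / 2 ≤ (d + c * w.re) ^ 2 + c ^ 2 * w.im ^ 2 →
      (((d + c * w.re) ^ 2 + c ^ 2 * w.im ^ 2) ^ j)⁻¹ ≤ latticeMajorant w.re (c, d) := by
    intro hN
    have h1 := inv_pow_le_base (X := d + c * w.re) hc h.im hj hN
    have h2 := latticeMajorant_exceptional_nonneg (c, d)
    rw [latticeMajorant]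
    linarith
  have him2 : 1 ≤ w.im ^ 2 := one_le_pow₀ h.im
  by_cases hc1 : c = 1 ∨ c = -1
  · obtain ⟨e, hce, hde⟩ : ∃ e : ℤ, (d + c * w.re) ^ 2 + c ^ 2 * w.im ^ 2 =
        (w.re + e) ^ 2 + w.im ^ 2 ∧ ((c = 1 ∧ d = e) ∨ (c = -1 ∧ d = -e)) := by
      rcases hc1 with rfl | rfl
      · exact ⟨d, by push_cast; ring, by simp⟩
      · exact ⟨-d, by push_cast; ring, by simp⟩
    rw [hce] at base ⊢
    by_cases e0 : e ≤ 0
    · apply base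
      have e0' : (e : ℝ) ≤ 0 := by exact_mod_cast e0
      nlinarith [h.zero, h.re_le, sq_nonneg (e : ℝ), mul_nonneg_of_nonpos_of_nonpos h.re_le e0']
    by_cases e5 : 5 ≤ e
    · apply base
      have e5' : (5 : ℝ) ≤ e := by exact_mod_cast e5
      nlinarith [h.le_re]
    have he : e = 1 ∨ e = 2 ∨ e = 3 ∨ e = 4 := by omega
    rcases he with rfl | rfl | rfl | rfl
    · apply le_latticeMajorant_of_exceptional
      refine (inv_pow_le_of_le hj one_le_two (by exact_mod_cast h.one)).trans ?_
      rcases hde with ⟨rfl, rfl⟩ | ⟨rfl, rfl⟩ <;> norm_num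
    · apply le_latticeMajorant_of_exceptional
      have h3 : (3 / 2 : ℝ) ≤ ((w.re + (2 : ℤ)) ^ 2 + w.im ^ 2) ^ j := by
        have h4 := three_halves_le_one_add_inv_pow (j := j) (by omega)
        refine h4.trans (pow_le_pow_left₀ (by positivity) ?_ _)
        exact_mod_cast h.two
      refine (inv_anti₀ (by norm_num) h3).trans ?_
      rcases hde with ⟨rfl, rfl⟩ | ⟨rfl, rfl⟩ <;> norm_num
    · apply le_latticeMajorant_of_exceptional
      refine (inv_pow_le_of_le (a := 3 / 2) hj (by norm_num) (by exact_mod_cast h.three)).trans ?_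
      rcases hde with ⟨rfl, rfl⟩ | ⟨rfl, rfl⟩ <;> norm_num
    · exact base (by exact_mod_cast h.four)
  · apply base
    have hc4 : (4 : ℝ) ≤ (c : ℝ) ^ 2 := by
      have : (4 : ℤ) ≤ c ^ 2 := by
        have : 2 ≤ c ∨ c ≤ -2 := by omega
        rcases this with h | h <;> nlinarith
      exact_mod_cast this
    nlinarith [sq_nonneg (d + c * w.re)]

theorem EstimateRegion.norm_sub_one_lt {k : ℕ} (hk : 3 ≤ k) (hk2 : Even k) (hk12 : 12 ≤ k) {w : ℂ}
    (h : EstimateRegion k w) : ‖eisensteinC hk w - 1‖ < 1 := by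
  obtain ⟨j, rfl⟩ := hk2.two_dvd
  have hw : 0 < w.im := by linarith [h.im]
  obtain ⟨s, hs, hs2⟩ := hasSum_latticeMajorant w.re
  rw [eisensteinC_apply hk hw]
  have := norm_eisenstein_sub_one_le hk hk2 ⟨w, hw⟩ hs (latticeMajorant_nonneg _)
    (fun c d hc => h.term_le (by omega) c d hc)
  linarith

/-! ### Zeros on the arcs from sign changes -/

/-- A continuous function whose signs alternate along a sequence has a zero in each gap. -/
theorem exists_zeros_of_alternating {G : ℝ → ℝ} {A B : ℝ} (hG : ContinuousOn G (Icc A B))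
    {x : ℤ → ℝ} (hx : StrictMono x) {p q : ℤ}
    (h : ∀ m ∈ Icc p q, x m ∈ Icc A B ∧ 0 < (-1 : ℝ) ^ m * G (x m)) :
    ∃ Z : Finset ℝ, q - p ≤ Z.card ∧ ∀ y ∈ Z, y ∈ Ioo A B ∧ G y = 0 := by
  classical
  have hz : ∀ m : ℤ, m ∈ Ico p q → ∃ y ∈ Ioo (x m) (x (m + 1)), G y = 0 := by
    rintro m ⟨h1, h2⟩
    obtain ⟨⟨a1, a2⟩, a3⟩ := h m ⟨h1, h2.le⟩
    obtain ⟨⟨b1, b2⟩, b3⟩ := h (m + 1) ⟨by omega, by omega⟩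
    rw [zpow_add_one₀ (by norm_num)] at b3
    have hcont : ContinuousOn (fun y => (-1 : ℝ) ^ m * G y) (Icc (x m) (x (m + 1))) :=
      continuousOn_const.mul (hG.mono (Icc_subset_Icc a1 b2))
    obtain ⟨y, hy, hy0⟩ := intermediate_value_Ioo' (hx.monotone (by omega)) hcont
      (show (0 : ℝ) ∈ _ from ⟨by linarith, a3⟩)
    exact ⟨y, hy, (mul_eq_zero.mp hy0).resolve_left (zpow_ne_zero _ (by norm_num))⟩
  choose! y hy hy0 using hz
  refine ⟨(Finset.Ico p q).image y, ?_, ?_⟩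
  · rw [Finset.card_image_of_injOn, Int.card_Ico]
    · omega
    · have key : ∀ m ∈ Ico p q, ∀ n ∈ Ico p q, m < n → y m < y n := fun m hm n hn hmn =>
        (hy m hm).2.trans_le ((hx.monotone (by omega)).trans (hy n hn).1.le)
      intro m hm n hn hmn
      rw [Finset.coe_Ico] at hm hn
      rcases lt_trichotomy m n with hlt | heq | hgt
      · exact absurd hmn (key m hm n hn hlt).ne
      · exact heq
      · exact absurd hmn (key n hn m hm hgt).ne'
  · intro t ht
    obtain ⟨m, hm, rfl⟩ := Finset.mem_image.mp ht
    rw [Finset.mem_Ico] at hm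
    refine ⟨⟨((h m ⟨hm.1, hm.2.le⟩).1.1).trans_lt (hy m hm).1,
      (hy m hm).2.trans_le (h (m + 1) ⟨by omega, by omega⟩).1.2⟩, hy0 m hm⟩

/-- The point with angle `θ` on the circle with real centre `c` and radius `r`. -/
def arcPoint (c r θ : ℝ) : ℂ := c + r * cexp (θ * Complex.I)

theorem arcPoint_re (c r θ : ℝ) : (arcPoint c r θ).re = c + r * Real.cos θ := by
  simp [arcPoint, Complex.exp_ofReal_mul_I_re]

theorem arcPoint_im (c r θ : ℝ) : (arcPoint c r θ).im = r * Real.sin θ := by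
  simp [arcPoint, Complex.exp_ofReal_mul_I_im]

theorem continuous_arcPoint (c r : ℝ) : Continuous (arcPoint c r) := by
  unfold arcPoint
  fun_prop

theorem arcPoint_injOn (c : ℝ) {r : ℝ} (hr : 0 < r) : InjOn (arcPoint c r) (Icc 0 Real.pi) := by
  intro a ha b hb h
  have := congrArg Complex.re h
  rw [arcPoint_re, arcPoint_re] at this
  exact Real.injOn_cos ha hb (mul_left_cancel₀ hr.ne' (add_left_cancel this))

/-- With `u = e^{ijθ}` and `E = E_k(5z)`, the hypothesis reads `E_k(z) = 5^j (conj u)² conj E`, so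
`5^j E + E_k(z) = 5^j (conj u) · 2 Re(u E)`. -/
theorem frickeEisenstein_eq_zero_of_re {j : ℕ} (hk : 3 ≤ 2 * j) {z : ℂ} {θ : ℝ}
    (hconj : conj (eisensteinC hk z) =
      ((√5 : ℝ) * cexp (θ * Complex.I)) ^ (2 * j) * eisensteinC hk (5 * z))
    (h : (cexp (j * θ * Complex.I) * eisensteinC hk (5 * z)).re = 0) :
    frickeEisenstein 5 hk z = 0 := by
  set u := cexp (j * θ * Complex.I) with hu
  set E := eisensteinC hk (5 * z)
  have h5 : ((√5 : ℝ) : ℂ) ^ 2 = 5 := by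
    rw [← ofReal_pow, Real.sq_sqrt (by norm_num)]
    norm_num
  have hpow : ((√5 : ℝ) * cexp (θ * Complex.I)) ^ (2 * j) = 5 ^ j * (u * u) := by
    rw [pow_mul, mul_pow, h5, mul_pow, sq, hu, ← Complex.exp_add, ← Complex.exp_add,
      ← Complex.exp_nat_mul]
    congr 2
    ring
  have hu1 : conj u * u = 1 := by
    rw [hu, ← Complex.exp_conj, ← Complex.exp_add]
    simp
  have hz : eisensteinC hk z = 5 ^ j * (conj u * conj u * conj E) := by
    have h1 := congrArg conj hconj
    rw [Complex.conj_conj, hpow, map_mul, map_mul, map_mul, map_pow, map_ofNat] at h1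
    rw [h1]
    ring
  have hre : u * E + conj (u * E) = 0 := by
    rw [Complex.add_conj, h]
    simp
  rw [frickeEisenstein_five, hz, show 2 * j / 2 = j by omega]
  have : (5 : ℂ) ^ j * E + 5 ^ j * (conj u * conj u * conj E) =
      5 ^ j * conj u * (u * E + conj (u * E)) := by
    rw [map_mul]
    linear_combination (-(5 : ℂ) ^ j * E) * hu1
  rw [this, hre, mul_zero, zero_div]

/-- At `θ = πm/j` the exponential equals `(-1)^m`, while `|E_k - 1| < 1` gives `E_k` positive real
part; hence the signs alternate. -/
theorem exists_zeros_on_arc {j : ℕ} (hk : 3 ≤ 2 * j) (hj : 6 ≤ j) {c r A B : ℝ} (hr : 0 < r)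
    (hA : 0 < A) (hB : B < Real.pi)
    (hconj : ∀ θ ∈ Ioo A B, conj (eisensteinC hk (arcPoint c r θ)) =
      ((√5 : ℝ) * cexp (θ * Complex.I)) ^ (2 * j) * eisensteinC hk (5 * arcPoint c r θ))
    {p q : ℤ} (hreg : ∀ m ∈ Icc p q, Real.pi * m / j ∈ Icc A B ∧
      EstimateRegion (2 * j) (5 * arcPoint c r (Real.pi * m / j))) :
    ∃ Z : Finset ℂ, q - p ≤ Z.card ∧
      ∀ z ∈ Z, frickeEisenstein 5 hk z = 0 ∧ ∃ θ ∈ Ioo A B, z = arcPoint c r θ := by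
  classical
  have hj0 : (0 : ℝ) < j := by exact_mod_cast (by omega : 0 < j)
  set G : ℝ → ℝ := fun θ => (cexp (j * θ * Complex.I) * eisensteinC hk (5 * arcPoint c r θ)).re
  have hG : ContinuousOn G (Icc A B) := by
    refine Complex.continuous_re.comp_continuousOn (ContinuousOn.mul (by fun_prop) ?_)
    refine (differentiableOn_eisensteinC hk).continuousOn.comp
      (continuous_const.mul (continuous_arcPoint c r)).continuousOn ?_
    intro θ hθ
    refine five_mul_im_pos ?_
    rw [arcPoint_im]
    exact mul_pos hr (Real.sin_pos_of_pos_of_lt_pi (hA.trans_le hθ.1) (hθ.2.trans_lt hB))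
  have hx : StrictMono fun m : ℤ => Real.pi * m / j := by
    intro m n hmn
    have : (m : ℝ) < n := by exact_mod_cast hmn
    have := Real.pi_pos
    simp only
    gcongr
  obtain ⟨Z, hZ, hZ0⟩ := exists_zeros_of_alternating hG hx (p := p) (q := q) fun m hm => by
    obtain ⟨h1, h2⟩ := hreg m hm
    refine ⟨h1, ?_⟩
    have hlt := h2.norm_sub_one_lt hk (even_two_mul j) (by omega)
    have hre : 0 < (eisensteinC hk (5 * arcPoint c r (Real.pi * m / j))).re := by
      have := (abs_lt.mp ((Complex.abs_re_le_norm _).trans_lt hlt)).1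
      rw [Complex.sub_re, Complex.one_re] at this
      linarith
    have he : cexp (j * (Real.pi * m / j : ℝ) * Complex.I) = (((-1 : ℝ) ^ m : ℝ) : ℂ) := by
      have : (j * (Real.pi * m / j : ℝ) * Complex.I : ℂ) = ((m * Real.pi : ℝ) : ℂ) * Complex.I := by
        rw [← ofReal_natCast, ← ofReal_mul]
        congr 2
        field_simp
      rw [this, Complex.exp_mul_I, ← ofReal_cos, ← ofReal_sin, Real.cos_int_mul_pi,
        Real.sin_int_mul_pi]
      simp
    simp only [G]
    rw [he, Complex.re_ofReal_mul, ← mul_assoc, ← mul_zpow]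
    norm_num
    exact hre
  refine ⟨Z.image (arcPoint c r), ?_, ?_⟩
  · rwa [Finset.card_image_of_injOn]
    intro a ha b hb
    have ha := (hZ0 a ha).1
    have hb := (hZ0 b hb).1
    exact arcPoint_injOn c hr ⟨(hA.trans ha.1).le, (ha.2.trans hB).le⟩
      ⟨(hA.trans hb.1).le, (hb.2.trans hB).le⟩
  · intro z hz
    obtain ⟨θ, hθ, rfl⟩ := Finset.mem_image.mp hz
    obtain ⟨h1, h2⟩ := hZ0 θ hθ
    exact ⟨frickeEisenstein_eq_zero_of_re hk (hconj θ h1) h2, θ, h1, rfl⟩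

/-- On this circle `|w + 2|² = 1 + 4 (Re w + 2)`, so the last hypothesis is the condition at the
critical term. -/
theorem estimateRegion_of_rightArc {k : ℕ} {w : ℂ} (h : w.re ^ 2 + w.im ^ 2 = 5) (him : 0 < w.im)
    (hre : w.re ≤ 0) (hre2 : 1 / (k : ℝ) ≤ 4 * (w.re + 2)) : EstimateRegion k w := by
  have hk : (0 : ℝ) ≤ 1 / (k : ℝ) := by positivity
  exact ⟨by nlinarith, hre, by linarith, by linarith, by nlinarith, by nlinarith, by nlinarith,
    by nlinarith⟩

/-- On this circle `|w + 2|² = 1 - (Re w + 2)`. -/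
theorem estimateRegion_of_leftArc {k : ℕ} {w : ℂ} (h : (w.re + 5 / 2) ^ 2 + w.im ^ 2 = 5 / 4)
    (him : 0 < w.im) (hre : -(5 / 2) ≤ w.re) (hre2 : 1 / (k : ℝ) ≤ -(w.re + 2)) :
    EstimateRegion k w := by
  have hk : (0 : ℝ) ≤ 1 / (k : ℝ) := by positivity
  exact ⟨by nlinarith, by linarith, hre, by nlinarith, by nlinarith, by nlinarith, by nlinarith,
    by nlinarith⟩

/-- The corner `(-2 + i)/5` has angle `π/2 + arctan 2` on the right circle and `arctan 2` on the
left one. -/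
theorem sqrt_five_mul_cos_arctan_two : √5 * Real.cos (Real.arctan 2) = 1 := by
  rw [Real.cos_arctan]
  norm_num

theorem sqrt_five_mul_sin_arctan_two : √5 * Real.sin (Real.arctan 2) = 2 := by
  rw [Real.sin_arctan]
  norm_num
  field_simp

theorem arctan_two_pos : 0 < Real.arctan 2 := Real.arctan_pos.mpr two_pos

/-- Jordan's inequality `sin δ ≥ 2δ/π` converts an angular margin `π/(2k)` into the margin `1/k`. -/
theorem one_div_le_sin {k : ℝ} (hk : 0 < k) {δ : ℝ} (h1 : Real.pi / (2 * k) ≤ δ)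
    (h2 : δ ≤ Real.pi / 2) : 1 / k ≤ Real.sin δ := by
  have hpi := Real.pi_pos
  refine le_trans ?_ (Real.mul_le_sin ((by positivity : (0 : ℝ) ≤ Real.pi / (2 * k)).trans h1) h2)
  calc 1 / k = 2 / Real.pi * (Real.pi / (2 * k)) := by field_simp
    _ ≤ 2 / Real.pi * δ := by gcongr

theorem sqrt_five_sq : √5 ^ 2 = (5 : ℝ) := Real.sq_sqrt (by norm_num)

theorem five_mul_arcPoint_zero (θ : ℝ) :
    5 * arcPoint 0 (√5 / 5) θ = (√5 : ℝ) * cexp (θ * Complex.I) := by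
  rw [arcPoint]
  push_cast
  ring

theorem ten_mul_arcPoint_neg_half (θ : ℝ) :
    10 * arcPoint (-(1 / 2)) (√5 / 10) θ + 5 = (√5 : ℝ) * cexp (θ * Complex.I) := by
  rw [arcPoint]
  push_cast
  ring

theorem arcPoint_zero_mem (θ : ℝ) :
    (arcPoint 0 (√5 / 5) θ).re ^ 2 + (arcPoint 0 (√5 / 5) θ).im ^ 2 = 1 / 5 := by
  rw [arcPoint_re, arcPoint_im]
  linear_combination (√5 ^ 2 / 25) * Real.sin_sq_add_cos_sq θ + 1 / 25 * sqrt_five_sq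

theorem arcPoint_neg_half_mem (θ : ℝ) :
    ((arcPoint (-(1 / 2)) (√5 / 10) θ).re + 1 / 2) ^ 2 +
      (arcPoint (-(1 / 2)) (√5 / 10) θ).im ^ 2 = 1 / 20 := by
  rw [arcPoint_re, arcPoint_im]
  linear_combination (√5 ^ 2 / 100) * Real.sin_sq_add_cos_sq θ + 1 / 100 * sqrt_five_sq

theorem re_ofNat_mul (n : ℕ) [n.AtLeastTwo] (z : ℂ) :
    ((OfNat.ofNat n : ℂ) * z).re = (OfNat.ofNat n : ℝ) * z.re := by simp

theorem im_ofNat_mul (n : ℕ) [n.AtLeastTwo] (z : ℂ) :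
    ((OfNat.ofNat n : ℂ) * z).im = (OfNat.ofNat n : ℝ) * z.im := by simp

/-- The `1/4` in the bound on `q` keeps the samples `πm/j` at distance `π/(4j) = π/(2k)` from the
corner angle. The bound on `p` starts them at the elliptic point `i/√5`. -/
theorem exists_zeros_rightArc {j : ℕ} (hk : 3 ≤ 2 * j) (hj : 6 ≤ j) {p q : ℤ}
    (hp : (j : ℝ) / 2 ≤ p) (hq : (q : ℝ) ≤ j / 2 + j * Real.arctan 2 / Real.pi - 1 / 4) :
    ∃ Z : Finset ℂ, q - p ≤ Z.card ∧ ∀ z ∈ Z, frickeEisenstein 5 hk z = 0 ∧ z ∈ rightArc := by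
  have hj0 : (0 : ℝ) < j := by exact_mod_cast (by omega : 0 < j)
  have hpi := Real.pi_pos
  have ha := arctan_two_pos
  have ha2 := Real.arctan_lt_pi_div_two 2
  have h5 : 0 < √5 := by positivity
  have hcos : ∀ δ, √5 * Real.cos (Real.pi / 2 + Real.arctan 2 - δ) =
      -2 * Real.cos δ + Real.sin δ := by
    intro δ
    rw [add_sub_assoc, add_comm, Real.cos_add_pi_div_two, Real.sin_sub]
    linear_combination Real.sin δ * sqrt_five_mul_cos_arctan_two -
      Real.cos δ * sqrt_five_mul_sin_arctan_two
  have hcos_neg : ∀ θ, Real.pi / 2 ≤ θ → θ ≤ Real.pi / 2 + Real.arctan 2 → Real.cos θ ≤ 0 :=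
    fun θ h1 h2 => Real.cos_nonpos_of_pi_div_two_le_of_le h1 (by linarith)
  have him : ∀ θ, Real.pi / 2 ≤ θ → θ ≤ Real.pi / 2 + Real.arctan 2 →
      0 < (arcPoint 0 (√5 / 5) θ).im := by
    intro θ h1 h2
    rw [arcPoint_im]
    exact mul_pos (by positivity) (Real.sin_pos_of_pos_of_lt_pi (by linarith) (by linarith))
  obtain ⟨Z, hZ, hZ0⟩ := exists_zeros_on_arc (c := 0) (r := √5 / 5) (A := Real.pi / 2)
    (B := Real.pi / 2 + Real.arctan 2) (p := p) (q := q) hk hj (by positivity) (by positivity)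
    (by linarith) (fun θ hθ => by
      have h1 := him θ hθ.1.le hθ.2.le
      rw [← eisensteinC_neg_conj hk (even_two_mul j) h1, neg_conj_eq_fricke (arcPoint_zero_mem θ),
        eisensteinC_neg_one_div hk (five_mul_im_pos h1), ← five_mul_arcPoint_zero])
    (fun m hm => by
      have hm1 : (p : ℝ) ≤ m := by exact_mod_cast hm.1
      have hm2 : (m : ℝ) ≤ q := by exact_mod_cast hm.2
      have hθ1 : Real.pi / 2 ≤ Real.pi * m / j := by
        rw [le_div_iff₀ hj0]
        nlinarith
      have hδ : Real.pi / (2 * (2 * j)) ≤ Real.pi / 2 + Real.arctan 2 - Real.pi * m / j := by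
        have h1 : Real.pi * m ≤
            Real.pi * (j / 2 + j * Real.arctan 2 / Real.pi - 1 / 4) := by
          gcongr
          linarith
        have h2 : Real.pi * m / j ≤
            Real.pi * (j / 2 + j * Real.arctan 2 / Real.pi - 1 / 4) / j := by gcongr
        have h3 : Real.pi * (j / 2 + j * Real.arctan 2 / Real.pi - 1 / 4) / j =
            Real.pi / 2 + Real.arctan 2 - Real.pi / (2 * (2 * j)) := by
          field_simp
          ring
        linarith
      have hδ0 : 0 < Real.pi / (2 * (2 * (j : ℝ))) := by positivity
      have hθ2 : Real.pi * m / j ≤ Real.pi / 2 + Real.arctan 2 := by linarith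
      refine ⟨⟨hθ1, hθ2⟩, ?_⟩
      set θ := Real.pi * m / j
      have hsin := one_div_le_sin (by positivity) hδ (by linarith)
      have hc := hcos (Real.pi / 2 + Real.arctan 2 - θ)
      rw [sub_sub_cancel] at hc
      have hmem := arcPoint_zero_mem θ
      have hre : (5 * arcPoint 0 (√5 / 5) θ).re = √5 * Real.cos θ := by
        rw [re_ofNat_mul, arcPoint_re]
        ring
      refine estimateRegion_of_rightArc ?_ (five_mul_im_pos (him θ hθ1 hθ2)) ?_ ?_
      · rw [re_ofNat_mul, im_ofNat_mul]
        linarith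
      · rw [hre]
        exact mul_nonpos_of_nonneg_of_nonpos h5.le (hcos_neg θ hθ1 hθ2)
      · rw [hre, hc]
        have := Real.cos_le_one (Real.pi / 2 + Real.arctan 2 - θ)
        have h0 : (0 : ℝ) ≤ 1 / (2 * (j : ℝ)) := by positivity
        push_cast
        linarith)
  refine ⟨Z, hZ, fun z hz => ⟨(hZ0 z hz).1, ?_⟩⟩
  obtain ⟨θ, hθ, rfl⟩ := (hZ0 z hz).2
  refine ⟨arcPoint_zero_mem θ, ?_, ?_, him θ hθ.1.le hθ.2.le⟩
  · have h1 := Real.cos_lt_cos_of_nonneg_of_le_pi (by linarith [hθ.1] : 0 ≤ θ) (by linarith) hθ.2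
    have h2 := hcos 0
    rw [sub_zero, Real.cos_zero, Real.sin_zero] at h2
    rw [arcPoint_re]
    nlinarith
  · have h1 := Real.cos_neg_of_pi_div_two_lt_of_lt hθ.1 (by linarith [hθ.2])
    rw [arcPoint_re]
    nlinarith

theorem exists_zeros_leftArc {j : ℕ} (hk : 3 ≤ 2 * j) (hj : 6 ≤ j) {p q : ℤ}
    (hp : j * Real.arctan 2 / Real.pi + 1 / 4 ≤ p) (hq : (q : ℝ) ≤ j / 2) :
    ∃ Z : Finset ℂ, q - p ≤ Z.card ∧ ∀ z ∈ Z, frickeEisenstein 5 hk z = 0 ∧ z ∈ leftArc := by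
  have hj0 : (0 : ℝ) < j := by exact_mod_cast (by omega : 0 < j)
  have hpi := Real.pi_pos
  have ha := arctan_two_pos
  have ha2 := Real.arctan_lt_pi_div_two 2
  have h5 : 0 < √5 := by positivity
  have hcos : ∀ δ, √5 * Real.cos (Real.arctan 2 + δ) = Real.cos δ - 2 * Real.sin δ := by
    intro δ
    rw [Real.cos_add]
    linear_combination Real.cos δ * sqrt_five_mul_cos_arctan_two -
      Real.sin δ * sqrt_five_mul_sin_arctan_two
  have hcos_nonneg : ∀ θ, Real.arctan 2 ≤ θ → θ ≤ Real.pi / 2 → 0 ≤ Real.cos θ :=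
    fun θ h1 h2 => Real.cos_nonneg_of_neg_pi_div_two_le_of_le (by linarith) h2
  have him : ∀ θ, Real.arctan 2 ≤ θ → θ ≤ Real.pi / 2 →
      0 < (arcPoint (-(1 / 2)) (√5 / 10) θ).im := by
    intro θ h1 h2
    rw [arcPoint_im]
    exact mul_pos (by positivity) (Real.sin_pos_of_pos_of_lt_pi (by linarith) (by linarith))
  obtain ⟨Z, hZ, hZ0⟩ := exists_zeros_on_arc (c := -(1 / 2)) (r := √5 / 10) (A := Real.arctan 2)
    (B := Real.pi / 2) (p := p) (q := q) hk hj (by positivity) ha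
    (by linarith) (fun θ hθ => by
      have h1 := him θ hθ.1.le hθ.2.le
      rw [← eisensteinC_neg_conj hk (even_two_mul j) h1,
        ← sub_add_cancel (-conj (arcPoint (-(1 / 2)) (√5 / 10) θ)) 1, eisensteinC_add_one,
        neg_conj_sub_one_eq_frickeV h1 (arcPoint_neg_half_mem θ),
        eisensteinC_frickeV hk (even_two_mul j) h1, ten_mul_arcPoint_neg_half])
    (fun m hm => by
      have hm1 : (p : ℝ) ≤ m := by exact_mod_cast hm.1
      have hm2 : (m : ℝ) ≤ q := by exact_mod_cast hm.2
      have hθ2 : Real.pi * m / j ≤ Real.pi / 2 := by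
        rw [div_le_iff₀ hj0]
        nlinarith
      have hδ : Real.pi / (2 * (2 * j)) ≤ Real.pi * m / j - Real.arctan 2 := by
        have h1 : Real.pi * (j * Real.arctan 2 / Real.pi + 1 / 4) ≤ Real.pi * m := by
          gcongr
          linarith
        have h2 : Real.pi * (j * Real.arctan 2 / Real.pi + 1 / 4) / j ≤ Real.pi * m / j := by
          gcongr
        have h3 : Real.pi * (j * Real.arctan 2 / Real.pi + 1 / 4) / j =
            Real.arctan 2 + Real.pi / (2 * (2 * j)) := by
          field_simp
          ring
        linarith
      have hδ0 : 0 < Real.pi / (2 * (2 * (j : ℝ))) := by positivity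
      have hθ1 : Real.arctan 2 ≤ Real.pi * m / j := by linarith
      refine ⟨⟨hθ1, hθ2⟩, ?_⟩
      set θ := Real.pi * m / j
      have hsin := one_div_le_sin (by positivity) hδ (by linarith)
      have hc := hcos (θ - Real.arctan 2)
      rw [add_sub_cancel] at hc
      have hmem := arcPoint_neg_half_mem θ
      have hre : (5 * arcPoint (-(1 / 2)) (√5 / 10) θ).re = -(5 / 2) + √5 * Real.cos θ / 2 := by
        rw [re_ofNat_mul, arcPoint_re]
        ring
      refine estimateRegion_of_leftArc ?_ (five_mul_im_pos (him θ hθ1 hθ2)) ?_ ?_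
      · rw [re_ofNat_mul, im_ofNat_mul]
        linarith
      · rw [hre]
        have := mul_nonneg h5.le (hcos_nonneg θ hθ1 hθ2)
        linarith
      · rw [hre, hc]
        have := Real.cos_le_one (θ - Real.arctan 2)
        push_cast
        linarith)
  refine ⟨Z, hZ, fun z hz => ⟨(hZ0 z hz).1, ?_⟩⟩
  obtain ⟨θ, hθ, rfl⟩ := (hZ0 z hz).2
  refine ⟨arcPoint_neg_half_mem θ, ?_, ?_, him θ hθ.1.le hθ.2.le⟩
  · have h1 := Real.cos_pos_of_mem_Ioo ⟨by linarith [hθ.1], hθ.2⟩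
    rw [arcPoint_re]
    nlinarith
  · have h1 := Real.cos_lt_cos_of_nonneg_of_le_pi ha.le (by linarith [hθ.2]) hθ.1
    have h2 := sqrt_five_mul_cos_arctan_two
    rw [arcPoint_re]
    nlinarith

/-- The open arcs carry at least `⌊k / 4⌋ - 2` zeros of `E*_{k,5}`. -/
theorem exists_zeros_arcs {k : ℕ} (hk : 3 ≤ k) (hk2 : Even k) :
    ∃ Z : Finset ℂ, k / 2 ≤ 2 * Z.card + 5 ∧
      ∀ z ∈ Z, frickeEisenstein 5 hk z = 0 ∧ z ∈ rightArc ∪ leftArc := by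
  classical
  obtain ⟨j, rfl⟩ := hk2.two_dvd
  by_cases hj : 6 ≤ j
  swap
  -- Here `k ≤ 10`, and the slack `5` alone suffices.
  · exact ⟨∅, by rw [Finset.card_empty]; omega, by simp⟩
  set b : ℝ := j * Real.arctan 2 / Real.pi
  obtain ⟨p₁, q₁, p₂, q₂, h1, h2, h3, h4, h5⟩ : ∃ p₁ q₁ p₂ q₂ : ℤ, (j : ℝ) / 2 ≤ p₁ ∧
      (q₁ : ℝ) ≤ j / 2 + b - 1 / 4 ∧ b + 1 / 4 ≤ p₂ ∧ (q₂ : ℝ) ≤ j / 2 ∧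
      (j : ℤ) ≤ 2 * ((q₁ - p₁) + (q₂ - p₂)) + 5 := by
    -- In both cases `(q₁ - p₁) + (q₂ - p₂) ≥ n - 2`. For even `j` the two roundings differ by at
    -- most `2`. For odd `j` one gap is lost at the angle `π/2`, but the same number `b + 1/4` is
    -- rounded both ways, at the cost of at most `1`.
    rcases Nat.even_or_odd' j with ⟨n, hn | hn⟩
    · have hjn : (j : ℝ) / 2 = n := by rw [hn]; push_cast; ring
      refine ⟨n, n + ⌊b - 1 / 4⌋, ⌈b + 1 / 4⌉, n, ?_, ?_, Int.le_ceil _, ?_, ?_⟩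
      · rw [hjn]; simp
      · have := Int.floor_le (b - 1 / 4)
        rw [hjn]; push_cast; linarith
      · rw [hjn]; simp
      · have : ⌈b + 1 / 4⌉ < ⌊b - 1 / 4⌋ + 3 := by
          have h1 := Int.ceil_lt_add_one (b + 1 / 4)
          have h2 := Int.lt_floor_add_one (b - 1 / 4)
          have : (⌈b + 1 / 4⌉ : ℝ) < ⌊b - 1 / 4⌋ + 3 := by linarith
          exact_mod_cast this
        omega
    · have hjn : (j : ℝ) / 2 = n + 1 / 2 := by rw [hn]; push_cast; ring
      refine ⟨n + 1, n + ⌊b + 1 / 4⌋, ⌈b + 1 / 4⌉, n, ?_, ?_, Int.le_ceil _, ?_, ?_⟩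
      · rw [hjn]; push_cast; linarith
      · have := Int.floor_le (b + 1 / 4)
        rw [hjn]; push_cast; linarith
      · rw [hjn]; simp
      · have := Int.ceil_le_floor_add_one (b + 1 / 4)
        omega
  obtain ⟨Z₁, hc₁, hZ₁⟩ := exists_zeros_rightArc hk hj h1 h2
  obtain ⟨Z₂, hc₂, hZ₂⟩ := exists_zeros_leftArc hk hj h3 h4
  have hdisj : Disjoint Z₁ Z₂ := by
    rw [Finset.disjoint_left]
    intro z hz1 hz2
    have a1 := (hZ₁ z hz1).2.2.1
    have a2 := (hZ₂ z hz2).2.2.2.1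
    linarith
  refine ⟨Z₁ ∪ Z₂, ?_, ?_⟩
  · rw [Finset.card_union_of_disjoint hdisj]
    omega
  · intro z hz
    rcases Finset.mem_union.mp hz with h | h
    · exact ⟨(hZ₁ z h).1, Or.inl (hZ₁ z h).2⟩
    · exact ⟨(hZ₂ z h).1, Or.inr (hZ₂ z h).2⟩

/-! ### Comparison of the two counts -/

theorem sum_rootMultiplicity_le_natDegree (P : Polynomial ℂ) (A : Finset ℂ) :
    ∑ a ∈ A, P.rootMultiplicity a ≤ P.natDegree := by
  classical
  refine le_trans ?_ P.card_roots'
  rw [← Multiset.toFinset_sum_count_eq]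
  simp only [← Polynomial.count_roots]
  refine Finset.sum_le_sum_of_ne_zero fun a _ ha => ?_
  rwa [Multiset.mem_toFinset, ← Multiset.count_ne_zero]

theorem lt_sq_add_sq_of_lt_norm {c : ℝ} (hc : 0 ≤ c) {z : ℂ} (h : c < ‖z‖) :
    c ^ 2 < z.re ^ 2 + z.im ^ 2 := by
  have h1 := pow_lt_pow_left₀ h hc two_ne_zero
  rw [← Complex.normSq_eq_norm_sq, Complex.normSq_apply] at h1
  linarith

theorem one_div_sqrt_five_sq : (1 / √((5 : ℕ) : ℝ)) ^ 2 = 1 / 5 := by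
  rw [div_pow, Real.sq_sqrt (by norm_num)]
  norm_num

theorem one_div_two_sqrt_five_sq : (1 / (2 * √((5 : ℕ) : ℝ))) ^ 2 = 1 / 20 := by
  rw [div_pow, mul_pow, Real.sq_sqrt (by norm_num)]
  norm_num

/-- Points of the fundamental domain off the arc lie outside both circles and in `regularSet`. -/
theorem mem_regularSet_of_notMem_frickeArc {z : ℂ} (hz : z ∈ frickeDomain 5)
    (hA : z ∉ frickeArc 5) : z ∈ regularSet ∧ 1 / 5 < z.re ^ 2 + z.im ^ 2 ∧
      1 / 20 < (z.re + 1 / 2) ^ 2 + z.im ^ 2 := by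
  have hA' : ¬(‖z‖ = 1 / √((5 : ℕ) : ℝ) ∨ ‖z + 1 / 2‖ = 1 / (2 * √((5 : ℕ) : ℝ))) :=
    fun h => hA ⟨hz, h⟩
  rw [not_or] at hA'
  have e1 : (0 : ℝ) ≤ 1 / √((5 : ℕ) : ℝ) := by positivity
  have e2 : (0 : ℝ) ≤ 1 / (2 * √((5 : ℕ) : ℝ)) := by positivity
  rcases hz with ⟨him, h1, h2, h3, h4⟩ | ⟨him, h1, h2, h3, h4⟩
  · have f1 := lt_sq_add_sq_of_lt_norm e1 (lt_of_le_of_ne h1 (Ne.symm hA'.1))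
    have f2 := lt_sq_add_sq_of_lt_norm e2 (lt_of_le_of_ne h2 (Ne.symm hA'.2))
    rw [one_div_sqrt_five_sq] at f1
    rw [one_div_two_sqrt_five_sq, add_re, add_im,
      show (1 / 2 : ℂ).re = 1 / 2 by norm_num, show (1 / 2 : ℂ).im = 0 by norm_num, add_zero] at f2
    refine ⟨?_, f1, f2⟩
    rcases h3.eq_or_lt with h3 | h3
    · refine Or.inr (Or.inr ⟨h3.symm, ?_, him⟩)
      rw [← h3] at f2
      linarith
    rcases h4.eq_or_lt with h4 | h4
    · refine Or.inr (Or.inl (Or.inl (Or.inl ⟨h4, ?_, him⟩)))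
      rw [h4] at f1
      linarith
    · exact Or.inl (Or.inl ⟨h3, h4, f1, f2, him⟩)
  · have f1 := lt_sq_add_sq_of_lt_norm e1 h1
    have f2 := lt_sq_add_sq_of_lt_norm e2 h2
    rw [one_div_sqrt_five_sq] at f1
    rw [one_div_two_sqrt_five_sq, sub_re, sub_im,
      show (1 / 2 : ℂ).re = 1 / 2 by norm_num, show (1 / 2 : ℂ).im = 0 by norm_num, sub_zero] at f2
    refine ⟨?_, f1, by linarith⟩
    rcases h3.eq_or_lt with h3 | h3
    · refine Or.inr (Or.inl (Or.inl (Or.inl ⟨h3.symm, ?_, him⟩)))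
      rw [← h3] at f1
      linarith
    · refine Or.inl (Or.inr ?_)
      rw [rightHalf, mem_ofPred_eq, leftHalf, mem_ofPred_eq, neg_re, neg_im, conj_re, conj_im]
      exact ⟨by linarith, by linarith, by linarith, by linarith, by linarith⟩

theorem arcs_subset_regularSet : rightArc ∪ leftArc ⊆ regularSet := by
  rintro z (h | h)
  · exact Or.inr (Or.inl (Or.inl (Or.inr h)))
  · exact Or.inr (Or.inl (Or.inr h))

/-- For even `k ≥ 4`, the zeros of `E*_{k,5}` in `𝔽*(5)` that do not lie on `A*_5` are finite in
number, and there are at most two of them, counted with multiplicity. -/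
theorem mainTheorem6 (k : ℕ) (hk : 4 ≤ k) (hk2 : Even k) :
    {z ∈ frickeDomain 5 |
      frickeEisenstein 5 (le_trans (by norm_num) hk : 3 ≤ k) z = 0 ∧ z ∉ frickeArc 5}.Finite ∧
    (∑ᶠ z ∈ {z ∈ frickeDomain 5 |
        frickeEisenstein 5 (le_trans (by norm_num) hk : 3 ≤ k) z = 0 ∧ z ∉ frickeArc 5},
      analyticOrderAt (frickeEisenstein 5 (le_trans (by norm_num) hk : 3 ≤ k)) z) ≤ 2 := by
  classical
  have hk3 : 3 ≤ k := le_trans (by norm_num) hk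
  obtain ⟨P, hP0, hPdeg, hP⟩ := exists_polynomial_rootMultiplicity hk3 hk2
  obtain ⟨Z, hZcard, hZ⟩ := exists_zeros_arcs hk3 hk2
  set S : Set ℂ := {z ∈ frickeDomain 5 |
    frickeEisenstein 5 (le_trans (by norm_num) hk : 3 ≤ k) z = 0 ∧ z ∉ frickeArc 5}
  have hS : ∀ z ∈ S, z ∈ regularSet ∧ 1 / 5 < z.re ^ 2 + z.im ^ 2 ∧
      1 / 20 < (z.re + 1 / 2) ^ 2 + z.im ^ 2 := fun z hz =>
    mem_regularSet_of_notMem_frickeArc hz.1 hz.2.2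
  have horder : ∀ z ∈ regularSet, frickeEisenstein 5 hk3 z = 0 →
      2 ≤ P.rootMultiplicity (hauptmodul z) := by
    intro z hz h0
    have h1 : 1 ≤ analyticOrderAt (frickeEisenstein 5 hk3) z := by
      rw [Order.one_le_iff_ne_zero, Ne, AnalyticAt.analyticOrderAt_eq_zero
        (frickeEisenstein_analyticAt (by norm_num) hk3 (regularSet_im_pos hz))]
      exact not_not_intro h0
    have h2 : (2 : ℕ∞) * 1 ≤ 2 * analyticOrderAt (frickeEisenstein 5 hk3) z := by gcongr
    rw [hP z hz, mul_one] at h2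
    exact_mod_cast h2
  have hfin : S.Finite := by
    refine Finite.of_finite_image (P.roots.toFinset.finite_toSet.subset ?_)
      (hauptmodul_injOn_regularSet.mono fun z hz => (hS z hz).1)
    rintro _ ⟨z, hz, rfl⟩
    have := horder z (hS z hz).1 hz.2.1
    rw [Finset.mem_coe, Multiset.mem_toFinset, Polynomial.mem_roots hP0,
      ← Polynomial.rootMultiplicity_pos hP0]
    omega
  refine ⟨hfin, ?_⟩
  rw [finsum_mem_eq_finite_toFinset_sum _ hfin]
  have hmemT : ∀ z ∈ hfin.toFinset, z ∈ S := fun z hz => hfin.mem_toFinset.mp hz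
  -- Points of `S` lie strictly outside both circles, while the zeros in `Z` lie on them.
  have hdisj : Disjoint hfin.toFinset Z := by
    rw [Finset.disjoint_left]
    intro z hz1 hz2
    obtain ⟨-, h1, h2⟩ := hS z (hmemT z hz1)
    rcases (hZ z hz2).2 with h | h
    · exact h1.ne' h.1
    · exact h2.ne' h.1
  have hreg : ∀ z ∈ hfin.toFinset ∪ Z, z ∈ regularSet := by
    intro z hz
    rcases Finset.mem_union.mp hz with h | h
    · exact (hS z (hmemT z h)).1
    · exact arcs_subset_regularSet (hZ z h).2
  have hsum := sum_rootMultiplicity_le_natDegree P ((hfin.toFinset ∪ Z).image hauptmodul)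
  rw [Finset.sum_image (hauptmodul_injOn_regularSet.mono hreg), Finset.sum_union hdisj] at hsum
  have hZsum : Z.card * 2 ≤ ∑ z ∈ Z, P.rootMultiplicity (hauptmodul z) :=
    Finset.card_nsmul_le_sum Z _ 2 fun z hz =>
      horder z (arcs_subset_regularSet (hZ z hz).2) (hZ z hz).1
  have hTsum : 2 * ∑ z ∈ hfin.toFinset, analyticOrderAt (frickeEisenstein 5 hk3) z =
      ((∑ z ∈ hfin.toFinset, P.rootMultiplicity (hauptmodul z) : ℕ) : ℕ∞) := by
    rw [Finset.mul_sum, Nat.cast_sum]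
    exact Finset.sum_congr rfl fun z hz => hP z (hS z (hmemT z hz)).1
  -- Each zero in `Z` uses at least `2` of the degree, which is at most `k/2 ≤ 2|Z| + 5`. What
  -- remains is twice a total order, so `5` yields `2`.
  have hle : ∑ z ∈ hfin.toFinset, P.rootMultiplicity (hauptmodul z) ≤ 5 := by omega
  change ∑ z ∈ hfin.toFinset, analyticOrderAt (frickeEisenstein 5 hk3) z ≤ 2
  generalize ∑ z ∈ hfin.toFinset, analyticOrderAt (frickeEisenstein 5 hk3) z = a at hTsum ⊢
  induction a using ENat.recTopCoe with
  | top => exact absurd hTsum (by rw [ENat.mul_top two_ne_zero]; exact ENat.top_ne_natCast _)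
  | coe a =>
    have : 2 * a = ∑ z ∈ hfin.toFinset, P.rootMultiplicity (hauptmodul z) := by
      exact_mod_cast hTsum
    exact_mod_cast (by omega : a ≤ 2)

end
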